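/- Let $p$ be an odd prime, $F$ a number field with algebraic closure $\bar F$, and $E/F$ an elliptic curve with good reduction at every prime of $F$ above $p$. Let $F_\infty\subset\bar F$ be a $\mathbb{Z}_p$-extension of $F$, i.e. a Galois extension with $\Gamma=\mathrm{Gal}(F_\infty/F)$ topologically isomorphic to $\mathbb{Z}_p$. Let $\gamma$ be a topological generator of $\Gamma$ and identify the Iwasawa algebra $\Lambda=\varprojlim_n \mathbb{Z}_p[\Gamma/\Gamma^{p^n}]$ with $\mathbb{Z}_p[[T]]$ by $T=\gamma-1$. Let $S$ be the (finite) set of finite primes $v$ of $F$ such that $v\mid p$ or $E$ has bad reduction at $v$, and let $F_S\subset\bar F$ be the maximal extension of $F$ in which every finite prime $v\notin S$ is unramified; it contains $F_\infty$. For $M=E[p]$ and $M=E[p^\infty]$ put $\mathcal{H}_v(F_\infty,M)=\prod_{w\mid v}H^1(F_{\infty,w},M)$, where $w$ runs over the primes of $F_\infty$ above $v$, $F_{\infty,w}$ is the completion of $F_\infty$ at $w$, and $H^1$ is continuous Galois cohomology. Define $$R(M/F_\infty)=\ker\Big(H^1(\mathrm{Gal}(F_S/F_\infty),M)\longrightarrow\bigoplus_{v\in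 S}\mathcal{H}_v(F_\infty,M)\Big)$$ (restriction maps), and write $R(E/F_\infty)=R(E[p^\infty]/F_\infty)$ for the fine Selmer group, a discrete $\Lambda$-module with Pontryagin dual $R(E/F_\infty)^\vee=\mathrm{Hom}(R(E/F_\infty),\mathbb{Q}_p/\mathbb{Z}_p)$. Let $$h:\bigoplus_{v\in S}\mathcal{H}_v(F_\infty,E[p])\longrightarrow\bigoplus_{v\in S}\mathcal{H}_v(F_\infty,E[p^\infty])[p]$$ be the map induced by the inclusion $E[p]\subset E[p^\infty]$. For a finitely generated $\Lambda$-module $X$ there is a $\Lambda$-homomorphism with finite kernel and cokernel $$X\to\Lambda^r\oplus\bigoplus_{i=1}^s\Lambda/(p^{\mu_i})\oplus\bigoplus_{j=1}^t\Lambda/(f_j^{\lambda_j})$$ with $r\ge 0$, positive integers $\mu_i,\lambda_j$ and irreducible distinguished polynomials $f_j$; put $\mu(X)=\sum_i\mu_i$ and $\lambda(X)=\sum_j\lambda_j\deg f_j$. Write $\mu(E/F_\infty)$ and $\lambda(E/F_\infty)$ for the invariants of $R(E/F_\infty)^\vee$. Assume that $\ker(h)$ is finite and that the residual fine Selmer group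 $R(E[p]/F_\infty)$ is finite. Then $R(E/F_\infty)^\vee$ is a finitely generated torsion $\Lambda$-module with $\mu(E/F_\infty)=0$, and $$\lambda(E/F_\infty)\le\dim_{\mathbb{Z}/p\mathbb{Z}}R(E[p]/F_\infty)+\dim_{\mathbb{Z}/p\mathbb{Z}}\ker(h).$$ -/

import Mathlib

noncomputable section

/-! ### Continuous cohomology in degree one with discrete coefficients -/

namespace ContH1

variable {G G' M M' : Type*} [Group G] [TopologicalSpace G] [Group G'] [TopologicalSpace G']
  [AddCommGroup M] [AddCommGroup M']

/-- Continuous 1-cocycles of `G` with values in the discrete `G`-module `M`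
(for a discrete target, continuous means locally constant). -/
def Z1 (ρ : G →* AddMonoid.End M) : AddSubgroup (G → M) where
  carrier := {c | IsLocallyConstant c ∧ ∀ g h, c (g * h) = c g + ρ g (c h)}
  zero_mem' := ⟨IsLocallyConstant.const 0, by simp⟩
  add_mem' := by
    rintro a b ⟨ha, ha'⟩ ⟨hb, hb'⟩
    refine ⟨ha.add hb, fun g h => ?_⟩
    simp only [Pi.add_apply, ha', hb', map_add]
    abel
  neg_mem' := by
    rintro a ⟨ha, ha'⟩
    refine ⟨ha.neg, fun g h => ?_⟩
    simp only [Pi.neg_apply, ha', map_neg]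
    abel

/-- 1-coboundaries `g ↦ g m - m`. -/
def B1 (ρ : G →* AddMonoid.End M) : AddSubgroup (Z1 ρ) where
  carrier := {c | ∃ m : M, ∀ g, c.1 g = ρ g m - m}
  zero_mem' := ⟨0, by simp⟩
  add_mem' := by
    rintro a b ⟨m, hm⟩ ⟨n, hn⟩
    refine ⟨m + n, fun g => ?_⟩
    simp only [AddSubgroup.coe_add, Pi.add_apply, hm, hn, map_add]
    abel
  neg_mem' := by
    rintro a ⟨m, hm⟩
    refine ⟨-m, fun g => ?_⟩
    simp only [AddSubgroup.coe_neg, Pi.neg_apply, hm, map_neg]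
    abel

/-- The first continuous cohomology group `H¹(G, M)` of a discrete `G`-module `M`. -/
def H1 (ρ : G →* AddMonoid.End M) : Type _ := Z1 ρ ⧸ B1 ρ

instance (ρ : G →* AddMonoid.End M) : AddCommGroup (H1 ρ) :=
  inferInstanceAs (AddCommGroup (Z1 ρ ⧸ B1 ρ))

/-- The class of a cocycle. -/
def H1.mk (ρ : G →* AddMonoid.End M) : Z1 ρ →+ H1 ρ := QuotientAddGroup.mk' (B1 ρ)

theorem H1.mk_surjective (ρ : G →* AddMonoid.End M) : Function.Surjective (H1.mk ρ) :=
  QuotientAddGroup.mk'_surjective (B1 ρ)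

/-- The map on cocycles induced by a continuous homomorphism `φ : G' → G` and a compatible
homomorphism `u : M → M'`: `c ↦ u ∘ c ∘ φ`. -/
def Z1.map {ρ : G →* AddMonoid.End M} {ρ' : G' →* AddMonoid.End M'}
    (φ : G' →* G) (hφ : Continuous φ) (u : M →+ M')
    (hu : ∀ g m, u (ρ (φ g) m) = ρ' g (u m)) : Z1 ρ →+ Z1 ρ' where
  toFun c := ⟨fun g => u (c.1 (φ g)), (c.2.1.comp_continuous hφ).comp u, fun g h => by
    simp only [map_mul, c.2.2, map_add, hu]⟩
  map_zero' := by ext g; simp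
  map_add' a b := by ext g; simp

/-- The map `H¹(G, M) → H¹(G', M')` induced by a continuous homomorphism `φ : G' → G` and a
compatible homomorphism `u : M → M'`. -/
def H1.map {ρ : G →* AddMonoid.End M} {ρ' : G' →* AddMonoid.End M'}
    (φ : G' →* G) (hφ : Continuous φ) (u : M →+ M')
    (hu : ∀ g m, u (ρ (φ g) m) = ρ' g (u m)) : H1 ρ →+ H1 ρ' :=
  QuotientAddGroup.map (B1 ρ) (B1 ρ') (Z1.map φ hφ u hu) (by
    rintro c ⟨m, hm⟩
    exact ⟨u m, fun g => by simp [Z1.map, hm, hu]⟩)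

theorem H1.map_mk {ρ : G →* AddMonoid.End M} {ρ' : G' →* AddMonoid.End M'}
    (φ : G' →* G) (hφ : Continuous φ) (u : M →+ M')
    (hu : ∀ g m, u (ρ (φ g) m) = ρ' g (u m)) (c : Z1 ρ) :
    H1.map φ hφ u hu (H1.mk ρ c) = H1.mk ρ' (Z1.map φ hφ u hu c) := rfl

theorem H1.mk_eq_zero {ρ : G →* AddMonoid.End M} (c : Z1 ρ) :
    H1.mk ρ c = 0 ↔ ∃ m : M, ∀ g, c.1 g = ρ g m - m :=
  QuotientAddGroup.eq_zero_iff c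

theorem H1.nsmul_eq_zero {ρ : G →* AddMonoid.End M} {n : ℕ} (h : ∀ m : M, n • m = 0)
    (c : H1 ρ) : n • c = 0 := by
  obtain ⟨c, rfl⟩ := H1.mk_surjective ρ c
  have : n • c = 0 := by ext g; simp [h]
  rw [← map_nsmul, this, map_zero]

theorem H1.map_mk_eq_zero {ρ : G →* AddMonoid.End M} {ρ' : G' →* AddMonoid.End M'}
    (φ : G' →* G) (hφ : Continuous φ) (u : M →+ M')
    (hu : ∀ g m, u (ρ (φ g) m) = ρ' g (u m)) (c : Z1 ρ) :
    H1.map φ hφ u hu (H1.mk ρ c) = 0 ↔ ∃ m : M', ∀ g, u (c.1 (φ g)) = ρ' g m - m :=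
  H1.mk_eq_zero (Z1.map φ hφ u hu c)

end ContH1

/-! ### Torsion -/

/-- `A[p ^ k]` for `k : ℕ∞`; for `k = ⊤` this is the `p`-primary torsion subgroup `A[p ^ ∞]`. -/
def pTors (p : ℕ) (k : ℕ∞) (A : Type*) [AddCommGroup A] : AddSubgroup A where
  carrier := {a | ∃ n : ℕ, (n : ℕ∞) ≤ k ∧ p ^ n • a = 0}
  zero_mem' := ⟨0, by simp, by simp⟩
  add_mem' := by
    rintro a b ⟨m, hm, ha⟩ ⟨n, hn, hb⟩
    rcases le_total m n with h | h
    · refine ⟨n, hn, ?_⟩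
      obtain ⟨d, rfl⟩ := Nat.exists_eq_add_of_le h
      rw [smul_add, hb, pow_add, mul_comm, mul_smul, ha]; simp
    · refine ⟨m, hm, ?_⟩
      obtain ⟨d, rfl⟩ := Nat.exists_eq_add_of_le h
      rw [smul_add, ha, pow_add, mul_comm, mul_smul, hb]; simp
  neg_mem' := by
    rintro a ⟨n, hn, ha⟩
    exact ⟨n, hn, by rw [smul_neg, ha, neg_zero]⟩

/-- A homomorphism `A → B` restricts to `A[p ^ k] → B[p ^ k]`. -/
def pTors.map (p : ℕ) (k : ℕ∞) {A B : Type*} [AddCommGroup A] [AddCommGroup B] (f : A →+ B) :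
    pTors p k A →+ pTors p k B :=
  (f.comp (pTors p k A).subtype).codRestrict (pTors p k B) (by
    rintro ⟨a, n, hn, ha⟩
    exact ⟨n, hn, by simp [← map_nsmul, ha]⟩)

/-- The inclusion `A[p ^ k] → A[p ^ ∞]`. -/
def pTors.incl (p : ℕ) (k : ℕ∞) (A : Type*) [AddCommGroup A] :
    pTors p k A →+ pTors p ⊤ A :=
  AddSubgroup.inclusion (by rintro a ⟨n, -, ha⟩; exact ⟨n, le_top, ha⟩)

/-- The action on `A[p ^ k]` induced by an action on `A`. -/
def pTors.rep (p : ℕ) (k : ℕ∞) {G A : Type*} [Group G] [AddCommGroup A]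
    (ρ : G →* AddMonoid.End A) : G →* AddMonoid.End (pTors p k A) where
  toFun g := pTors.map p k (ρ g)
  map_one' := by rw [map_one]; rfl
  map_mul' g h := by rw [map_mul]; rfl

theorem pTors.nsmul_eq_zero {p : ℕ} {A : Type*} [AddCommGroup A] (a : pTors p 1 A) :
    p • a = 0 := by
  obtain ⟨a, n, hn, ha⟩ := a
  ext
  have hn : n ≤ 1 := by exact_mod_cast hn
  change p • a = 0
  interval_cases n
  · simp at ha; simp [ha]
  · simpa using ha


/-! ### Completions and local Galois groups -/

/-- The completion `L_w` of a field `L` at a place `w`, a place being given by its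
valuation ring. -/
def CompletionAt {L : Type*} [Field L] (w : ValuationSubring L) : Type _ :=
  w.valuation.Completion

namespace CompletionAt

variable {L : Type*} [Field L] (w : ValuationSubring L)

instance : Field (CompletionAt w) := inferInstanceAs (Field w.valuation.Completion)

/-- The canonical embedding `L → L_w`. -/
def emb : L →+* CompletionAt w :=
  (UniformSpace.Completion.coeRingHom (α := WithVal w.valuation)).comp
    (WithVal.equiv w.valuation).symm.toRingHom

instance {F : Type*} [CommSemiring F] [Algebra F L] : Algebra F (CompletionAt w) :=
  ((emb w).comp (algebraMap F L)).toAlgebra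

theorem algebraMap_eq (x : L) : algebraMap L (CompletionAt w) x = emb w x := rfl

instance {F : Type*} [CommSemiring F] [Algebra F L] : IsScalarTower F L (CompletionAt w) :=
  IsScalarTower.of_algebraMap_eq fun _ => rfl

variable {w}

theorem continuous_congr {w' : ValuationSubring L} (σ : L ≃+* L)
    (h : ∀ x, x ∈ w' ↔ σ x ∈ w) :
    Continuous (WithVal.congr w'.valuation w.valuation σ) := by
  have hlt : ∀ x y, w'.valuation x < w'.valuation y ↔ w.valuation (σ x) < w.valuation (σ y) := by
    have he : w'.valuation.IsEquiv (w.valuation.comap (σ : L →+* L)) := by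
      refine Valuation.isEquiv_of_val_le_one fun x => ?_
      simp [ValuationSubring.valuation_le_one_iff, h]
    exact fun x y => he.lt_iff_lt
  refine continuous_of_continuousAt_zero (WithVal.congr w'.valuation w.valuation σ) ?_
  simp_rw [ContinuousAt, map_zero, (Valued.hasBasis_nhds_zero _ _).tendsto_iff
    (Valued.hasBasis_nhds_zero _ _), true_and, forall_const]
  intro γ
  obtain ⟨r, s, hr, hs, hrs⟩ := Valuation.restrict_exists_div_eq
    (Valued.v (R := WithVal w.valuation)) γ
  have hr0 : r ≠ 0 := fun h0 => by simp [h0] at hr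
  have hs0 : s ≠ 0 := fun h0 => by simp [h0] at hs
  obtain ⟨a, ha⟩ : ∃ a : WithVal w'.valuation,
      WithVal.congr w'.valuation w.valuation σ a = r / s :=
    (WithVal.congr w'.valuation w.valuation σ).surjective _
  have ha0 : Valued.v.restrict a ≠ 0 := by
    rw [Valuation.ne_zero_iff]
    rintro rfl
    rw [map_zero] at ha
    exact div_ne_zero hr0 hs0 ha.symm
  refine ⟨Units.mk0 _ ha0, fun x hx => ?_⟩
  rw [Set.mem_ofPred_eq, ← hrs, ← map_div₀, ← ha, Valuation.restrict_lt_iff]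
  rw [Set.mem_ofPred_eq, Units.val_mk0, Valuation.restrict_lt_iff] at hx
  exact (hlt _ _).1 hx

/-- An automorphism of `L` that carries the place `w'` to the place `w` extends to an
isomorphism of the completions. -/
def congr {w' : ValuationSubring L} (σ : L ≃+* L)
    (h : ∀ x, x ∈ w' ↔ σ x ∈ w) : CompletionAt w' ≃+* CompletionAt w :=
  UniformSpace.Completion.mapRingEquiv (WithVal.congr w'.valuation w.valuation σ)
    (continuous_congr σ h)
    (continuous_congr σ.symm (fun x => by simp [h]))

theorem congr_emb {w' : ValuationSubring L} (σ : L ≃+* L)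
    (h : ∀ x, x ∈ w' ↔ σ x ∈ w) (x : L) : congr σ h (emb w' x) = emb w (σ x) :=
  UniformSpace.Completion.mapRingHom_coe (continuous_congr σ h) (WithVal.toVal _ x)

end CompletionAt

section resHom

variable {F Ω K : Type*} [Field F] [Field Ω] [Field K] [Algebra F Ω] [Algebra F K]

/-- Restriction `Gal(K̄/K) → Gal(Ω/F)` along an embedding `ι : Ω → K̄` over `F`,
for a normal extension `Ω/F`. -/
def resHom [Normal F Ω] (ι : Ω →ₐ[F] AlgebraicClosure K) :
    Gal(AlgebraicClosure K/K) →* Gal(Ω/F) :=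
  letI : Algebra Ω (AlgebraicClosure K) := ι.toRingHom.toAlgebra
  haveI : IsScalarTower F Ω (AlgebraicClosure K) :=
    IsScalarTower.of_algebraMap_eq fun x => (ι.commutes x).symm
  (AlgEquiv.restrictNormalHom Ω).comp (AlgEquiv.restrictScalarsHom F)

theorem resHom_commutes [Normal F Ω] (ι : Ω →ₐ[F] AlgebraicClosure K)
    (τ : Gal(AlgebraicClosure K/K)) (x : Ω) : ι (resHom ι τ x) = τ (ι x) := by
  let _ : Algebra Ω (AlgebraicClosure K) := ι.toRingHom.toAlgebra
  have : IsScalarTower F Ω (AlgebraicClosure K) :=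
    IsScalarTower.of_algebraMap_eq fun x => (ι.commutes x).symm
  exact AlgEquiv.restrictNormal_commutes (τ.restrictScalars F) Ω x

theorem resHom_continuous [Normal F Ω] (ι : Ω →ₐ[F] AlgebraicClosure K) :
    Continuous (resHom ι) := by
  refine continuous_of_continuousAt_one (resHom ι) ?_
  rw [ContinuousAt, map_one]
  intro s hs
  rw [krullTopology_mem_nhds_one_iff] at hs
  obtain ⟨E, hE, hs⟩ := hs
  rw [Filter.mem_map, krullTopology_mem_nhds_one_iff]
  obtain ⟨t, ht⟩ := (IntermediateField.essFiniteType_iff (K := E)).1 inferInstance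
  refine ⟨IntermediateField.adjoin K (ι '' t), ?_, ?_⟩
  · have : (ι '' (t : Set Ω)).Finite := t.finite_toSet.image _
    have := this.to_subtype
    exact IntermediateField.finiteDimensional_adjoin fun x _ =>
      Algebra.IsIntegral.isIntegral x
  · intro τ hτ
    refine hs ?_
    rw [SetLike.mem_coe, ← ht, IntermediateField.mem_fixingSubgroup_iff]
    rw [SetLike.mem_coe, IntermediateField.mem_fixingSubgroup_iff] at hτ
    have key : IntermediateField.adjoin F (t : Set Ω) ≤
        IntermediateField.fixedField (Subgroup.zpowers (resHom ι τ)) := by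
      rw [IntermediateField.adjoin_le_iff]
      intro x hx
      rw [SetLike.mem_coe, IntermediateField.mem_fixedField_iff]
      have h1 : resHom ι τ x = x := ι.injective (by
        refine (resHom_commutes ι τ x).trans ?_
        exact hτ _ (IntermediateField.subset_adjoin _ _ ⟨x, hx, rfl⟩))
      have : Subgroup.zpowers (resHom ι τ) ≤ MulAction.stabilizer Gal(Ω/F) x := by
        rw [Subgroup.zpowers_le]; exact h1
      exact fun f hf => this hf
    intro x hx
    exact (IntermediateField.mem_fixedField_iff _ _).1 (key hx) _ (Subgroup.mem_zpowers _)

end resHom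

/-! ### The conjugation action on `H¹` of a normal subgroup -/

namespace ContH1

variable {G M : Type*} [Group G] [TopologicalSpace G] [IsTopologicalGroup G] [AddCommGroup M]
  (ρ : G →* AddMonoid.End M) (N : Subgroup G) [N.Normal]

/-- Conjugation `n ↦ σ⁻¹ n σ` on a normal subgroup. -/
def conjHom (σ : G) : N →* N := (MulAut.conjNormal σ⁻¹ : MulAut N).toMonoidHom

theorem coe_conjHom (σ : G) (n : N) : (conjHom N σ n : G) = σ⁻¹ * n * σ := by
  simp [conjHom]

theorem continuous_conjHom (σ : G) : Continuous (conjHom N σ) := by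
  refine continuous_induced_rng.2 ?_
  have : (Subtype.val ∘ conjHom N σ) = fun n : N => σ⁻¹ * (n : G) * σ := by
    ext n; exact coe_conjHom N σ n
  rw [this]
  fun_prop

/-- The natural action of `σ ∈ G` on `H¹(N, M)` for a normal subgroup `N` and a `G`-module `M`:
on cocycles it is `(σ c)(n) = σ (c (σ⁻¹ n σ))`. -/
def conj (σ : G) : AddMonoid.End (H1 (ρ.comp N.subtype)) :=
  H1.map (conjHom N σ) (continuous_conjHom N σ) (ρ σ) (by
    intro n m
    simp only [MonoidHom.comp_apply, Subgroup.coe_subtype, coe_conjHom, map_mul]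
    change (ρ σ * (ρ σ⁻¹ * ρ n * ρ σ)) m = (ρ n * ρ σ) m
    rw [← map_mul, ← map_mul, ← map_mul, ← map_mul]
    congr 2
    group)

theorem conj_mul (σ τ : G) : conj ρ N (σ * τ) = conj ρ N σ * conj ρ N τ := by
  refine AddMonoidHom.ext fun c => ?_
  obtain ⟨c, rfl⟩ := H1.mk_surjective _ c
  refine congrArg (H1.mk _) ?_
  ext n
  change ρ (σ * τ) (c.1 (conjHom N (σ * τ) n)) = ρ σ (ρ τ (c.1 (conjHom N τ (conjHom N σ n))))
  rw [map_mul]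
  have : conjHom N (σ * τ) n = conjHom N τ (conjHom N σ n) := by
    ext; simp only [coe_conjHom]; group
  rw [this]; rfl

theorem conj_of_mem {σ : G} (hσ : σ ∈ N) : conj ρ N σ = 1 := by
  refine AddMonoidHom.ext fun c => ?_
  obtain ⟨c, rfl⟩ := H1.mk_surjective _ c
  rw [← sub_eq_zero]
  refine (H1.mk_eq_zero (Z1.map (conjHom N σ) (continuous_conjHom N σ) (ρ σ) _ c - c)).2
    ⟨c.1 ⟨σ, hσ⟩, fun n => ?_⟩
  have h1 := c.2.2 n ⟨σ, hσ⟩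
  have h2 := c.2.2 ⟨σ, hσ⟩ (conjHom N σ n)
  have h3 : (⟨σ, hσ⟩ : N) * conjHom N σ n = n * ⟨σ, hσ⟩ := by
    ext; simp only [Subgroup.coe_mul, coe_conjHom]; group
  rw [h3, h1] at h2
  change ρ σ (c.1 (conjHom N σ n)) - c.1 n = _
  have h4 : (ρ.comp N.subtype) ⟨σ, hσ⟩ (c.1 (conjHom N σ n)) = ρ σ (c.1 (conjHom N σ n)) := rfl
  rw [h4] at h2
  rw [sub_eq_sub_iff_add_eq_add, add_comm, ← h2, add_comm]

theorem conj_congr {σ σ' : G} (h : σ⁻¹ * σ' ∈ N) : conj ρ N σ = conj ρ N σ' := by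
  have h2 : conj ρ N (σ * (σ⁻¹ * σ')) = conj ρ N σ := by
    rw [conj_mul, conj_of_mem ρ N h, mul_one]
  rw [← h2, mul_inv_cancel_left]

variable {ρ N} in
theorem H1.map_conj_mk_eq_zero {G' M' : Type*} [Group G'] [TopologicalSpace G'] [AddCommGroup M']
    {ρ' : G' →* AddMonoid.End M'} (φ : G' →* N) (hφ : Continuous φ) (u : M →+ M')
    (hu : ∀ g m, u ((ρ.comp N.subtype) (φ g) m) = ρ' g (u m)) (c : Z1 (ρ.comp N.subtype)) (σ : G) :
    H1.map φ hφ u hu (conj ρ N σ (H1.mk _ c)) = 0 ↔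
      ∃ m : M', ∀ g, u (ρ σ (c.1 (conjHom N σ (φ g)))) = ρ' g m - m :=
  H1.mk_eq_zero (Z1.map φ hφ u hu (Z1.map (conjHom N σ) (continuous_conjHom N σ) (ρ σ) _ c))

open Topology in
theorem conj_eventually [CompactSpace N] (hρ : ∀ m : M, ∀ᶠ σ in 𝓝 (1 : G), ρ σ m = m)
    (c : H1 (ρ.comp N.subtype)) : ∀ᶠ σ in 𝓝 (1 : G), conj ρ N σ c = c := by
  obtain ⟨c, rfl⟩ := H1.mk_surjective _ c
  · have key : ∀ᶠ σ in 𝓝 (1 : G), ∀ n ∈ (Set.univ : Set N), ρ σ (c.1 (conjHom N σ n)) = c.1 n := by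
      refine isCompact_univ.eventually_forall_of_forall_eventually fun n _ => ?_
      have hcont : Continuous fun x : G × N => conjHom N x.1 x.2 := by
        refine continuous_induced_rng.2 ?_
        have : (Subtype.val ∘ fun x : G × N => conjHom N x.1 x.2) =
            fun x : G × N => x.1⁻¹ * (x.2 : G) * x.1 := by
          ext x; exact coe_conjHom N x.1 x.2
        rw [this]
        fun_prop
      have h1 : ∀ᶠ x : G × N in 𝓝 (1, n), c.1 (conjHom N x.1 x.2) = c.1 n := by
        have h0 : conjHom N 1 n = n := by ext; simp [coe_conjHom]
        have := (c.2.1.comp_continuous hcont).eventually_eq (1, n)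
        simpa [h0] using this
      have h2 : ∀ᶠ x : G × N in 𝓝 (1, n), c.1 x.2 = c.1 n :=
        (continuous_snd.tendsto ((1 : G), n)).eventually (c.2.1.eventually_eq n)
      have h3 : ∀ᶠ x : G × N in 𝓝 (1, n), ρ x.1 (c.1 n) = c.1 n :=
        (continuous_fst.tendsto ((1 : G), n)).eventually (hρ (c.1 n))
      filter_upwards [h1, h2, h3] with x hx1 hx2 hx3
      rw [hx1, hx2, hx3]
    filter_upwards [key] with σ hσ
    refine congrArg (H1.mk _) ?_
    ext n
    exact hσ n trivial

theorem H1.exists_pow_nsmul {G : Type*} [Group G] [TopologicalSpace G] [CompactSpace G] {p : ℕ} {k : ℕ∞} {A : Type*} [AddCommGroup A]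
    (ρ : G →* AddMonoid.End (pTors p k A)) (c : H1 ρ) : ∃ n : ℕ, p ^ n • c = 0 := by
  obtain ⟨c, rfl⟩ := H1.mk_surjective _ c
  · have hfin := c.2.1.range_finite
    choose n _ hn using fun a : pTors p k A => a.2
    obtain ⟨b, hb⟩ := (hfin.image n).bddAbove
    refine ⟨b, ?_⟩
    have : p ^ b • c = 0 := by
      ext g
      have hle : n (c.1 g) ≤ b := hb ⟨_, ⟨g, rfl⟩, rfl⟩
      obtain ⟨d, hd⟩ := Nat.exists_eq_add_of_le hle
      simp only [AddSubgroup.coe_nsmul, Pi.smul_apply, AddSubgroup.coe_zero, Pi.zero_apply]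
      rw [hd, pow_add, mul_comm, mul_smul, hn, smul_zero]
    rw [← map_nsmul, this, map_zero]

end ContH1

/-- If `e ^ (p ^ m)` fixes `x` and `p ^ n x = 0`, then a power of `e - 1` kills `x`. -/
theorem exists_pow_sub_one_apply_eq_zero {A : Type*} [AddCommGroup A] {p : ℕ} (hp : p.Prime)
    (e : AddMonoid.End A) (x : A) {m n : ℕ} (hm : (e ^ p ^ m) x = x) (hn : p ^ n • x = 0) :
    ∃ k : ℕ, ((e - 1) ^ k : AddMonoid.End A) x = 0 := by
  obtain ⟨r, hr⟩ := exists_add_pow_prime_pow_eq hp (Polynomial.X : Polynomial ℤ) 1 m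
  set t : AddMonoid.End A := e - 1 with ht
  have h1 := congrArg (Polynomial.aeval t) hr
  set R : Polynomial ℤ := -(Polynomial.X * r)
  have h2 : t ^ p ^ m = e ^ p ^ m - 1 + p * Polynomial.aeval t R := by
    simp only [R, map_pow, map_add, map_mul, Polynomial.aeval_X, map_one, one_pow, mul_one,
      map_natCast, map_neg] at h1 ⊢
    rw [ht, sub_add_cancel] at h1
    rw [ht, h1]
    noncomm_ring
  have h3 : (t ^ p ^ m : AddMonoid.End A) x = p • (Polynomial.aeval t R) x := by
    rw [h2]
    change (e ^ p ^ m) x - x + (p : AddMonoid.End A) ((Polynomial.aeval t R) x) = _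
    rw [hm, sub_self, zero_add, AddMonoid.End.natCast_apply]
  have h4 : ∀ j : ℕ, (t ^ (p ^ m * j) : AddMonoid.End A) x =
      p ^ j • (Polynomial.aeval t (R ^ j)) x := by
    intro j
    induction j with
    | zero => simp
    | succ j ih =>
      have hc : t ^ p ^ m * Polynomial.aeval t (R ^ j) = Polynomial.aeval t (R ^ j) * t ^ p ^ m := by
        have : t ^ p ^ m = Polynomial.aeval t (Polynomial.X ^ p ^ m : Polynomial ℤ) := by simp
        rw [this, ← map_mul, mul_comm, map_mul]
      have hc' : (t ^ p ^ m : AddMonoid.End A) ((Polynomial.aeval t (R ^ j)) x) =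
          (Polynomial.aeval t (R ^ j)) ((t ^ p ^ m : AddMonoid.End A) x) :=
        DFunLike.congr_fun hc x
      rw [Nat.mul_succ, add_comm, pow_add]
      change (t ^ p ^ m : AddMonoid.End A) ((t ^ (p ^ m * j) : AddMonoid.End A) x) = _
      rw [ih, map_nsmul, hc', h3, map_nsmul, ← mul_smul, ← pow_succ]
      congr 1
      rw [pow_succ, map_mul]
      rfl
  refine ⟨p ^ m * n, ?_⟩
  rw [h4, ← map_nsmul, hn, map_zero]

/-! ### Modules over the Iwasawa algebra `Λ = ℤ_p⟦T⟧` -/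

/-- The Iwasawa algebra `Λ = ℤ_p⟦T⟧`. -/
abbrev IwasawaAlg (p : ℕ) [Fact p.Prime] : Type := PowerSeries ℤ_[p]

namespace IwasawaAlg

open Polynomial

variable (p : ℕ) [Fact p.Prime]

/-- The natural map `ℤ[T] → Λ`. -/
def ofPoly : ℤ[X] →+* IwasawaAlg p :=
  (Polynomial.coeToPowerSeries.ringHom).comp (Polynomial.mapRingHom (Int.castRingHom ℤ_[p]))

theorem coeff_ofPoly (q : ℤ[X]) (i : ℕ) :
    PowerSeries.coeff i (ofPoly p q) = (q.coeff i : ℤ_[p]) := by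
  simp [ofPoly]

/-- The ideal of power series whose first `k` coefficients are divisible by `p ^ k`. -/
def trivIdeal (k : ℕ) : Ideal (IwasawaAlg p) where
  carrier := {g | ∀ i < k, (p : ℤ_[p]) ^ k ∣ PowerSeries.coeff i g}
  zero_mem' := by intro i _; simp
  add_mem' := by
    intro a b ha hb i hi
    rw [map_add]
    exact dvd_add (ha i hi) (hb i hi)
  smul_mem' := by
    intro c a ha i hi
    rw [smul_eq_mul, PowerSeries.coeff_mul]
    refine Finset.dvd_sum fun x hx => Dvd.dvd.mul_left (ha _ ?_) _
    have := Finset.HasAntidiagonal.mem_antidiagonal.1 hx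
    omega

theorem trivIdeal_anti {j k : ℕ} (h : j ≤ k) : trivIdeal p k ≤ trivIdeal p j :=
  fun _ hg i hi => (pow_dvd_pow _ h).trans (hg i (hi.trans_le h))

/-- An integral polynomial of degree `< k` that is congruent to `g` modulo
`(p ^ k, T ^ k)`. -/
def approx (k : ℕ) (g : IwasawaAlg p) : ℤ[X] :=
  ∑ i ∈ Finset.range k, Polynomial.monomial i (((PowerSeries.coeff i g).appr k : ℕ) : ℤ)

theorem approx_sub_mem (k : ℕ) (g : IwasawaAlg p) : ofPoly p (approx p k g) - g ∈ trivIdeal p k := by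
  intro i hi
  rw [map_sub, coeff_ofPoly, approx, Polynomial.finsetSum_coeff]
  simp only [Polynomial.coeff_monomial]
  rw [Finset.sum_ite_eq' (Finset.range k) i, if_pos (Finset.mem_range.2 hi)]
  have := PadicInt.appr_spec k (PowerSeries.coeff i g)
  rw [Ideal.mem_span_singleton] at this
  rw [← dvd_neg, neg_sub]
  simpa using this

variable {p} {A : Type*} [AddCommGroup A] {τ : AddMonoid.End A}

theorem aeval_eq_zero {k : ℕ} {a : A} (h1 : p ^ k • a = 0) (h2 : (τ ^ k : AddMonoid.End A) a = 0)
    {q : ℤ[X]} (hq : ofPoly p q ∈ trivIdeal p k) : (Polynomial.aeval τ q) a = 0 := by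
  rw [Polynomial.aeval_eq_sum_range]
  refine (AddMonoidHom.finsetSum_apply _ _ _).trans (Finset.sum_eq_zero fun i _ => ?_)
  change q.coeff i • ((τ ^ i : AddMonoid.End A) a) = 0
  rcases lt_or_ge i k with hi | hi
  · have := hq i hi
    rw [coeff_ofPoly, PadicInt.pow_p_dvd_int_iff] at this
    obtain ⟨c, hc⟩ := this
    rw [← map_zsmul, hc, mul_comm, mul_smul]
    have h3 : ((p : ℤ) ^ k) • a = 0 := by
      rw [← h1, ← natCast_zsmul]; push_cast; rfl
    rw [h3, smul_zero, map_zero]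
  · obtain ⟨d, rfl⟩ := Nat.exists_eq_add_of_le hi
    rw [add_comm, pow_add]
    change q.coeff _ • (τ ^ d : AddMonoid.End A) ((τ ^ k : AddMonoid.End A) a) = 0
    rw [h2, map_zero, smul_zero]

open Classical in
/-- The element `g • a = ∑ i, g_i τ ^ i a`: since `p ^ k` and `τ ^ k` kill `a` for some `k`, only
`g` modulo `(p ^ k, T ^ k)` matters, and an integral polynomial congruent to `g` is applied. -/
def discreteSMul (hτ : ∀ a : A, ∃ k : ℕ, p ^ k • a = 0 ∧ (τ ^ k : AddMonoid.End A) a = 0)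
    (g : IwasawaAlg p) (a : A) : A :=
  (Polynomial.aeval τ (approx p (Nat.find (hτ a)) g)) a

theorem discreteSMul_eq
    (hτ : ∀ a : A, ∃ k : ℕ, p ^ k • a = 0 ∧ (τ ^ k : AddMonoid.End A) a = 0)
    {g : IwasawaAlg p} {a : A} {k : ℕ} (h1 : p ^ k • a = 0)
    (h2 : (τ ^ k : AddMonoid.End A) a = 0) {q : ℤ[X]} (hq : ofPoly p q - g ∈ trivIdeal p k) :
    discreteSMul hτ g a = (Polynomial.aeval τ q) a := by
  classical
  have hle : Nat.find (hτ a) ≤ k := Nat.find_min' (hτ a) ⟨h1, h2⟩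
  have hs := Nat.find_spec (hτ a)
  rw [discreteSMul, ← sub_eq_zero]
  change (Polynomial.aeval τ _ - Polynomial.aeval τ q : AddMonoid.End A) a = 0
  rw [← map_sub]
  refine aeval_eq_zero (p := p) (k := Nat.find (hτ a)) ?_ ?_ ?_
  · convert hs.1
  · convert hs.2
  · rw [map_sub]
    have h3 := approx_sub_mem p (Nat.find (hτ a)) g
    have h4 := trivIdeal_anti p hle hq
    convert Ideal.sub_mem _ h3 h4 using 1
    ring

/-- A `p`-primary abelian group with a locally nilpotent endomorphism `τ` is a `Λ`-module on which
`T` acts as `τ`. -/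
@[reducible]
def discreteModule (hτ : ∀ a : A, ∃ k : ℕ, p ^ k • a = 0 ∧ (τ ^ k : AddMonoid.End A) a = 0) :
    Module (IwasawaAlg p) A where
  smul := discreteSMul hτ
  one_smul a := by
    obtain ⟨k, h1, h2⟩ := hτ a
    refine (discreteSMul_eq hτ h1 h2 (q := 1) (by simp)).trans ?_
    simp
  mul_smul g g' a := by
    obtain ⟨k, h1, h2⟩ := hτ a
    have e1 : discreteSMul hτ g' a = _ := discreteSMul_eq hτ h1 h2 (approx_sub_mem p k g')
    change discreteSMul hτ (g * g') a = discreteSMul hτ g (discreteSMul hτ g' a)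
    have h2' : (τ ^ k : AddMonoid.End A) ((Polynomial.aeval τ (approx p k g')) a) = 0 := by
      have hc : τ ^ k * Polynomial.aeval τ (approx p k g') =
          Polynomial.aeval τ (approx p k g') * τ ^ k := by
        have : τ ^ k = Polynomial.aeval τ (Polynomial.X ^ k : ℤ[X]) := by simp
        rw [this, ← map_mul, mul_comm, map_mul]
      refine (DFunLike.congr_fun hc a).trans ?_
      change (Polynomial.aeval τ (approx p k g')) ((τ ^ k : AddMonoid.End A) a) = 0
      rw [h2, map_zero]
    rw [e1, discreteSMul_eq hτ (k := k) (by rw [← map_nsmul, h1, map_zero]) h2'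
      (approx_sub_mem p k g), discreteSMul_eq hτ h1 h2 (q := approx p k g * approx p k g'),
      map_mul]
    · rfl
    · have h3 := Ideal.mul_mem_right (ofPoly p (approx p k g')) _ (approx_sub_mem p k g)
      have h4 := Ideal.mul_mem_left _ g (approx_sub_mem p k g')
      convert Ideal.add_mem _ h3 h4 using 1
      rw [map_mul]
      ring
  smul_zero g := by
    change (Polynomial.aeval τ _) 0 = 0
    rw [map_zero]
  smul_add g a b := by
    obtain ⟨j, a1, a2⟩ := hτ a
    obtain ⟨k, b1, b2⟩ := hτ b
    have a1' : p ^ (k + j) • a = 0 := by rw [pow_add, mul_smul, a1, smul_zero]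
    have b1' : p ^ (k + j) • b = 0 := by rw [add_comm, pow_add, mul_smul, b1, smul_zero]
    have a2' : (τ ^ (k + j) : AddMonoid.End A) a = 0 := by
      rw [pow_add]
      change (τ ^ k : AddMonoid.End A) ((τ ^ j : AddMonoid.End A) a) = 0
      rw [a2, map_zero]
    have b2' : (τ ^ (k + j) : AddMonoid.End A) b = 0 := by
      rw [add_comm, pow_add]
      change (τ ^ j : AddMonoid.End A) ((τ ^ k : AddMonoid.End A) b) = 0
      rw [b2, map_zero]
    change discreteSMul hτ g (a + b) = discreteSMul hτ g a + discreteSMul hτ g b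
    rw [discreteSMul_eq hτ a1' a2' (approx_sub_mem p _ g),
      discreteSMul_eq hτ b1' b2' (approx_sub_mem p _ g),
      discreteSMul_eq hτ (by rw [smul_add, a1', b1', add_zero])
        (by rw [map_add, a2', b2', add_zero]) (approx_sub_mem p (k + j) g), map_add]
  add_smul g g' a := by
    obtain ⟨k, h1, h2⟩ := hτ a
    change discreteSMul hτ (g + g') a = discreteSMul hτ g a + discreteSMul hτ g' a
    rw [discreteSMul_eq hτ h1 h2 (approx_sub_mem p k g),
      discreteSMul_eq hτ h1 h2 (approx_sub_mem p k g'),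
      discreteSMul_eq hτ h1 h2 (q := approx p k g + approx p k g'), map_add]
    · rfl
    · convert Ideal.add_mem _ (approx_sub_mem p k g) (approx_sub_mem p k g') using 1
      rw [map_add]
      ring
  zero_smul a := by
    obtain ⟨k, h1, h2⟩ := hτ a
    refine (discreteSMul_eq hτ h1 h2 (q := 0) (by simp)).trans ?_
    simp

theorem X_discreteSMul
    (hτ : ∀ a : A, ∃ k : ℕ, p ^ k • a = 0 ∧ (τ ^ k : AddMonoid.End A) a = 0) (a : A) :
    discreteSMul hτ (PowerSeries.X : IwasawaAlg p) a = τ a := by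
  obtain ⟨k, h1, h2⟩ := hτ a
  rw [discreteSMul_eq hτ h1 h2 (q := Polynomial.X) (by simp [ofPoly])]
  simp

end IwasawaAlg

/-- The Pontryagin dual `Hom(A, ℚ_p / ℤ_p)` of a discrete `p`-primary abelian group. -/
def PontDual (p : ℕ) [Fact p.Prime] (A : Type*) [AddCommGroup A] : Type _ :=
  A →+ ℚ_[p] ⧸ (PadicInt.subring p).toAddSubgroup

namespace PontDual

variable (p : ℕ) [Fact p.Prime] (A : Type*) [AddCommGroup A]

instance : AddCommGroup (PontDual p A) :=
  inferInstanceAs (AddCommGroup (A →+ ℚ_[p] ⧸ (PadicInt.subring p).toAddSubgroup))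

/-- The dual of a module over a commutative ring: `(r f)(a) = f (r a)`. -/
instance {R : Type*} [CommRing R] [Module R A] : Module R (PontDual p A) where
  smul r f := AddMonoidHom.comp f (DistribSMul.toAddMonoidHom A r)
  one_smul f := AddMonoidHom.ext fun a => congrArg f.toFun (one_smul R a)
  mul_smul r s f := AddMonoidHom.ext fun a =>
    congrArg f.toFun (by rw [mul_comm]; exact mul_smul s r a)
  smul_zero r := rfl
  smul_add r f g := rfl
  add_smul r s f := AddMonoidHom.ext fun a =>
    (congrArg f.toFun (add_smul r s a)).trans (AddMonoidHom.map_add f _ _)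
  zero_smul f := AddMonoidHom.ext fun a =>
    (congrArg f.toFun (zero_smul R a)).trans (AddMonoidHom.map_zero f)

end PontDual

/-- The data of an elementary `Λ`-module
`Λ ^ r ⊕ ⨁ i, Λ / (p ^ μ_i) ⊕ ⨁ j, Λ / (f_j ^ λ_j)` with positive `μ_i`, `λ_j` and irreducible
distinguished polynomials `f_j`. -/
structure ElementaryData (p : ℕ) [Fact p.Prime] where
  r : ℕ
  s : ℕ
  mu : Fin s → ℕ
  mu_pos : ∀ i, 0 < mu i
  t : ℕ
  f : Fin t → Polynomial ℤ_[p]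
  distinguished : ∀ j, (f j).IsDistinguishedAt (Ideal.span {(p : ℤ_[p])})
  irreducible : ∀ j, Irreducible (f j)
  lam : Fin t → ℕ
  lam_pos : ∀ j, 0 < lam j

/-- The elementary `Λ`-module attached to the data. -/
abbrev ElementaryData.Mod {p : ℕ} [Fact p.Prime] (D : ElementaryData p) : Type :=
  (Fin D.r → IwasawaAlg p) ×
  ((i : Fin D.s) → IwasawaAlg p ⧸ Ideal.span {(p : IwasawaAlg p) ^ D.mu i}) ×
  ((j : Fin D.t) → IwasawaAlg p ⧸ Ideal.span {(D.f j : IwasawaAlg p) ^ D.lam j})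

/-- A pseudo-isomorphism: a linear map with finite kernel and cokernel. -/
def IsPseudoIso {R M N : Type*} [CommRing R] [AddCommGroup M] [AddCommGroup N] [Module R M]
    [Module R N] (φ : M →ₗ[R] N) : Prop :=
  Finite (LinearMap.ker φ) ∧ Finite (N ⧸ LinearMap.range φ)

/-- `M` has Iwasawa invariants `μ(M) = m` and `λ(M) = l`: it is pseudo-isomorphic to an
elementary module with `∑ μ_i = m` and `∑ λ_j deg f_j = l`. -/
def HasIwasawaInvariants (p : ℕ) [Fact p.Prime] (M : Type*) [AddCommGroup M]
    [Module (IwasawaAlg p) M] (m l : ℕ) : Prop :=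
  ∃ (D : ElementaryData p) (φ : M →ₗ[IwasawaAlg p] D.Mod), IsPseudoIso φ ∧
    ∑ i, D.mu i = m ∧ ∑ j, D.lam j * (D.f j).natDegree = l

/-! ### Points of elliptic curves as Galois modules -/

/-- The group `E(L)` of `L`-points of a Weierstrass curve `E` over `F`. -/
def Pts {F : Type*} [Field F] (E : WeierstrassCurve F) (L : Type*) [Field L] [Algebra F L] :
    Type _ :=
  (E.baseChange L).toAffine.Point

namespace Pts

open Classical in
instance {F : Type*} [Field F] (E : WeierstrassCurve F) (L : Type*) [Field L] [Algebra F L] :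
    AddCommGroup (Pts E L) :=
  inferInstanceAs (AddCommGroup (E.baseChange L).toAffine.Point)

variable {F : Type*} [Field F] (E : WeierstrassCurve F) {L L' : Type*} [Field L] [Algebra F L]
  [Field L'] [Algebra F L']

open Classical in
/-- The homomorphism `E(L) → E(L')` induced by an embedding `L → L'` over `F`. -/
def map (f : L →ₐ[F] L') : Pts E L →+ Pts E L' :=
  WeierstrassCurve.Affine.Point.map (W' := E.toAffine) f

theorem map_map {L'' : Type*} [Field L''] [Algebra F L''] (f : L →ₐ[F] L') (g : L' →ₐ[F] L'')
    (P : Pts E L) : map E g (map E f P) = map E (g.comp f) P := by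
  classical
  exact WeierstrassCurve.Affine.Point.map_map (W' := E.toAffine) f g P

variable (L) in
/-- The action of `Gal(L/F)` on `E(L)`. -/
def rep : Gal(L/F) →* AddMonoid.End (Pts E L) where
  toFun σ := map E σ.toAlgHom
  map_one' := by
    ext P
    rcases P with _ | ⟨x, y, h⟩ <;> rfl
  map_mul' σ τ := by
    ext P
    exact (map_map E τ.toAlgHom σ.toAlgHom P).symm

open Topology in
theorem rep_eventually [Algebra.IsAlgebraic F L] (P : Pts E L) :
    ∀ᶠ σ in 𝓝 (1 : Gal(L/F)), rep E L σ P = P := by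
  rcases P with _ | ⟨x, y, h⟩
  · exact Filter.Eventually.of_forall fun σ => rfl
  · rw [Filter.Eventually, krullTopology_mem_nhds_one_iff]
    refine ⟨IntermediateField.adjoin F {x, y}, ?_, ?_⟩
    · exact IntermediateField.finiteDimensional_adjoin fun z _ =>
        Algebra.IsIntegral.isIntegral z
    · intro σ hσ
      rw [SetLike.mem_coe, IntermediateField.mem_fixingSubgroup_iff] at hσ
      have hx : σ x = x := hσ _ (IntermediateField.subset_adjoin _ _ (by simp))
      have hy : σ y = y := hσ _ (IntermediateField.subset_adjoin _ _ (by simp))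
      have key : ∀ (x' y' : L) (h' : (E.baseChange L).toAffine.Nonsingular x' y'),
          x' = x → y' = y → WeierstrassCurve.Affine.Point.some x' y' h' =
            WeierstrassCurve.Affine.Point.some x y h := by
        rintro _ _ _ rfl rfl
        rfl
      exact key _ _ _ hx hy

end Pts

/-! ### The fine Selmer groups -/

namespace FineSelmer

open NumberField IsDedekindDomain ContH1 Topology

variable {F : Type*} [Field F] [NumberField F]

/-- `E` has good reduction at the prime `v`: a Weierstrass equation of `E` that is minimal at `v`
has good reduction. -/
def HasGoodReductionAt (E : WeierstrassCurve F) (v : HeightOneSpectrum (𝓞 F)) : Prop :=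
  (E.minimal (v.valuation F).valuationSubring).HasGoodReduction (v.valuation F).valuationSubring

/-- The set `S` of primes of `F` that lie above `p` or at which `E` has bad reduction. -/
def badPrimes (E : WeierstrassCurve F) (p : ℕ) : Set (HeightOneSpectrum (𝓞 F)) :=
  {v | (p : 𝓞 F) ∈ v.asIdeal ∨ ¬ HasGoodReductionAt E v}

/-- The set `v(L)` of places of an algebraic extension `L` above the prime `v` of `F`, a place
being given by its valuation ring. -/
def placesOver (L : Type*) [Field L] [Algebra F L] (v : HeightOneSpectrum (𝓞 F)) :
    Set (ValuationSubring L) :=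
  {w | w.comap (algebraMap F L) = (v.valuation F).valuationSubring}

/-- The extension `L/F` is unramified at `v`: the inertia groups in `Gal(F̄/F)` of all places
above `v` act trivially on `L`. -/
def IsUnramifiedAt (L : IntermediateField F (AlgebraicClosure F)) (v : HeightOneSpectrum (𝓞 F)) :
    Prop :=
  ∀ w ∈ placesOver (AlgebraicClosure F) v, ∀ σ ∈ w.inertiaSubgroup F,
    ∀ x ∈ L, (σ : Gal(AlgebraicClosure F/F)) x = x

/-- The maximal extension `F_S` of `F` in `F̄` that is unramified at all primes outside `S`. -/
def maxUnram (S : Set (HeightOneSpectrum (𝓞 F))) : IntermediateField F (AlgebraicClosure F) :=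
  sSup {L | ∀ v ∉ S, IsUnramifiedAt L v}

theorem mem_inertia_iff (w : ValuationSubring (AlgebraicClosure F))
    (σ : w.decompositionSubgroup F) :
    σ ∈ w.inertiaSubgroup F ↔ ∀ x ∈ w, (σ : Gal(AlgebraicClosure F/F)) x - x = 0 ∨
      ((σ : Gal(AlgebraicClosure F/F)) x - x)⁻¹ ∉ w := by
  have key : ∀ a : w, (σ • IsLocalRing.residue w a = IsLocalRing.residue w a ↔
      ((σ : Gal(AlgebraicClosure F/F)) a - a = 0 ∨
        ((σ : Gal(AlgebraicClosure F/F)) a - a)⁻¹ ∉ w)) := by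
    intro a
    rw [← IsLocalRing.ResidueField.residue_smul, ← sub_eq_zero, ← map_sub,
      IsLocalRing.residue_eq_zero_iff, IsLocalRing.mem_maximalIdeal, mem_nonunits_iff]
    have hcoe : ((σ • a - a : w) : AlgebraicClosure F) =
        (σ : Gal(AlgebraicClosure F/F)) a - a := rfl
    rw [← hcoe]
    generalize σ • a - a = b
    constructor
    · intro h
      by_contra! hc
      refine h (isUnit_iff_exists_inv.2 ⟨⟨_, hc.2⟩, Subtype.ext (mul_inv_cancel₀ hc.1)⟩)
    · rintro h hu
      obtain ⟨c, hc⟩ := isUnit_iff_exists_inv.1 hu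
      have hc' : (b : AlgebraicClosure F) * c = 1 := congrArg Subtype.val hc
      rcases h with h | h
      · rw [h, zero_mul] at hc'
        exact zero_ne_one hc'
      · exact h (by rw [inv_eq_of_mul_eq_one_right hc']; exact c.2)
  rw [ValuationSubring.inertiaSubgroup, MonoidHom.mem_ker]
  constructor
  · intro h x hx
    exact (key ⟨x, hx⟩).1 (RingEquiv.congr_fun h _)
  · intro h
    ext y
    obtain ⟨a, rfl⟩ := IsLocalRing.residue_surjective y
    exact (key a).2 (h a a.2)

theorem smul_mem_placesOver {L : Type*} [Field L] [Algebra F L] {v : HeightOneSpectrum (𝓞 F)}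
    {w w' : ValuationSubring L} (g : L ≃ₐ[F] L) (h : ∀ x, x ∈ w' ↔ g x ∈ w)
    (hw : w ∈ placesOver L v) : w' ∈ placesOver L v := by
  rw [placesOver, Set.mem_ofPred_eq] at hw ⊢
  rw [← hw]
  ext x
  simp [h]

open Pointwise in
theorem IsUnramifiedAt.map {L : IntermediateField F (AlgebraicClosure F)}
    {v : HeightOneSpectrum (𝓞 F)} (h : IsUnramifiedAt L v) (g : Gal(AlgebraicClosure F/F)) :
    IsUnramifiedAt (L.map g.toAlgHom) v := by
  rintro w hw σ hσ _ ⟨x, hx, rfl⟩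
  let w' : ValuationSubring (AlgebraicClosure F) := w.comap (g : AlgebraicClosure F →+* _)
  have hmem : ∀ x, x ∈ w' ↔ g x ∈ w := fun x => Iff.rfl
  have hst : ∀ x, (σ : Gal(AlgebraicClosure F/F)) x ∈ w ↔ x ∈ w := by
    intro x
    have h2 := ValuationSubring.smul_mem_pointwise_smul_iff
      (g := (σ : Gal(AlgebraicClosure F/F))) (S := w) (x := x)
    rwa [show (σ : Gal(AlgebraicClosure F/F)) • w = w from σ.2] at h2
  have hdec : g⁻¹ * σ * g ∈ w'.decompositionSubgroup F := by
    rw [MulAction.mem_stabilizer_iff]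
    ext x
    rw [ValuationSubring.mem_pointwise_smul_iff_inv_smul_mem]
    have h3 : g ((g⁻¹ * σ * g)⁻¹ • x) = (σ : Gal(AlgebraicClosure F/F))⁻¹ (g x) := by
      simp [mul_assoc, AlgEquiv.smul_def]
    rw [hmem, h3, ← hst, ← AlgEquiv.mul_apply, mul_inv_cancel, hmem]
    rfl
  have hin : (⟨_, hdec⟩ : w'.decompositionSubgroup F) ∈ w'.inertiaSubgroup F := by
    rw [mem_inertia_iff] at hσ ⊢
    intro x hx
    have h4 : (g⁻¹ * σ * g) x - x =
        g⁻¹ ((σ : Gal(AlgebraicClosure F/F)) (g x) - g x) := by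
      simp
    rcases hσ (g x) hx with h5 | h5
    · left; rw [h4, h5, map_zero]
    · right
      rw [hmem, h4, map_inv₀]
      simpa using h5
  have := h w' (smul_mem_placesOver g hmem hw) _ hin x hx
  have h6 := congrArg g this
  simpa using h6

instance (S : Set (HeightOneSpectrum (𝓞 F))) : Normal F (maxUnram S) := by
  rw [IntermediateField.normal_iff_forall_map_le']
  intro g
  rw [IntermediateField.map_le_iff_le_comap, maxUnram, sSup_le_iff]
  intro L hL
  rw [← IntermediateField.map_le_iff_le_comap]
  exact le_sSup fun v hv => (hL v hv).map g

instance (S : Set (HeightOneSpectrum (𝓞 F))) : IsGalois F (maxUnram S) := ⟨⟩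

variable (E : WeierstrassCurve F) (p : ℕ) (k : ℕ∞)
  (Finf : IntermediateField F (AlgebraicClosure F))

/-- The field `F_S` for the set `S` of primes above `p` or of bad reduction. -/
abbrev FS : IntermediateField F (AlgebraicClosure F) := maxUnram (badPrimes E p)

/-- The Galois group `Gal(F_S/F_∞)` for `F ⊆ F_∞ ⊆ F_S`, as the subgroup of `Gal(F_S/F)` of
automorphisms that fix `F_∞`. -/
def galS : Subgroup Gal(FS E p/F) := (Finf.comap (FS E p).val).fixingSubgroup

theorem mem_galS {τ : Gal(FS E p/F)} :
    τ ∈ galS E p Finf ↔ ∀ x : FS E p, (x : AlgebraicClosure F) ∈ Finf → τ x = x := by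
  rw [galS, IntermediateField.mem_fixingSubgroup_iff]
  rfl

/-- The restriction map `Gal(F̄/F) → Gal(F_S/F)`. -/
def resS : Gal(AlgebraicClosure F/F) →* Gal(FS E p/F) := AlgEquiv.restrictNormalHom (FS E p)

theorem coe_resS (σ : Gal(AlgebraicClosure F/F)) (x : FS E p) :
    (resS E p σ x : AlgebraicClosure F) = σ x :=
  AlgEquiv.restrictNormalHom_apply (FS E p) σ x

theorem resS_mem_galS {σ : Gal(AlgebraicClosure F/F)} (hσ : ∀ x ∈ Finf, σ x = x) :
    resS E p σ ∈ galS E p Finf := by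
  rw [mem_galS]
  intro x hx
  ext
  rw [coe_resS, hσ x hx]

instance [Normal F Finf] : (galS E p Finf).Normal := by
  refine ⟨fun τ hτ g => ?_⟩
  rw [mem_galS] at hτ ⊢
  intro x hx
  obtain ⟨σ, rfl⟩ : ∃ σ, resS E p σ = g := AlgEquiv.restrictNormalHom_surjective _ g
  have h1 : (((resS E p σ)⁻¹ x : FS E p) : AlgebraicClosure F) ∈ Finf := by
    rw [← map_inv, coe_resS]
    exact (IntermediateField.normal_iff_forall_map_le'.1 ‹_› σ⁻¹) ⟨_, hx, rfl⟩
  rw [AlgEquiv.mul_apply, AlgEquiv.mul_apply, hτ _ h1, ← AlgEquiv.mul_apply, mul_inv_cancel]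
  rfl

instance : CompactSpace (galS E p Finf) :=
  isCompact_iff_compactSpace.1 (InfiniteGalois.fixingSubgroup_isClosed _).isCompact

/-- The `Gal(F_S/F)`-module `E[p ^ k]`; since `F_S` contains the coordinates of all points of
`p`-power order, these are the points of `E[p ^ k]` over `F_S`. -/
abbrev globalRep : Gal(FS E p/F) →* AddMonoid.End (pTors p k (Pts E (FS E p))) :=
  pTors.rep p k (Pts.rep E (FS E p))

/-- `H¹(F_S/F_∞, E[p ^ k])`. -/
def GlobalH1 : Type _ := H1 ((globalRep E p k).comp (galS E p Finf).subtype)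

instance : AddCommGroup (GlobalH1 E p k Finf) :=
  inferInstanceAs (AddCommGroup (H1 ((globalRep E p k).comp (galS E p Finf).subtype)))

set_option synthInstance.maxHeartbeats 400000 in
variable {Finf} in
/-- A chosen embedding of `F̄` over `F_∞` into an algebraic closure of the completion `F_{∞,w}`. -/
def localEmb (w : ValuationSubring Finf) :
    AlgebraicClosure F →ₐ[Finf] AlgebraicClosure (CompletionAt w) :=
  IsAlgClosed.lift

variable {Finf} in
/-- The restriction map from the absolute Galois group of `F_{∞,w}` to `Gal(F̄/F)`. -/
def localRes (w : ValuationSubring Finf) :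
    Gal(AlgebraicClosure (CompletionAt w)/CompletionAt w) →* Gal(AlgebraicClosure F/F) :=
  resHom ((localEmb w).restrictScalars F)

variable {Finf} in
theorem localEmb_localRes (w : ValuationSubring Finf)
    (τ : Gal(AlgebraicClosure (CompletionAt w)/CompletionAt w)) (x : AlgebraicClosure F) :
    localEmb w (localRes w τ x) = τ (localEmb w x) :=
  resHom_commutes ((localEmb w).restrictScalars F) τ x

variable {Finf} in
theorem localEmb_coe (w : ValuationSubring Finf) (x : Finf) :
    localEmb w (x : AlgebraicClosure F) =
      algebraMap (CompletionAt w) (AlgebraicClosure (CompletionAt w)) (CompletionAt.emb w x) :=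
  (localEmb w).commutes x

variable {Finf} in
theorem localRes_fix (w : ValuationSubring Finf)
    (τ : Gal(AlgebraicClosure (CompletionAt w)/CompletionAt w)) :
    ∀ x ∈ Finf, localRes w τ x = x := by
  intro x hx
  refine (localEmb w).injective ((localEmb_localRes w τ x).trans ?_)
  change τ (localEmb w ((⟨x, hx⟩ : Finf) : AlgebraicClosure F)) =
    localEmb w ((⟨x, hx⟩ : Finf) : AlgebraicClosure F)
  rw [localEmb_coe, AlgEquiv.commutes]

variable {Finf} in
/-- The restriction map from the absolute Galois group of `F_{∞,w}` to `Gal(F_S/F_∞)`. -/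
def localResS (w : ValuationSubring Finf) :
    Gal(AlgebraicClosure (CompletionAt w)/CompletionAt w) →* galS E p Finf :=
  ((resS E p).comp (localRes w)).codRestrict (galS E p Finf) fun τ =>
    resS_mem_galS E p Finf (localRes_fix w τ)

variable {Finf} in
theorem continuous_localResS (w : ValuationSubring Finf) : Continuous (localResS E p w) :=
  continuous_induced_rng.2
    ((InfiniteGalois.restrictNormalHom_continuous (FS E p)).comp
      (resHom_continuous ((localEmb w).restrictScalars F)))

variable {Finf} in
/-- `E[p ^ k]`, the torsion of `E(F̄)`, as a module over the absolute Galois group of `F_{∞,w}`. -/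
abbrev localRep (w : ValuationSubring Finf) :
    Gal(AlgebraicClosure (CompletionAt w)/CompletionAt w) →*
      AddMonoid.End (pTors p k (Pts E (AlgebraicClosure F))) :=
  (pTors.rep p k (Pts.rep E (AlgebraicClosure F))).comp (localRes w)

variable {Finf} in
/-- `H¹(F_{∞,w}, E[p ^ k])`. -/
def LocalH1 (w : ValuationSubring Finf) : Type _ := H1 (localRep E p k w)

variable {Finf} in
instance (w : ValuationSubring Finf) : AddCommGroup (LocalH1 E p k w) :=
  inferInstanceAs (AddCommGroup (H1 (localRep E p k w)))

theorem incl_globalRep (σ : Gal(AlgebraicClosure F/F)) (P : pTors p k (Pts E (FS E p))) :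
    pTors.map p k (Pts.map E (FS E p).val) (globalRep E p k (resS E p σ) P) =
      pTors.rep p k (Pts.rep E (AlgebraicClosure F)) σ
        (pTors.map p k (Pts.map E (FS E p).val) P) := by
  ext
  change Pts.map E (FS E p).val (Pts.map E (resS E p σ).toAlgHom P) =
    Pts.map E σ.toAlgHom (Pts.map E (FS E p).val P)
  rw [Pts.map_map, Pts.map_map]
  congr 2
  ext x
  exact coe_resS E p σ x

variable {Finf} in
/-- The localization map `H¹(F_S/F_∞, E[p ^ k]) → H¹(F_{∞,w}, E[p ^ k])`. -/
def loc (w : ValuationSubring Finf) : GlobalH1 E p k Finf →+ LocalH1 E p k w :=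
  H1.map (localResS E p w) (continuous_localResS E p w) (pTors.map p k (Pts.map E (FS E p).val))
    fun τ P => incl_globalRep E p k (localRes w τ) P

/-- `⨁_{v ∈ S} 𝓗_v(F_∞, E[p ^ k])` with `𝓗_v` the product of the `H¹(F_{∞,w}, E[p ^ k])` over the
places `w` above `v`; as `S` is finite, the direct sum over `S` is a product. -/
abbrev LocalProd : Type _ :=
  (v : badPrimes E p) → (w : placesOver Finf v.1) → LocalH1 E p k w.1

/-- The map `H¹(F_S/F_∞, E[p ^ k]) → ⨁_{v ∈ S} 𝓗_v(F_∞, E[p ^ k])`. -/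
def locMap : GlobalH1 E p k Finf →+ LocalProd E p k Finf where
  toFun c v w := loc E p k w.1 c
  map_zero' := by ext v w; simp
  map_add' a b := by ext v w; simp

/-- The fine Selmer group of `E[p ^ k]` over `F_∞`: for `k = ⊤` this is `R(E/F_∞)`, and for
`k = 1` it is the residual fine Selmer group `R(E[p]/F_∞)`. -/
def fineSelmer : AddSubgroup (GlobalH1 E p k Finf) := (locMap E p k Finf).ker

variable {Finf} in
/-- The map `h_w : H¹(F_{∞,w}, E[p]) → H¹(F_{∞,w}, E[p ^ ∞])` induced by the inclusion
`E[p] → E[p ^ ∞]` (its image is killed by `p`). -/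
def hLocal (w : ValuationSubring Finf) : LocalH1 E p 1 w →+ LocalH1 E p ⊤ w :=
  H1.map (MonoidHom.id _) continuous_id (pTors.incl p 1 _) fun _ _ => rfl

/-- The map `h : ⨁_{v ∈ S} 𝓗_v(F_∞, E[p]) → ⨁_{v ∈ S} 𝓗_v(F_∞, E[p ^ ∞])`. -/
def hMap : LocalProd E p 1 Finf →+ LocalProd E p ⊤ Finf where
  toFun c v w := hLocal E p w.1 (c v w)
  map_zero' := by ext v w; simp
  map_add' a b := by ext v w; simp

instance : Module (ZMod p) (fineSelmer E p 1 Finf) :=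
  AddCommGroup.zmodModule fun c => Subtype.ext (H1.nsmul_eq_zero pTors.nsmul_eq_zero c.1)

instance : Module (ZMod p) (hMap E p Finf).ker :=
  AddCommGroup.zmodModule fun c => Subtype.ext <| funext fun v => funext fun w =>
    H1.nsmul_eq_zero pTors.nsmul_eq_zero (c.1 v w)


/-! ### The action of `Γ = Gal(F_∞/F)` and the `Λ`-module structure -/

variable {Finf} in
/-- The action of `σ ∈ Gal(F̄/F)` on `H¹(F_S/F_∞, E[p ^ k])` by conjugation. -/
def globalConj [Normal F Finf] (σ : Gal(AlgebraicClosure F/F)) :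
    AddMonoid.End (GlobalH1 E p k Finf) :=
  conj (globalRep E p k) (galS E p Finf) (resS E p σ)

variable {Finf} in
theorem globalConj_congr [Normal F Finf] {σ σ' : Gal(AlgebraicClosure F/F)}
    (h : ∀ x ∈ Finf, σ x = σ' x) :
    globalConj E p k σ = globalConj (Finf := Finf) E p k σ' := by
  refine conj_congr _ _ ?_
  rw [← map_inv, ← map_mul]
  refine resS_mem_galS E p Finf fun x hx => ?_
  rw [AlgEquiv.mul_apply, ← h x hx, ← AlgEquiv.mul_apply, inv_mul_cancel]
  rfl

variable {Finf} in
theorem globalConj_mul [Normal F Finf] (σ σ' : Gal(AlgebraicClosure F/F)) :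
    globalConj (Finf := Finf) E p k (σ * σ') = globalConj E p k σ * globalConj E p k σ' := by
  unfold globalConj
  rw [map_mul]
  exact conj_mul _ _ _ _

variable {Finf} in
theorem globalConj_one [Normal F Finf] : globalConj (Finf := Finf) E p k 1 = 1 := by
  unfold globalConj
  rw [map_one]
  exact conj_of_mem _ _ (Subgroup.one_mem _)

/-- Compatibility of conjugation by `σ` with the places `w' = σ⁻¹ w` and `w`: there are an
automorphism `σ'` with the same restriction to `F_∞` as `σ` and a map `τ ↦ τ'` of local Galois
groups such that the restriction of `τ'` is `σ'⁻¹ τ σ'`. -/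
theorem exists_conj_local [Normal F Finf] (σ : Gal(AlgebraicClosure F/F))
    (w : ValuationSubring Finf) :
    ∃ w' : ValuationSubring Finf, (∀ v : HeightOneSpectrum (𝓞 F), w ∈ placesOver Finf v → w' ∈ placesOver Finf v) ∧
    ∃ σ' : Gal(AlgebraicClosure F/F), (∀ x ∈ Finf, σ x = σ' x) ∧
    ∀ τ : Gal(AlgebraicClosure (CompletionAt w)/CompletionAt w),
    ∃ τ' : Gal(AlgebraicClosure (CompletionAt w')/CompletionAt w'),
      localRes w' τ' = σ'⁻¹ * localRes w τ * σ' := by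
  let s : Gal(Finf/F) := AlgEquiv.restrictNormalHom Finf σ
  have hs : ∀ x : Finf, (s x : AlgebraicClosure F) = σ x :=
    fun x => AlgEquiv.restrictNormalHom_apply Finf σ x
  let w' : ValuationSubring Finf := w.comap (s : Finf →+* Finf)
  have hmem : ∀ x, x ∈ w' ↔ s x ∈ w := fun x => Iff.rfl
  refine ⟨w', fun v hw => smul_mem_placesOver s hmem hw, ?_⟩
  let θ : CompletionAt w' ≃+* CompletionAt w := CompletionAt.congr s.toRingEquiv hmem
  obtain ⟨Θ, hΘ⟩ : ∃ Θ : AlgebraicClosure (CompletionAt w') ≃+* AlgebraicClosure (CompletionAt w),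
      ∀ x, Θ (algebraMap _ _ x) = algebraMap _ _ (θ x) :=
    ⟨IsAlgClosure.equivOfEquiv _ _ θ, IsAlgClosure.equivOfEquiv_algebraMap _ _ θ⟩
  have hθ : ∀ x : Finf, Θ (localEmb w' x) = localEmb w (s x : AlgebraicClosure F) := by
    intro x
    rw [localEmb_coe, localEmb_coe, hΘ]
    congr 1
    exact CompletionAt.congr_emb s.toRingEquiv hmem x
  obtain ⟨σ', hσ'⟩ : ∃ σ' : Gal(AlgebraicClosure F/F), ∀ x,
      localEmb w (σ' x) = Θ (localEmb w' x) := by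
    let a : AlgebraicClosure F →ₐ[F] AlgebraicClosure (CompletionAt w) :=
      (localEmb w).restrictScalars F
    let b : AlgebraicClosure F →ₐ[F] AlgebraicClosure (CompletionAt w) :=
      { toRingHom := Θ.toRingHom.comp (localEmb w').toRingHom
        commutes' := fun x => by
          have h1 := hθ (algebraMap F Finf x)
          rw [s.commutes] at h1
          refine h1.trans ?_
          exact a.commutes x }
    let _ : Algebra (AlgebraicClosure F) (AlgebraicClosure (CompletionAt w)) :=
      a.toRingHom.toAlgebra
    have : IsScalarTower F (AlgebraicClosure F) (AlgebraicClosure (CompletionAt w)) :=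
      IsScalarTower.of_algebraMap_eq fun x => (a.commutes x).symm
    refine ⟨b.restrictNormal' (AlgebraicClosure F), fun x => ?_⟩
    exact b.restrictNormal_commutes (AlgebraicClosure F) x
  refine ⟨σ', fun x hx => ?_, fun τ => ?_⟩
  · refine (localEmb w).injective ?_
    refine Eq.trans ?_ (hσ' x).symm
    refine Eq.trans ?_ (hθ ⟨x, hx⟩).symm
    exact congrArg (localEmb w) (hs ⟨x, hx⟩).symm
  · let τ' : Gal(AlgebraicClosure (CompletionAt w')/CompletionAt w') :=
      AlgEquiv.ofRingEquiv (f := (Θ.trans τ.toRingEquiv).trans Θ.symm) (fun x => by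
        simp only [RingEquiv.trans_apply, hΘ, AlgEquiv.coe_ringEquiv, AlgEquiv.commutes]
        rw [← hΘ, Θ.symm_apply_apply])
    refine ⟨τ', ?_⟩
    ext x
    refine (localEmb w').injective (Θ.injective ?_)
    refine (congrArg Θ (localEmb_localRes w' τ' x)).trans ?_
    have e1 : Θ (τ' (localEmb w' x)) = τ (Θ (localEmb w' x)) := Θ.apply_symm_apply _
    rw [e1]
    refine Eq.trans ?_ (hσ' _)
    rw [← hσ', ← localEmb_localRes, ← AlgEquiv.mul_apply, ← AlgEquiv.mul_apply]
    congr 2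
    group


/-- If `c` is locally trivial at all places above `v`, then so are its translates. -/
theorem loc_conj_eq_zero [Normal F Finf] {v : HeightOneSpectrum (𝓞 F)}
    {c : GlobalH1 E p k Finf} (hc : ∀ w ∈ placesOver Finf v, loc E p k w c = 0)
    (σ : Gal(AlgebraicClosure F/F)) {w : ValuationSubring Finf} (hw : w ∈ placesOver Finf v) :
    loc E p k w (globalConj E p k σ c) = 0 := by
  obtain ⟨w', hw', σ', hres, hτ⟩ := exists_conj_local Finf σ w
  rw [globalConj_congr E p k hres]
  obtain ⟨c, rfl⟩ := H1.mk_surjective _ c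
  · obtain ⟨m, hm⟩ := (H1.map_mk_eq_zero _ _ _ _ c).1 (hc w' (hw' v hw))
    refine (H1.map_conj_mk_eq_zero (localResS E p w) (continuous_localResS E p w)
      _ _ c (resS E p σ')).2 ⟨pTors.rep p k (Pts.rep E (AlgebraicClosure F)) σ' m, fun τ => ?_⟩
    obtain ⟨τ', hτ'⟩ := hτ τ
    have h1 : pTors.map p k (Pts.map E (FS E p).val) (c.1 (localResS E p w' τ')) =
        pTors.rep p k (Pts.rep E (AlgebraicClosure F)) (localRes w' τ') m - m := hm τ'
    have h2 : conjHom (galS E p Finf) (resS E p σ') (localResS E p w τ) = localResS E p w' τ' := by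
      ext1
      rw [coe_conjHom]
      change (resS E p σ')⁻¹ * resS E p (localRes w τ) * resS E p σ' = resS E p (localRes w' τ')
      rw [hτ', map_mul, map_mul, map_inv]
    change pTors.map p k (Pts.map E (FS E p).val) (globalRep E p k (resS E p σ')
      (c.1 (conjHom (galS E p Finf) (resS E p σ') (localResS E p w τ)))) =
      pTors.rep p k (Pts.rep E (AlgebraicClosure F)) (localRes w τ)
        (pTors.rep p k (Pts.rep E (AlgebraicClosure F)) σ' m) -
        pTors.rep p k (Pts.rep E (AlgebraicClosure F)) σ' m
    rw [h2, incl_globalRep, h1, map_sub, hτ']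
    congr 1
    have h3 : ∀ a b : Gal(AlgebraicClosure F/F), pTors.rep p k (Pts.rep E (AlgebraicClosure F)) a
        (pTors.rep p k (Pts.rep E (AlgebraicClosure F)) b m) =
        pTors.rep p k (Pts.rep E (AlgebraicClosure F)) (a * b) m := by
      intro a b
      rw [map_mul]
      rfl
    rw [h3, h3]
    congr 2
    group

theorem conj_mem_fineSelmer [Normal F Finf] (σ : Gal(AlgebraicClosure F/F))
    {c : GlobalH1 E p k Finf} (hc : c ∈ fineSelmer E p k Finf) :
    globalConj E p k σ c ∈ fineSelmer E p k Finf := by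
  have hc' : ∀ v ∈ badPrimes E p, ∀ w ∈ placesOver Finf v, loc E p k w c = 0 := by
    intro v hv w hw
    exact congrFun (congrFun hc ⟨v, hv⟩) ⟨w, hw⟩
  refine funext fun v => funext fun w => ?_
  exact loc_conj_eq_zero E p k Finf (hc' v.1 v.2) σ w.2

variable {Finf} in
/-- A lift of an element of `Gal(F_∞/F)` to `Gal(F̄/F)`. -/
def lift [Normal F Finf] (γ : Gal(Finf/F)) : Gal(AlgebraicClosure F/F) :=
  Function.surjInv (AlgEquiv.restrictNormalHom_surjective (F := F) (K₁ := Finf)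
    (AlgebraicClosure F)) γ

variable {Finf} in
theorem restrict_lift [Normal F Finf] (γ : Gal(Finf/F)) :
    AlgEquiv.restrictNormalHom Finf (lift γ) = γ :=
  Function.surjInv_eq _ γ

variable {Finf} in
/-- The natural action of `γ ∈ Γ = Gal(F_∞/F)` on the fine Selmer group: conjugation by a lift of
`γ`, which does not depend on the lift (see `coe_gammaAct`). -/
def gammaAct [Normal F Finf] (γ : Gal(Finf/F)) : AddMonoid.End (fineSelmer E p k Finf) :=
  ((globalConj E p k (lift γ)).comp
    (fineSelmer E p k Finf).subtype).codRestrict (fineSelmer E p k Finf)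
    fun c => conj_mem_fineSelmer E p k Finf (lift γ) c.2

variable {Finf} in
theorem coe_gammaAct [Normal F Finf] {γ : Gal(Finf/F)} {σ : Gal(AlgebraicClosure F/F)}
    (hσ : AlgEquiv.restrictNormalHom Finf σ = γ) (c : fineSelmer E p k Finf) :
    (gammaAct E p k γ c : GlobalH1 E p k Finf) =
      globalConj E p k σ c := by
  have h : ∀ x ∈ Finf, lift γ x = σ x := by
    intro x hx
    have h1 := AlgEquiv.restrictNormalHom_apply Finf (lift γ) ⟨x, hx⟩
    have h2 := AlgEquiv.restrictNormalHom_apply Finf σ ⟨x, hx⟩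
    rw [restrict_lift] at h1
    rw [hσ] at h2
    exact h1.symm.trans h2
  exact DFunLike.congr_fun (globalConj_congr E p k h) _

variable {Finf} in
theorem gammaAct_mul [Normal F Finf] (γ δ : Gal(Finf/F)) :
    gammaAct E p k (γ * δ) = gammaAct E p k γ * gammaAct E p k δ := by
  refine AddMonoidHom.ext fun c => Subtype.ext ?_
  have h : AlgEquiv.restrictNormalHom Finf (lift γ * lift δ) = γ * δ := by
    rw [map_mul, restrict_lift, restrict_lift]
  refine (coe_gammaAct E p k h c).trans ?_
  rw [globalConj_mul]
  rfl

variable {Finf} in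
theorem gammaAct_one [Normal F Finf] : gammaAct E p k (1 : Gal(Finf/F)) = 1 := by
  refine AddMonoidHom.ext fun c => Subtype.ext ?_
  refine (coe_gammaAct E p k (σ := 1) (map_one _) c).trans ?_
  rw [globalConj_one]
  rfl

variable {Finf} in
theorem gammaAct_pow [Normal F Finf] (γ : Gal(Finf/F)) (n : ℕ) :
    gammaAct E p k (γ ^ n) = gammaAct E p k γ ^ n := by
  induction n with
  | zero => rw [pow_zero, pow_zero, gammaAct_one]
  | succ n ih => rw [pow_succ, gammaAct_mul, ih, pow_succ]

variable {Finf} in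
theorem gammaAct_eventually [IsGalois F Finf] (c : fineSelmer E p k Finf) :
    ∀ᶠ γ in 𝓝 (1 : Gal(Finf/F)), gammaAct E p k γ c = c := by
  have h1 : ∀ᶠ g in 𝓝 (1 : Gal(FS E p/F)),
      conj (globalRep E p k) (galS E p Finf) g c.1 = c.1 := by
    refine conj_eventually _ _ (fun P => ?_) c.1
    filter_upwards [Pts.rep_eventually E P.1] with σ hσ
    exact Subtype.ext hσ
  have h2 : ∀ᶠ σ in 𝓝 (1 : Gal(AlgebraicClosure F/F)),
      globalConj E p k σ c.1 = c.1 := by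
    have hcont : Continuous (resS E p) := InfiniteGalois.restrictNormalHom_continuous (FS E p)
    have := hcont.tendsto 1
    rw [map_one] at this
    exact this.eventually h1
  have hr : Continuous (AlgEquiv.restrictNormalHom (F := F) (K₁ := AlgebraicClosure F) Finf) :=
    InfiniteGalois.restrictNormalHom_continuous Finf
  have hopen : IsOpenMap (AlgEquiv.restrictNormalHom (F := F) (K₁ := AlgebraicClosure F) Finf) :=
    (MonoidHom.isOpenQuotientMap_of_isQuotientMap
      (hr.isClosedMap.isQuotientMap hr
        (AlgEquiv.restrictNormalHom_surjective (AlgebraicClosure F)))).isOpenMap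
  have h3 := hopen.image_mem_nhds h2
  rw [map_one] at h3
  filter_upwards [h3] with γ hγ
  obtain ⟨σ, hσ, rfl⟩ := hγ
  exact Subtype.ext ((coe_gammaAct E p k rfl c).trans hσ)

/-- The extension `L/K` has Galois group topologically isomorphic to `ℤ_p`. -/
class IsZpExtension (p : ℕ) [Fact p.Prime] (K L : Type*) [Field K] [Field L] [Algebra K L] :
    Prop where
  nonempty_equiv : Nonempty (Gal(L/K) ≃ₜ* Multiplicative ℤ_[p])

theorem IsZpExtension.tendsto_pow (p : ℕ) [Fact p.Prime] {K L : Type*} [Field K] [Field L]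
    [Algebra K L] [IsZpExtension p K L] (γ : Gal(L/K)) :
    Filter.Tendsto (fun m : ℕ => γ ^ p ^ m) Filter.atTop (𝓝 1) := by
  obtain ⟨e⟩ := IsZpExtension.nonempty_equiv (p := p) (K := K) (L := L)
  have h1 : Filter.Tendsto (fun m : ℕ => (p : ℤ_[p]) ^ m * (e γ).toAdd) Filter.atTop (𝓝 0) := by
    have : Filter.Tendsto (fun m : ℕ => (p : ℤ_[p]) ^ m) Filter.atTop (𝓝 0) :=
      tendsto_pow_atTop_nhds_zero_of_norm_lt_one (by
        rw [PadicInt.norm_p]; exact inv_lt_one_of_one_lt₀ (by exact_mod_cast (Fact.out : p.Prime).one_lt))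
    simpa using this.mul_const (e γ).toAdd
  have h2 : Filter.Tendsto (fun m : ℕ => e.symm (Multiplicative.ofAdd ((p : ℤ_[p]) ^ m * (e γ).toAdd)))
      Filter.atTop (𝓝 (e.symm (Multiplicative.ofAdd 0))) :=
    ((e.symm.continuous.comp continuous_ofAdd).tendsto 0).comp h1
  have h3 : e.symm (Multiplicative.ofAdd 0) = 1 := map_one e.symm
  rw [h3] at h2
  refine h2.congr fun m => ?_
  apply e.injective
  rw [map_pow]
  refine (e.apply_symm_apply _).trans ?_
  apply Multiplicative.toAdd.injective
  simp [toAdd_pow]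

variable {Finf} in
theorem gammaAct_nilpotent [Fact p.Prime] [IsGalois F Finf] [IsZpExtension p F Finf]
    (γ : Gal(Finf/F)) (c : fineSelmer E p k Finf) :
    ∃ j : ℕ, p ^ j • c = 0 ∧
      ((gammaAct E p k γ - 1) ^ j : AddMonoid.End (fineSelmer E p k Finf)) c = 0 := by
  obtain ⟨n, hn⟩ := H1.exists_pow_nsmul _ c.1
  have hn' : p ^ n • c = 0 := Subtype.ext hn
  obtain ⟨m, hm⟩ := ((IsZpExtension.tendsto_pow p γ).eventually
    (gammaAct_eventually E p k c)).exists
  rw [gammaAct_pow] at hm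
  obtain ⟨j, hj⟩ := exists_pow_sub_one_apply_eq_zero Fact.out _ c hm hn'
  refine ⟨n + j, ?_, ?_⟩
  · rw [add_comm, pow_add, mul_smul, hn', smul_zero]
  · rw [pow_add]
    refine (congrArg ((gammaAct E p k γ - 1) ^ n : AddMonoid.End (fineSelmer E p k Finf)) hj).trans ?_
    exact map_zero _

variable {Finf} in
/-- The fine Selmer group `R(E/F_∞)`, regarded as a module over `Λ = ℤ_p⟦T⟧` on which `T` acts as
`γ - 1`. -/
def SelmerModule [IsGalois F Finf] (_γ : Gal(Finf/F)) : Type _ := fineSelmer E p ⊤ Finf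

variable {Finf} in
instance [IsGalois F Finf] (γ : Gal(Finf/F)) : AddCommGroup (SelmerModule E p γ) :=
  inferInstanceAs (AddCommGroup (fineSelmer E p ⊤ Finf))

variable {Finf} in
instance [Fact p.Prime] [IsGalois F Finf] [IsZpExtension p F Finf] (γ : Gal(Finf/F)) :
    Module (IwasawaAlg p) (SelmerModule E p γ) :=
  IwasawaAlg.discreteModule (A := fineSelmer E p ⊤ Finf) (τ := gammaAct E p ⊤ γ - 1)
    (gammaAct_nilpotent E p ⊤ γ)

variable {Finf} in
theorem X_smul [Fact p.Prime] [IsGalois F Finf] [IsZpExtension p F Finf] (γ : Gal(Finf/F))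
    (c : fineSelmer E p ⊤ Finf) :
    (PowerSeries.X : IwasawaAlg p) • (show SelmerModule E p γ from c) =
      (gammaAct E p ⊤ γ c - c : fineSelmer E p ⊤ Finf) :=
  IwasawaAlg.X_discreteSMul (gammaAct_nilpotent E p ⊤ γ) c

end FineSelmer

end

/-!
At a prime `v ∤ p` of good reduction, reduction is injective on `p`-power torsion, so inertia acts
trivially on it and `E[p ^ ∞]` is defined over `F_S`. Since `E[p ^ ∞]` is divisible,
`H¹(F_S/F_∞, E[p]) → H¹(F_S/F_∞, E[p ^ ∞])[p]` is surjective. A lift of a class of `R(E/F_∞)[p]` is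
locally in `ker h`, and it lies in `R(E[p]/F_∞)` when it is locally trivial; hence
`#R(E/F_∞)[p] ≤ #R(E[p]/F_∞) * #ker h`.

This bounds the dual of `R(E/F_∞)` modulo `p`, and Nakayama's lemma over `ℤ_p` makes it a quotient
of `ℤ_p ^ B`, where `p ^ B` is the bound. Then `T` satisfies a monic polynomial whose Weierstrass
preparation is a distinguished annihilator, which excludes the summands `Λ` and `Λ / (p ^ μ)`, and
`λ` is the rank over `ℤ_p`, at most `B`.
-/

noncomputable section

/-! ### Changes of variables on points -/

section VariableChange

open WeierstrassCurve WeierstrassCurve.Affine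

variable {K : Type*} [Field K] (W : WeierstrassCurve K) (C : VariableChange K)

theorem equation_variableChange_iff (x y : K) :
    (C • W).toAffine.Equation x y ↔ W.toAffine.Equation (C.u ^ 2 * x + C.r)
      (C.u ^ 3 * y + C.u ^ 2 * C.s * x + C.t) := by
  have hu : (C.u : K) ≠ 0 := C.u.ne_zero
  rw [equation_iff', equation_iff', ← mul_eq_zero_iff_left (pow_ne_zero 6 hu)]
  simp only [variableChange_a₁, variableChange_a₂, variableChange_a₃, variableChange_a₄,
    variableChange_a₆, Units.val_inv_eq_inv_val]
  congr! 1
  field_simp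
  ring

theorem nonsingular_variableChange_iff (x y : K) :
    (C • W).toAffine.Nonsingular x y ↔ W.toAffine.Nonsingular (C.u ^ 2 * x + C.r)
      (C.u ^ 3 * y + C.u ^ 2 * C.s * x + C.t) := by
  have hu : (C.u : K) ≠ 0 := C.u.ne_zero
  rw [nonsingular_iff', nonsingular_iff', equation_variableChange_iff]
  refine and_congr_right fun _ => ?_
  set X := (C.u : K) ^ 2 * x + C.r with hX
  set Y := (C.u : K) ^ 3 * y + C.u ^ 2 * C.s * x + C.t with hY
  have hpolyY : 2 * y + (C • W).a₁ * x + (C • W).a₃ = (C.u : K)⁻¹ ^ 3 *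
      (2 * Y + W.a₁ * X + W.a₃) := by
    simp only [variableChange_a₁, variableChange_a₃, Units.val_inv_eq_inv_val, hX, hY]
    field_simp
    ring
  have hpolyX : (C • W).a₁ * y - (3 * x ^ 2 + 2 * (C • W).a₂ * x + (C • W).a₄) = (C.u : K)⁻¹ ^ 4 *
      ((W.a₁ * Y - (3 * X ^ 2 + 2 * W.a₂ * X + W.a₄)) + C.s * (2 * Y + W.a₁ * X + W.a₃)) := by
    simp only [variableChange_a₁, variableChange_a₂, variableChange_a₄, Units.val_inv_eq_inv_val,
      hX, hY]
    field_simp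
    ring
  rw [hpolyY, hpolyX]
  by_cases h : 2 * Y + W.a₁ * X + W.a₃ = 0 <;> simp [h]

theorem negY_variableChange (x y : K) :
    W.toAffine.negY (C.u ^ 2 * x + C.r) (C.u ^ 3 * y + C.u ^ 2 * C.s * x + C.t) =
      C.u ^ 3 * (C • W).toAffine.negY x y + C.u ^ 2 * C.s * x + C.t := by
  have hu : (C.u : K) ≠ 0 := C.u.ne_zero
  simp only [negY, variableChange_a₁, variableChange_a₃, Units.val_inv_eq_inv_val]
  field_simp
  ring

theorem variableChange_X_inj {x₁ x₂ : K} :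
    (C.u : K) ^ 2 * x₁ + C.r = C.u ^ 2 * x₂ + C.r ↔ x₁ = x₂ := by
  have hu : (C.u : K) ≠ 0 := C.u.ne_zero
  simp [hu]

theorem variableChange_Y_inj {x y₁ y₂ : K} :
    (C.u : K) ^ 3 * y₁ + C.u ^ 2 * C.s * x + C.t = C.u ^ 3 * y₂ + C.u ^ 2 * C.s * x + C.t ↔
      y₁ = y₂ := by
  have hu : (C.u : K) ≠ 0 := C.u.ne_zero
  simp [hu]

variable [DecidableEq K]

theorem slope_variableChange {x₁ x₂ y₁ y₂ : K} (h₁ : (C • W).toAffine.Equation x₁ y₁)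
    (h₂ : (C • W).toAffine.Equation x₂ y₂)
    (hxy : ¬(x₁ = x₂ ∧ y₁ = (C • W).toAffine.negY x₂ y₂)) :
    W.toAffine.slope (C.u ^ 2 * x₁ + C.r) (C.u ^ 2 * x₂ + C.r)
      (C.u ^ 3 * y₁ + C.u ^ 2 * C.s * x₁ + C.t) (C.u ^ 3 * y₂ + C.u ^ 2 * C.s * x₂ + C.t) =
      C.u * (C • W).toAffine.slope x₁ x₂ y₁ y₂ + C.s := by
  have hu : (C.u : K) ≠ 0 := C.u.ne_zero
  by_cases hx : x₁ = x₂
  · subst hx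
    have hy : y₁ ≠ (C • W).toAffine.negY x₁ y₂ := fun h => hxy ⟨rfl, h⟩
    obtain rfl : y₁ = y₂ := Y_eq_of_Y_ne h₁ h₂ rfl hy
    have hd : y₁ - (C • W).toAffine.negY x₁ y₁ ≠ 0 := sub_ne_zero.2 hy
    rw [slope_of_Y_ne rfl hy, slope_of_Y_ne rfl (by
      rw [negY_variableChange]; exact fun h => hy ((variableChange_Y_inj C).1 h))]
    rw [negY_variableChange]
    have : C.u ^ 3 * y₁ + C.u ^ 2 * C.s * x₁ + C.t - (C.u ^ 3 * (C • W).toAffine.negY x₁ y₁ +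
        C.u ^ 2 * C.s * x₁ + C.t) = C.u ^ 3 * (y₁ - (C • W).toAffine.negY x₁ y₁) := by ring
    rw [this, div_eq_iff (mul_ne_zero (pow_ne_zero 3 hu) hd)]
    field_simp
    simp only [negY, variableChange_a₁, variableChange_a₂, variableChange_a₃, variableChange_a₄,
      Units.val_inv_eq_inv_val]
    field_simp
    ring
  · have hd : x₁ - x₂ ≠ 0 := sub_ne_zero.2 hx
    rw [slope_of_X_ne hx, slope_of_X_ne fun h => hx ((variableChange_X_inj C).1 h)]
    have : (C.u : K) ^ 2 * x₁ + C.r - (C.u ^ 2 * x₂ + C.r) = C.u ^ 2 * (x₁ - x₂) := by ring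
    rw [this]
    field_simp
    ring

/-- The homomorphism `(x, y) ↦ (u²x + r, u³y + u²sx + t)` from the points of `C • W` to the points
of `W`. -/
def variableChangeHom : (C • W).toAffine.Point →+ W.toAffine.Point where
  toFun P := match P with
    | .zero => .zero
    | .some _ _ h => .some _ _ ((nonsingular_variableChange_iff W C _ _).1 h)
  map_zero' := rfl
  map_add' := by
    rintro (_ | ⟨x₁, y₁, h₁⟩) (_ | ⟨x₂, y₂, h₂⟩)
    · rfl
    · rw [← Point.zero_def, zero_add]; exact (zero_add _).symm
    · rw [← Point.zero_def, add_zero]; exact (add_zero _).symm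
    · by_cases hxy : x₁ = x₂ ∧ y₁ = (C • W).toAffine.negY x₂ y₂
      · rw [Point.add_of_Y_eq hxy.1 hxy.2, Point.add_of_Y_eq]
        · rfl
        · rw [hxy.1]
        · rw [negY_variableChange, hxy.1, hxy.2]
      · rw [Point.add_some hxy, Point.add_some]
        · have hu : (C.u : K) ≠ 0 := C.u.ne_zero
          simp only [Point.some.injEq]
          rw [slope_variableChange W C h₁.1 h₂.1 hxy]
          simp only [addX, addY, negAddY, negY, variableChange_a₁, variableChange_a₂,
            variableChange_a₃, Units.val_inv_eq_inv_val]
          constructor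
          · field_simp
            ring
          · field_simp
            ring
        · rintro ⟨h, h'⟩
          have h := (variableChange_X_inj C).1 h
          subst h
          rw [negY_variableChange] at h'
          exact hxy ⟨rfl, (variableChange_Y_inj C).1 h'⟩

theorem variableChangeHom_some {x y : K} (h : (C • W).toAffine.Nonsingular x y) :
    variableChangeHom W C (.some x y h) =
      .some _ _ ((nonsingular_variableChange_iff W C _ _).1 h) := rfl

theorem variableChangeHom_injective : Function.Injective (variableChangeHom W C) := by
  rw [injective_iff_map_eq_zero]
  rintro (_ | ⟨x, y, h⟩) hP
  · rfl
  · exact absurd hP (Point.some_ne_zero _)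

theorem variableChangeHom_surjective : Function.Surjective (variableChangeHom W C) := by
  have hu : (C.u : K) ≠ 0 := C.u.ne_zero
  rintro (_ | ⟨x, y, h⟩)
  · exact ⟨0, rfl⟩
  · have hx : C.u ^ 2 * ((x - C.r) / C.u ^ 2) + C.r = x := by field_simp; ring
    have hy : C.u ^ 3 * ((y - C.t - C.s * (x - C.r)) / C.u ^ 3) +
        C.u ^ 2 * C.s * ((x - C.r) / C.u ^ 2) + C.t = y := by
      field_simp
      ring
    refine ⟨.some ((x - C.r) / C.u ^ 2) ((y - C.t - C.s * (x - C.r)) / C.u ^ 3) ?_, ?_⟩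
    · rwa [nonsingular_variableChange_iff, hx, hy]
    · rw [variableChangeHom_some]
      simp only [Point.some.injEq]
      exact ⟨hx, hy⟩

end VariableChange

/-! ### Curves with cuspidal reduction -/

section CuspidalReduction

open WeierstrassCurve WeierstrassCurve.Affine IsLocalRing

section Lines

variable {K : Type*} [Field K] {W : WeierstrassCurve K}

theorem vieta_addX_slope [DecidableEq K] {x₁ x₂ y₁ y₂ : K} (h₁ : W.toAffine.Equation x₁ y₁)
    (h₂ : W.toAffine.Equation x₂ y₂) (hxy : ¬(x₁ = x₂ ∧ y₁ = W.toAffine.negY x₂ y₂))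
    {ℓ x₃ ν : K} (hℓ : ℓ = W.toAffine.slope x₁ x₂ y₁ y₂) (hx₃ : x₃ = W.toAffine.addX x₁ x₂ ℓ)
    (hν : ν = y₁ - ℓ * x₁) :
    x₁ + x₂ + x₃ = ℓ ^ 2 + W.a₁ * ℓ - W.a₂ ∧
    x₁ * x₂ + x₁ * x₃ + x₂ * x₃ = W.a₄ - 2 * ℓ * ν - W.a₁ * ν - W.a₃ * ℓ ∧
    x₁ * x₂ * x₃ = ν ^ 2 + W.a₃ * ν - W.a₆ := by
  have key := addPolynomial_slope h₁ h₂ hxy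
  rw [← hℓ, ← hx₃, addPolynomial_eq, neg_inj, Cubic.prod_X_sub_C_eq] at key
  have hb := Cubic.b_of_eq key
  have hc := Cubic.c_of_eq key
  have hd := Cubic.d_of_eq key
  dsimp only at hb hc hd
  refine ⟨?_, ?_, ?_⟩
  · linear_combination hb
  · rw [hν]; linear_combination -hc
  · rw [hν]; linear_combination hd

theorem Y_eq_slope_mul_sub_add [DecidableEq K] {x₁ x₂ y₁ y₂ : K} (h₁ : W.toAffine.Equation x₁ y₁)
    (h₂ : W.toAffine.Equation x₂ y₂) (hxy : ¬(x₁ = x₂ ∧ y₁ = W.toAffine.negY x₂ y₂)) :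
    y₂ = W.toAffine.slope x₁ x₂ y₁ y₂ * (x₂ - x₁) + y₁ := by
  by_cases hx : x₁ = x₂
  · subst hx
    have hy := Y_eq_of_Y_ne h₁ h₂ rfl fun h => hxy ⟨rfl, h⟩
    rw [hy]; ring
  · have : x₁ - x₂ ≠ 0 := sub_ne_zero.2 hx
    rw [slope_of_X_ne hx]
    field_simp
    ring

theorem slope_mul_of_Y_ne_negY [DecidableEq K] {x y₁ y₂ : K} (h₁ : W.toAffine.Equation x y₁)
    (h₂ : W.toAffine.Equation x y₂) (hy : y₁ ≠ W.toAffine.negY x y₂) :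
    W.toAffine.slope x x y₁ y₂ * (2 * y₁ + W.a₁ * x + W.a₃) =
      3 * x ^ 2 + 2 * W.a₂ * x + W.a₄ - W.a₁ * y₁ := by
  obtain rfl := Y_eq_of_Y_ne h₁ h₂ rfl hy
  have hd : 2 * y₁ + W.a₁ * x + W.a₃ = y₁ - W.toAffine.negY x y₁ := by rw [negY]; ring
  rw [slope_of_Y_ne rfl hy, hd, div_mul_cancel₀ _ (sub_ne_zero.2 hy)]

theorem equation_inv_coordinates {x y z w : K} (h : W.toAffine.Equation x y) (hw : w * y = 1)
    (hz : x = z * y) :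
    w + W.a₁ * z * w + W.a₃ * w ^ 2 =
      z ^ 3 + W.a₂ * z ^ 2 * w + W.a₄ * z * w ^ 2 + W.a₆ * w ^ 3 := by
  have hy : y ≠ 0 := right_ne_zero_of_mul_eq_one hw
  have e := (equation_iff ..).1 h
  rw [hz] at e
  rw [eq_inv_of_mul_eq_one_left hw]
  field_simp
  linear_combination e

end Lines

section Chord

variable {R : Type*} [CommRing R] (W : WeierstrassCurve R)

/-- The denominator of the slope of the line through the points `(z₁, w₁)` and `(z₂, w₂)` of `W`
in the coordinates `z = x / y`, `w = 1 / y` around the origin of the group law; see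
`sub_mul_chordDenom`. -/
def chordDenom (z₁ w₁ w₂ : R) : R :=
  1 + W.a₁ * z₁ + W.a₃ * (w₁ + w₂) - W.a₂ * z₁ ^ 2 - W.a₄ * z₁ * (w₁ + w₂) -
    W.a₆ * (w₁ ^ 2 + w₁ * w₂ + w₂ ^ 2)

/-- The numerator of the slope of the line through the points `(z₁, w₁)` and `(z₂, w₂)` of `W`
in the coordinates `z = x / y`, `w = 1 / y` around the origin of the group law; see
`sub_mul_chordDenom`. -/
def chordNum (z₁ z₂ w₂ : R) : R :=
  z₁ ^ 2 + z₁ * z₂ + z₂ ^ 2 + W.a₂ * w₂ * (z₁ + z₂) + W.a₄ * w₂ ^ 2 - W.a₁ * w₂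

variable {W}

theorem sub_mul_chordDenom {z₁ w₁ z₂ w₂ : R}
    (h₁ : w₁ + W.a₁ * z₁ * w₁ + W.a₃ * w₁ ^ 2 =
      z₁ ^ 3 + W.a₂ * z₁ ^ 2 * w₁ + W.a₄ * z₁ * w₁ ^ 2 + W.a₆ * w₁ ^ 3)
    (h₂ : w₂ + W.a₁ * z₂ * w₂ + W.a₃ * w₂ ^ 2 =
      z₂ ^ 3 + W.a₂ * z₂ ^ 2 * w₂ + W.a₄ * z₂ * w₂ ^ 2 + W.a₆ * w₂ ^ 3) :
    (w₁ - w₂) * chordDenom W z₁ w₁ w₂ = (z₁ - z₂) * chordNum W z₁ z₂ w₂ := by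
  rw [chordDenom, chordNum]
  linear_combination h₁ - h₂

end Chord

section Slope

variable {K : Type*} [Field K] {W : WeierstrassCurve K}

theorem chordNum_mul_eq_of_tangent {x y z w : K} (h : W.toAffine.Equation x y) (hw : w * y = 1)
    (hz : x = z * y) {ℓ : K}
    (hℓ : ℓ * (2 * y + W.a₁ * x + W.a₃) = 3 * x ^ 2 + 2 * W.a₂ * x + W.a₄ - W.a₁ * y) :
    chordNum W z z w * (y - ℓ * x) = -ℓ * chordDenom W z w w := by
  have hy : y ≠ 0 := right_ne_zero_of_mul_eq_one hw
  have hz' : z = x / y := by rw [hz]; field_simp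
  have e := (equation_iff ..).1 h
  rw [chordNum, chordDenom, hz', eq_inv_of_mul_eq_one_left hw]
  field_simp
  linear_combination -y * hℓ + 3 * ℓ * e

/-- The line `y = ℓ x + ν` reads `w = 1 / ν - (ℓ / ν) z` in the coordinates `z = x / y` and
`w = 1 / y`. -/
theorem chordNum_mul_eq_neg_slope_mul [DecidableEq K] {x₁ x₂ y₁ y₂ : K}
    (h₁ : W.toAffine.Equation x₁ y₁) (h₂ : W.toAffine.Equation x₂ y₂)
    (hxy : ¬(x₁ = x₂ ∧ y₁ = W.toAffine.negY x₂ y₂))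
    {z₁ w₁ z₂ w₂ : K} (hw₁ : w₁ * y₁ = 1) (hz₁ : x₁ = z₁ * y₁) (hw₂ : w₂ * y₂ = 1)
    (hz₂ : x₂ = z₂ * y₂) (hD : chordDenom W z₁ w₁ w₂ ≠ 0) :
    chordNum W z₁ z₂ w₂ * (y₁ - W.toAffine.slope x₁ x₂ y₁ y₂ * x₁) =
      -W.toAffine.slope x₁ x₂ y₁ y₂ * chordDenom W z₁ w₁ w₂ := by
  have hy₁ : y₁ ≠ 0 := right_ne_zero_of_mul_eq_one hw₁
  by_cases hx : x₁ = x₂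
  · subst hx
    have hy : y₁ ≠ W.toAffine.negY x₁ y₂ := fun h => hxy ⟨rfl, h⟩
    have hℓ := slope_mul_of_Y_ne_negY h₁ h₂ hy
    obtain rfl : y₁ = y₂ := Y_eq_of_Y_ne h₁ h₂ rfl hy
    obtain rfl : w₁ = w₂ := mul_right_cancel₀ hy₁ (hw₁.trans hw₂.symm)
    obtain rfl : z₁ = z₂ := mul_right_cancel₀ hy₁ (hz₁.symm.trans hz₂)
    exact chordNum_mul_eq_of_tangent h₁ hw₁ hz₁ hℓ
  · have hDN := sub_mul_chordDenom (equation_inv_coordinates h₁ hw₁ hz₁)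
      (equation_inv_coordinates h₂ hw₂ hz₂)
    have hy₂ := Y_eq_slope_mul_sub_add h₁ h₂ hxy
    set ℓ := W.toAffine.slope x₁ x₂ y₁ y₂
    have line₁ : w₁ * (y₁ - ℓ * x₁) = 1 - ℓ * z₁ := by
      rw [hz₁]; linear_combination (1 - ℓ * z₁) * hw₁
    have line₂ : w₂ * (y₁ - ℓ * x₁) = 1 - ℓ * z₂ := by
      linear_combination hw₂ - w₂ * hy₂ - ℓ * w₂ * hz₂ - ℓ * z₂ * hw₂
    have hz : z₁ - z₂ ≠ 0 := fun hz => by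
      rw [hz, zero_mul, mul_eq_zero, or_iff_left hD, sub_eq_zero] at hDN
      rw [← hDN] at hw₂
      have hy : y₁ = y₂ := mul_left_cancel₀ (left_ne_zero_of_mul_eq_one hw₁) (hw₁.trans hw₂.symm)
      exact hx (by rw [hz₁, hz₂, sub_eq_zero.1 hz, hy])
    refine mul_left_cancel₀ hz ?_
    linear_combination (-(y₁ - ℓ * x₁)) * hDN + chordDenom W z₁ w₁ w₂ * (line₁ - line₂)

end Slope

theorem exists_mul_eq_one_of_residue_eq_one {R : Type*} [CommRing R] [IsLocalRing R] {a : R}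
    (h : residue R a = 1) : ∃ b : R, a * b = 1 ∧ residue R b = 1 := by
  have ha : IsUnit a := by
    rw [← residue_ne_zero_iff_isUnit, h]
    exact one_ne_zero
  obtain ⟨b, hb⟩ := ha.exists_right_inv
  refine ⟨b, hb, ?_⟩
  have := congrArg (residue R) hb
  rwa [map_mul, h, one_mul, map_one] at this

/-- The reduction of the Weierstrass curve `W` over a local ring is the cuspidal cubic
`y² = x³`. -/
structure ReducesToCusp {R : Type*} [CommRing R] [IsLocalRing R] (W : WeierstrassCurve R) :
    Prop where
  a₁ : residue R W.a₁ = 0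
  a₂ : residue R W.a₂ = 0
  a₃ : residue R W.a₃ = 0
  a₄ : residue R W.a₄ = 0
  a₆ : residue R W.a₆ = 0

variable {K : Type*} [Field K]

/-- `CuspParam O P κ` says that the point `P = (x, y)` has `x = z / w` and `y = 1 / w` with `z` and
`w` in the valuation ring `O`, and that `κ` is the residue class of `z`. If the curve reduces to the
cuspidal cubic, then `P ↦ κ` is the isomorphism `(x, y) ↦ x / y` of the smooth locus of the
reduction with the additive group. -/
def CuspParam (O : ValuationSubring K) {W : WeierstrassCurve K} (P : W.toAffine.Point)
    (κ : ResidueField O) : Prop :=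
  match P with
  | .zero => κ = 0
  | .some x y _ => ∃ z w : O, (w : K) * y = 1 ∧ x = z * y ∧ residue O z = κ

variable {O : ValuationSubring K}

theorem cuspParam_zero {W : WeierstrassCurve K} {κ : ResidueField O} :
    CuspParam O (0 : W.toAffine.Point) κ ↔ κ = 0 := Iff.rfl

theorem cuspParam_some {W : WeierstrassCurve K} {x y : K} {h : W.toAffine.Nonsingular x y}
    {κ : ResidueField O} :
    CuspParam O (Point.some x y h) κ ↔
      ∃ z w : O, (w : K) * y = 1 ∧ x = z * y ∧ residue O z = κ := Iff.rfl

theorem CuspParam.unique {W : WeierstrassCurve K} {P : W.toAffine.Point} {κ κ' : ResidueField O}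
    (h : CuspParam O P κ) (h' : CuspParam O P κ') : κ = κ' := by
  rcases P with _ | ⟨x, y, hP⟩
  · exact (cuspParam_zero.1 h).trans (cuspParam_zero.1 h').symm
  · obtain ⟨z, w, hw, hz, rfl⟩ := h
    obtain ⟨z', _, _, hz', rfl⟩ := h'
    have hy : y ≠ 0 := right_ne_zero_of_mul_eq_one hw
    rw [Subtype.ext (mul_right_cancel₀ hy (hz.symm.trans hz')) (a1 := z) (a2 := z')]

theorem line_vieta {W : WeierstrassCurve K} {x₁ x₂ x₃ ℓ ν m c : K}
    (s₁ : x₁ + x₂ + x₃ = ℓ ^ 2 + W.a₁ * ℓ - W.a₂)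
    (s₂ : x₁ * x₂ + x₁ * x₃ + x₂ * x₃ = W.a₄ - 2 * ℓ * ν - W.a₁ * ν - W.a₃ * ℓ)
    (s₃ : x₁ * x₂ * x₃ = ν ^ 2 + W.a₃ * ν - W.a₆) (hc : c * ν = 1) (hm : m = -ℓ * c) :
    (1 - m * x₁) * (1 - m * x₂) * (1 - m * x₃) =
        1 + W.a₂ * m + W.a₄ * m ^ 2 + W.a₆ * m ^ 3 ∧
      c * (x₁ * (1 - m * x₂) * (1 - m * x₃) + x₂ * (1 - m * x₁) * (1 - m * x₃) +
        x₃ * (1 - m * x₁) * (1 - m * x₂)) =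
        W.a₁ * m + W.a₃ * m ^ 2 - W.a₂ * c - 2 * W.a₄ * m * c - 3 * W.a₆ * m ^ 2 * c := by
  have hc0 : c ≠ 0 := left_ne_zero_of_mul_eq_one hc
  have hν : ν = c⁻¹ := eq_inv_of_mul_eq_one_right hc
  have hℓ : ℓ = -m / c := by rw [hm]; field_simp
  have hU : (1 - m * x₁) * (1 - m * x₂) * (1 - m * x₃) = 1 - m * (x₁ + x₂ + x₃) +
      m ^ 2 * (x₁ * x₂ + x₁ * x₃ + x₂ * x₃) - m ^ 3 * (x₁ * x₂ * x₃) := by ring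
  have hV : c * (x₁ * (1 - m * x₂) * (1 - m * x₃) + x₂ * (1 - m * x₁) * (1 - m * x₃) +
      x₃ * (1 - m * x₁) * (1 - m * x₂)) = c * ((x₁ + x₂ + x₃) -
        2 * m * (x₁ * x₂ + x₁ * x₃ + x₂ * x₃) + 3 * m ^ 2 * (x₁ * x₂ * x₃)) := by ring
  rw [hU, hV, s₁, s₂, s₃, hℓ, hν]
  constructor
  · field_simp
    ring
  · field_simp
    ring

variable {W₀ : WeierstrassCurve O} (hW : ReducesToCusp W₀)

include hW

theorem CuspParam.neg {P : (W₀.map O.subtype).toAffine.Point} {κ : ResidueField O}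
    (h : CuspParam O P κ) : CuspParam O (-P) (-κ) := by
  rcases P with _ | ⟨x, y, hP⟩
  · have h : κ = 0 := h
    rw [← Point.zero_def, h, Point.neg_zero, cuspParam_zero, neg_zero]
  · obtain ⟨z, w, hw, hz, hκ⟩ := h
    rw [Point.neg_some, cuspParam_some]
    obtain ⟨b, hb, hb'⟩ := exists_mul_eq_one_of_residue_eq_one (a := 1 + W₀.a₁ * z + W₀.a₃ * w)
      (by simp [hW.a₁, hW.a₃])
    have hbK : (1 + (W₀.a₁ : K) * z + W₀.a₃ * w) * b = 1 := congrArg Subtype.val hb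
    refine ⟨-(z * b), -(w * b), ?_, ?_, ?_⟩
    · change (-(w * b : K)) * (-y - W₀.a₁ * x - W₀.a₃) = 1
      rw [hz]
      linear_combination hbK + (b + b * W₀.a₁ * z) * hw
    · change x = (-(z * b : K)) * (-y - W₀.a₁ * x - W₀.a₃)
      rw [hz]
      linear_combination (-z * y) * hbK + (z * b * W₀.a₃ : K) * hw
    · simp [hb', hκ]

theorem ReducesToCusp.exists_line [DecidableEq K] {x₁ x₂ y₁ y₂ : K}
    (h₁ : (W₀.map O.subtype).toAffine.Equation x₁ y₁)
    (h₂ : (W₀.map O.subtype).toAffine.Equation x₂ y₂)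
    (hxy : ¬(x₁ = x₂ ∧ y₁ = (W₀.map O.subtype).toAffine.negY x₂ y₂))
    {z₁ w₁ z₂ w₂ : O} (hw₁ : (w₁ : K) * y₁ = 1) (hz₁ : x₁ = z₁ * y₁)
    (hw₂ : (w₂ : K) * y₂ = 1) (hz₂ : x₂ = z₂ * y₂) {ℓ : K}
    (hℓ : ℓ = (W₀.map O.subtype).toAffine.slope x₁ x₂ y₁ y₂) :
    ∃ m c : O, (c : K) * (y₁ - ℓ * x₁) = 1 ∧ (m : K) = -ℓ * c := by
  obtain ⟨b, hb, -⟩ := exists_mul_eq_one_of_residue_eq_one (a := chordDenom W₀ z₁ w₁ w₂)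
    (by simp [chordDenom, hW.a₁, hW.a₂, hW.a₃, hW.a₄, hW.a₆])
  have hbK : chordDenom (W₀.map O.subtype) (z₁ : K) w₁ w₂ * b = 1 := congrArg Subtype.val hb
  have hslope := chordNum_mul_eq_neg_slope_mul h₁ h₂ hxy hw₁ hz₁ hw₂ hz₂
    (left_ne_zero_of_mul_eq_one hbK)
  rw [← hℓ] at hslope
  have hm : ((chordNum W₀ z₁ z₂ w₂ * b : O) : K) * (y₁ - ℓ * x₁) = -ℓ := by
    change chordNum (W₀.map O.subtype) (z₁ : K) z₂ w₂ * b * (y₁ - ℓ * x₁) = -ℓ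
    linear_combination (b : K) * hslope - ℓ * hbK
  set m := chordNum W₀ z₁ z₂ w₂ * b
  have hc : ((w₁ - m * z₁ : O) : K) * (y₁ - ℓ * x₁) = 1 := by
    change ((w₁ : K) - m * z₁) * (y₁ - ℓ * x₁) = 1
    linear_combination hw₁ - (w₁ * ℓ : K) * hz₁ - (ℓ * z₁) * hw₁ - (z₁ : K) * hm
  refine ⟨m, w₁ - m * z₁, hc, mul_right_cancel₀ (right_ne_zero_of_mul_eq_one hc) ?_⟩
  rw [hm, mul_assoc, hc, mul_one]

/-- The `z`-coordinates of the three points on a line `w = c + m z` are the roots of the cubic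
polynomial obtained by substituting it into the equation in `z` and `w`. Its coefficients of `z³`
and `z²` are `U` and `-V`. -/
theorem CuspParam.third {x₁ x₂ x₃ y₁ y₂ y₃ ℓ ν : K} {m c : O} {κ₁ κ₂ : ResidueField O}
    (s₁ : x₁ + x₂ + x₃ = ℓ ^ 2 + W₀.a₁ * ℓ - W₀.a₂)
    (s₂ : x₁ * x₂ + x₁ * x₃ + x₂ * x₃ = W₀.a₄ - 2 * ℓ * ν - W₀.a₁ * ν - W₀.a₃ * ℓ)
    (s₃ : x₁ * x₂ * x₃ = ν ^ 2 + W₀.a₃ * ν - W₀.a₆)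
    (hy₁ : y₁ = ℓ * x₁ + ν) (hy₂ : y₂ = ℓ * x₂ + ν) (hy₃ : y₃ = ℓ * x₃ + ν)
    (hc : (c : K) * ν = 1) (hm : (m : K) = -ℓ * c)
    {n₁ : (W₀.map O.subtype).toAffine.Nonsingular x₁ y₁}
    {n₂ : (W₀.map O.subtype).toAffine.Nonsingular x₂ y₂}
    {n₃ : (W₀.map O.subtype).toAffine.Nonsingular x₃ y₃}
    (h₁ : CuspParam O (.some x₁ y₁ n₁) κ₁) (h₂ : CuspParam O (.some x₂ y₂ n₂) κ₂) :
    CuspParam O (.some x₃ y₃ n₃) (-(κ₁ + κ₂)) := by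
  obtain ⟨z₁, _, _, hz₁, rfl⟩ := h₁
  obtain ⟨z₂, _, _, hz₂, rfl⟩ := h₂
  have line {x y : K} (hy : y = ℓ * x + ν) : 1 - m * x = (c : K) * y := by
    rw [hm, hy]; linear_combination -hc
  obtain ⟨hU, hV⟩ := line_vieta (W := W₀.map O.subtype) s₁ s₂ s₃ hc hm
  simp only [line hy₁, line hy₂, line hy₃] at hU hV
  obtain ⟨u, hu, -⟩ := exists_mul_eq_one_of_residue_eq_one
    (a := 1 + W₀.a₂ * m + W₀.a₄ * m ^ 2 + W₀.a₆ * m ^ 3) (by simp [hW.a₂, hW.a₄, hW.a₆])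
  have hu : (c : K) * y₁ * (c * y₂) * (c * y₃) * u = 1 := by
    rw [hU]; exact congrArg Subtype.val hu
  let V : O := W₀.a₁ * m + W₀.a₃ * m ^ 2 - W₀.a₂ * c - 2 * W₀.a₄ * m * c - 3 * W₀.a₆ * m ^ 2 * c
  have hz₃ : x₃ = ((V * u - z₁ - z₂ : O) : K) * y₃ := by
    change x₃ = (V * u - z₁ - z₂ : K) * y₃
    rw [show (V : K) = _ from hV.symm, hz₁, hz₂]
    linear_combination (-(z₁ * y₃ + z₂ * y₃ + x₃)) * hu
  rw [cuspParam_some]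
  refine ⟨V * u - z₁ - z₂, c + m * (V * u - z₁ - z₂), ?_, hz₃, ?_⟩
  · change ((c : K) + m * ((V * u - z₁ - z₂ : O) : K)) * y₃ = 1
    linear_combination -line hy₃ - m * hz₃
  · simp only [V, map_sub, map_mul, map_add, map_pow, hW.a₁, hW.a₂, hW.a₃, hW.a₄, hW.a₆]
    ring

variable [DecidableEq K]

theorem CuspParam.add {P Q : (W₀.map O.subtype).toAffine.Point} {κ κ' : ResidueField O}
    (hP : CuspParam O P κ) (hQ : CuspParam O Q κ') : CuspParam O (P + Q) (κ + κ') := by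
  rcases P with _ | ⟨x₁, y₁, n₁⟩
  · rwa [← Point.zero_def, zero_add, cuspParam_zero.1 hP, zero_add]
  rcases Q with _ | ⟨x₂, y₂, n₂⟩
  · rwa [← Point.zero_def, add_zero, cuspParam_zero.1 hQ, add_zero]
  by_cases hxy : x₁ = x₂ ∧ y₁ = (W₀.map O.subtype).toAffine.negY x₂ y₂
  · obtain ⟨rfl, rfl⟩ := hxy
    have hneg := CuspParam.neg hW hQ
    rw [Point.neg_some] at hneg
    rw [Point.add_of_Y_eq rfl rfl, cuspParam_zero, hP.unique hneg, neg_add_cancel]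
  obtain ⟨z₁, w₁, hw₁, hz₁, -⟩ := id hP
  obtain ⟨z₂, w₂, hw₂, hz₂, -⟩ := id hQ
  obtain ⟨m, c, hc, hm⟩ := hW.exists_line n₁.1 n₂.1 hxy hw₁ hz₁ hw₂ hz₂ rfl
  obtain ⟨s₁, s₂, s₃⟩ := vieta_addX_slope n₁.1 n₂.1 hxy rfl rfl rfl
  have hy₂ := Y_eq_slope_mul_sub_add n₁.1 n₂.1 hxy
  have third := CuspParam.third hW s₁ s₂ s₃ (by ring) (by linear_combination hy₂)
    (by rw [negAddY]; ring) hc hm (n₃ := nonsingular_negAdd n₁ n₂ hxy) hP hQ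
  have := CuspParam.neg hW third
  rw [Point.neg_some, neg_neg] at this
  rwa [Point.add_some hxy]

theorem CuspParam.nsmul {P : (W₀.map O.subtype).toAffine.Point} {κ : ResidueField O}
    (hP : CuspParam O P κ) (n : ℕ) : CuspParam O (n • P) (n • κ) := by
  induction n with
  | zero => rw [zero_smul, zero_smul, cuspParam_zero]
  | succ n ih => rw [succ_nsmul, succ_nsmul]; exact CuspParam.add hW ih hP

end CuspidalReduction

/-! ### Torsion and reduction -/

section TorsionReduction

open WeierstrassCurve WeierstrassCurve.Affine IsLocalRing

variable {K : Type*} [Field K]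

theorem slope_mul_eq_secant [DecidableEq K] {W : WeierstrassCurve K} {x₁ x₂ y₁ y₂ : K}
    (h₁ : W.toAffine.Equation x₁ y₁) (h₂ : W.toAffine.Equation x₂ y₂)
    (hxy : ¬(x₁ = x₂ ∧ y₁ = W.toAffine.negY x₂ y₂)) :
    W.toAffine.slope x₁ x₂ y₁ y₂ * (y₁ + y₂ + W.a₁ * x₁ + W.a₃) =
      x₁ ^ 2 + x₁ * x₂ + x₂ ^ 2 + W.a₂ * (x₁ + x₂) + W.a₄ - W.a₁ * y₂ := by
  by_cases hx : x₁ = x₂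
  · subst hx
    have hy : y₁ ≠ W.toAffine.negY x₁ y₂ := fun h => hxy ⟨rfl, h⟩
    have hℓ := slope_mul_of_Y_ne_negY h₁ h₂ hy
    obtain rfl : y₁ = y₂ := Y_eq_of_Y_ne h₁ h₂ rfl hy
    linear_combination hℓ
  · have hy₂ := Y_eq_slope_mul_sub_add h₁ h₂ hxy
    refine mul_right_cancel₀ (sub_ne_zero.2 hx) ?_
    linear_combination (equation_iff ..).1 h₁ - (equation_iff ..).1 h₂ +
      (y₁ + y₂ + W.a₁ * x₁ + W.a₃) * hy₂

variable {O : ValuationSubring K}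

theorem mem_valuationSubring_of_sq_add_mul_eq {b c y : K} (hb : b ∈ O) (hc : c ∈ O)
    (h : y ^ 2 + b * y = c) : y ∈ O := by
  rcases O.mem_or_inv_mem y with hy | hy
  · exact hy
  · by_cases hy0 : y = 0
    · rw [hy0]; exact O.zero_mem
    · have : y = -b + c * y⁻¹ := by
        rw [← h]; field_simp; ring
      rw [this]
      exact O.add_mem _ _ (O.neg_mem _ hb) (O.mul_mem _ _ hc hy)

theorem residue_eq_zero_of_inv_notMem {a : O} (h : (a : K)⁻¹ ∉ O) : residue O a = 0 := by
  by_contra h0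
  obtain ⟨b, hb⟩ := ((residue_ne_zero_iff_isUnit a).1 h0).exists_right_inv
  have hb : (a : K) * b = 1 := congrArg Subtype.val hb
  exact h (by rw [← eq_inv_of_mul_eq_one_right hb]; exact b.2)

variable {W₀ : WeierstrassCurve O}

theorem Y_mem_of_X_mem {x y : K} (h : (W₀.map O.subtype).toAffine.Equation x y) (hx : x ∈ O) :
    y ∈ O := by
  have e : y ^ 2 + (W₀.a₁ : K) * x * y + W₀.a₃ * y = x ^ 3 + W₀.a₂ * x ^ 2 + W₀.a₄ * x + W₀.a₆ :=
    (equation_iff ..).1 h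
  lift x to O using hx
  refine mem_valuationSubring_of_sq_add_mul_eq (b := ((W₀.a₁ * x + W₀.a₃ : O) : K))
    (c := ((x ^ 3 + W₀.a₂ * x ^ 2 + W₀.a₄ * x + W₀.a₆ : O) : K)) (Subtype.mem _) (Subtype.mem _) ?_
  push_cast
  linear_combination e

theorem div_notMem_of_X_notMem {x y : K} (h : (W₀.map O.subtype).toAffine.Equation x y)
    (hx : x ∉ O) : y / x ∉ O := by
  intro ht
  have hx0 : x ≠ 0 := by rintro rfl; exact hx O.zero_mem
  have e : y ^ 2 + (W₀.a₁ : K) * x * y + W₀.a₃ * y = x ^ 3 + W₀.a₂ * x ^ 2 + W₀.a₄ * x + W₀.a₆ :=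
    (equation_iff ..).1 h
  lift x⁻¹ to O using (O.mem_or_inv_mem x).resolve_left hx with q hq
  lift y / x to O using ht with t htx
  have hxt : x = ((t ^ 2 + W₀.a₁ * t + W₀.a₃ * q * t - W₀.a₂ - W₀.a₄ * q - W₀.a₆ * q ^ 2 : O) :
      K) := by
    push_cast
    rw [hq, htx]
    field_simp
    linear_combination -e
  exact hx (hxt ▸ Subtype.mem _)

theorem exists_param_of_X_notMem {x y : K} (h : (W₀.map O.subtype).toAffine.Equation x y)
    (hx : x ∉ O) :
    ∃ z X : O, (z : K) ≠ 0 ∧ residue O z = 0 ∧ residue O X = 1 ∧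
      (z : K)⁻¹ ^ 2 * X = x ∧ (z : K)⁻¹ ^ 3 * X = y := by
  have hx0 : x ≠ 0 := by rintro rfl; exact hx O.zero_mem
  have e : y ^ 2 + (W₀.a₁ : K) * x * y + W₀.a₃ * y = x ^ 3 + W₀.a₂ * x ^ 2 + W₀.a₄ * x + W₀.a₆ :=
    (equation_iff ..).1 h
  have ht : y / x ∉ O := div_notMem_of_X_notMem h hx
  have hy0 : y ≠ 0 := by rintro rfl; exact ht (by rw [zero_div]; exact O.zero_mem)
  have hz0 : x / y ≠ 0 := div_ne_zero hx0 hy0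
  have hz : x / y ∈ O := by simpa only [inv_div] using (O.mem_or_inv_mem (y / x)).resolve_left ht
  lift x⁻¹ to O using (O.mem_or_inv_mem x).resolve_left hx with q hq
  lift x / y to O using hz with z hzx
  have hzr : residue O z = 0 := residue_eq_zero_of_inv_notMem (by rwa [hzx, inv_div])
  let X : O := 1 + W₀.a₁ * z + W₀.a₃ * q * z - W₀.a₂ * z ^ 2 - W₀.a₄ * q * z ^ 2 -
    W₀.a₆ * q ^ 2 * z ^ 2
  have hX : (X : K) = x ^ 3 / y ^ 2 := by
    change 1 + (W₀.a₁ : K) * z + W₀.a₃ * q * z - W₀.a₂ * z ^ 2 - W₀.a₄ * q * z ^ 2 -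
      W₀.a₆ * q ^ 2 * z ^ 2 = _
    rw [hq, hzx]
    field_simp
    linear_combination e
  refine ⟨z, X, hz0, hzr, by simp [X, hzr], ?_, ?_⟩ <;>
  · rw [hX, hzx]
    field_simp

theorem ReducesToCusp.nsmul_ne_zero [DecidableEq K] (hW : ReducesToCusp W₀) {W : WeierstrassCurve K}
    (h : W = W₀.map O.subtype) {P : W.toAffine.Point} {κ : ResidueField O} (hP : CuspParam O P κ)
    {n : ℕ} (hn : (n : ResidueField O) * κ ≠ 0) : n • P ≠ 0 := by
  subst h
  intro h0
  have := CuspParam.nsmul hW hP n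
  rw [h0, cuspParam_zero, nsmul_eq_mul] at this
  exact hn this

/-- A point with nonintegral `x` is `(X / z², X / z³)` with `z` in the maximal ideal and `X`
reducing to `1`. Scaling by `z` moves it to the integral point `(X, X)` of a curve reducing to the
cuspidal cubic, on which multiplication by `n` is injective modulo the maximal ideal. -/
theorem X_mem_of_nsmul_eq_zero [DecidableEq K] {n : ℕ} (hn : (n : ResidueField O) ≠ 0) {x y : K}
    {h : (W₀.map O.subtype).toAffine.Nonsingular x y} (hP : n • Point.some x y h = 0) : x ∈ O := by
  by_contra hx
  obtain ⟨z, X, hz0, hz, hX, rfl, rfl⟩ := exists_param_of_X_notMem h.1 hx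
  obtain ⟨b, hb, -⟩ := exists_mul_eq_one_of_residue_eq_one hX
  have hbK : (X : K) * b = 1 := congrArg Subtype.val hb
  let C : VariableChange K := ⟨(Units.mk0 (z : K) hz0)⁻¹, 0, 0, 0⟩
  let W₁ : WeierstrassCurve O := ⟨z * W₀.a₁, z ^ 2 * W₀.a₂, z ^ 3 * W₀.a₃, z ^ 4 * W₀.a₄,
    z ^ 6 * W₀.a₆⟩
  have hcusp : ReducesToCusp W₁ := by constructor <;> simp [W₁, hz]
  have hW₁ : C • W₀.map O.subtype = W₁.map O.subtype := by
    ext <;> simp [C, W₁, variableChange_def]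
  have hCX : (C.u : K) ^ 2 * X + C.r = (z : K)⁻¹ ^ 2 * X := by simp [C]
  have hCY : (C.u : K) ^ 3 * X + C.u ^ 2 * C.s * X + C.t = (z : K)⁻¹ ^ 3 * X := by simp [C]
  have hns : (C • W₀.map O.subtype).toAffine.Nonsingular (X : K) X := by
    rwa [nonsingular_variableChange_iff, hCX, hCY]
  have hparam : CuspParam O (Point.some _ _ hns) 1 :=
    cuspParam_some.2 ⟨1, b, by rw [mul_comm]; exact hbK, by simp, map_one _⟩
  refine hcusp.nsmul_ne_zero hW₁ hparam (by rwa [mul_one]) ?_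
  apply variableChangeHom_injective
  rw [map_nsmul, variableChangeHom_some, map_zero, ← hP]
  congr 2

theorem not_secant_of_residue_Δ_ne_zero (hΔ : residue O W₀.Δ ≠ 0) {x₁ y₁ x₂ y₂ ℓ : O}
    (h₁ : (W₀.map O.subtype).toAffine.Equation (x₁ : K) y₁)
    (hx : residue O x₁ = residue O x₂) (hy : residue O y₁ = residue O (-y₂ - W₀.a₁ * x₂ - W₀.a₃))
    (hchord : ℓ * (x₁ - x₂) = y₁ - y₂)
    (hsec : ℓ * (y₁ + y₂ + W₀.a₁ * x₁ + W₀.a₃) =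
      x₁ ^ 2 + x₁ * x₂ + x₂ ^ 2 + W₀.a₂ * (x₁ + x₂) + W₀.a₄ - W₀.a₁ * y₂) : False := by
  have e : y₁ ^ 2 + W₀.a₁ * x₁ * y₁ + W₀.a₃ * y₁ = x₁ ^ 3 + W₀.a₂ * x₁ ^ 2 + W₀.a₄ * x₁ +
    W₀.a₆ := Subtype.ext ((equation_iff ..).1 h₁)
  replace e := congrArg (residue O) e
  replace hchord := congrArg (residue O) hchord
  replace hsec := congrArg (residue O) hsec
  simp only [map_mul, map_sub, map_add, map_pow, map_neg, hx] at e hchord hsec hy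
  have heq : (W₀.map (residue O)).toAffine.Equation (residue O x₂) (residue O y₁) :=
    (equation_iff ..).2 e
  rw [equation_iff_nonsingular_of_Δ_ne_zero (by rwa [map_Δ]), nonsingular_iff'] at heq
  have hy' : 2 * residue O y₁ + residue O W₀.a₁ * residue O x₂ + residue O W₀.a₃ = 0 := by
    linear_combination hy - hchord
  refine heq.2.elim (fun hx' => hx' ?_) fun hy'' => hy'' hy'
  change residue O W₀.a₁ * residue O y₁ - (3 * residue O x₂ ^ 2 + 2 * residue O W₀.a₂ *
    residue O x₂ + residue O W₀.a₄) = 0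
  linear_combination hsec - residue O ℓ * hy - residue O W₀.a₁ * hchord

/-- The difference of two such points has integral coordinates, hence so has the slope of the line
through the first and the opposite of the second. Modulo the maximal ideal this line would be a
tangent at a singular point. -/
theorem some_eq_some_of_residue_eq [DecidableEq K] {n : ℕ} (hn : (n : ResidueField O) ≠ 0)
    (hΔ : residue O W₀.Δ ≠ 0) {x₁ y₁ x₂ y₂ : O}
    {h₁ : (W₀.map O.subtype).toAffine.Nonsingular (x₁ : K) y₁}
    {h₂ : (W₀.map O.subtype).toAffine.Nonsingular (x₂ : K) y₂}
    (hP₁ : n • Point.some _ _ h₁ = 0) (hP₂ : n • Point.some _ _ h₂ = 0)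
    (hx : residue O x₁ = residue O x₂) (hy : residue O y₁ = residue O y₂) :
    Point.some _ _ h₁ = Point.some _ _ h₂ := by
  by_contra hne
  let y₂' : O := -y₂ - W₀.a₁ * x₂ - W₀.a₃
  have hy₂' : (W₀.map O.subtype).toAffine.negY x₂ y₂ = y₂' := rfl
  have hxy : ¬((x₁ : K) = x₂ ∧ (y₁ : K) = (W₀.map O.subtype).toAffine.negY x₂ y₂') := by
    rw [← hy₂', negY_negY]
    simpa using hne
  have hn₂ : (W₀.map O.subtype).toAffine.Nonsingular (x₂ : K) y₂' := by
    rwa [← hy₂', nonsingular_neg]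
  have hsub : n • (Point.some _ _ h₁ + Point.some _ _ hn₂) = 0 := by
    have : Point.some _ _ hn₂ = -Point.some _ _ h₂ := rfl
    rw [this, smul_add, smul_neg, hP₁, hP₂, neg_zero, add_zero]
  rw [Point.add_some hxy] at hsub
  have hchord := Y_eq_slope_mul_sub_add h₁.1 hn₂.1 hxy
  have hsec := slope_mul_eq_secant h₁.1 hn₂.1 hxy
  have hx₃ := X_mem_of_nsmul_eq_zero hn hsub
  have hℓ : (W₀.map O.subtype).toAffine.slope x₁ x₂ y₁ y₂' ∈ O := by
    refine mem_valuationSubring_of_sq_add_mul_eq W₀.a₁.2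
      (add_mem hx₃ (W₀.a₂ + x₁ + x₂ : O).2) ?_
    simp only [addX, map_a₁, map_a₂, ValuationSubring.subtype_apply]
    push_cast
    ring
  clear hsub hx₃
  lift (W₀.map O.subtype).toAffine.slope x₁ x₂ y₁ y₂' to O using hℓ with ℓ
  refine not_secant_of_residue_Δ_ne_zero hΔ h₁.1 (ℓ := ℓ) (y₂ := y₂') hx ?_ ?_
    (Subtype.ext hsec)
  · rw [hy]
    congr 1
    ring
  · refine Subtype.ext ?_
    push_cast
    linear_combination hchord

end TorsionReduction

/-! ### Divisibility of the group of points -/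

section Divisibility

open WeierstrassCurve WeierstrassCurve.Affine Filter

section FiniteComplement

variable {G : Type*} [AddGroup G] [Infinite G]

theorem addSubgroup_eq_top_of_finite_compl {H : AddSubgroup G} (hH : (H : Set G)ᶜ.Finite) :
    H = ⊤ := by
  by_contra hne
  obtain ⟨a, ha⟩ : ∃ a, a ∉ H := by
    by_contra! hall
    exact hne (eq_top_iff.2 fun a _ => hall a)
  have hfin : (H : Set G).Finite := by
    refine Set.Finite.of_finite_image (f := (a + ·)) (hH.subset ?_) (add_right_injective a).injOn
    rintro _ ⟨b, hb, rfl⟩ hab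
    exact ha ((AddSubgroup.add_mem_cancel_right H hb).1 hab)
  refine Set.infinite_univ (α := G) ?_
  rw [← Set.union_compl_self (H : Set G)]
  exact hfin.union hH

theorem not_eventually_map_mem_of_zero_notMem {H : Type*} [AddGroup H] (f : G →+ H) {T : Set H}
    (hT : T.Finite) (h0 : 0 ∉ T) : ¬ ∀ᶠ a in cofinite, f a ∈ T := by
  intro hev
  have hker : (f ⁻¹' {0}).Finite :=
    (eventually_cofinite.1 hev).subset fun a (ha : f a = 0) hmem => h0 (ha ▸ hmem)
  have hfib (b : H) : (f ⁻¹' {b}).Finite := by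
    rcases (f ⁻¹' {b}).eq_empty_or_nonempty with he | ⟨a, rfl⟩
    · rw [he]; exact Set.finite_empty
    · refine Set.Finite.of_finite_image (f := (-a + ·)) (hker.subset ?_)
        (add_right_injective _).injOn
      rintro _ ⟨b, hb : f b = f a, rfl⟩
      simp [hb]
  have hpre : (f ⁻¹' T).Finite := by
    rw [← Set.biUnion_preimage_singleton]
    exact hT.biUnion fun b _ => hfib b
  refine Set.infinite_univ (α := G) ?_
  rw [← Set.union_compl_self (f ⁻¹' T)]
  exact hpre.union (eventually_cofinite.1 hev)

end FiniteComplement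

theorem eventually_eval_ne_zero {R : Type*} [CommRing R] [IsDomain R] {B : Polynomial R}
    (hB : B ≠ 0) : ∀ᶠ x in cofinite, B.eval x ≠ 0 := by
  rw [eventually_cofinite]
  refine (Polynomial.finite_setOfPred_isRoot hB).subset fun x hx => ?_
  simpa using hx

variable {K : Type*} [Field K]

theorem subsingleton_setOf_natDegree_sub_C_mul_eq_zero {A B : Polynomial K} (hB : B ≠ 0)
    (hAB : ∀ c, A - Polynomial.C c * B ≠ 0) :
    {c : K | (A - Polynomial.C c * B).natDegree = 0}.Subsingleton := by
  intro c hc c' hc'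
  by_contra hne
  obtain ⟨a, ha⟩ := Polynomial.natDegree_eq_zero.1 hc
  obtain ⟨a', ha'⟩ := Polynomial.natDegree_eq_zero.1 hc'
  have hd : c' - c ≠ 0 := sub_ne_zero.2 (Ne.symm hne)
  obtain ⟨b, rfl⟩ : ∃ b, Polynomial.C b = B := by
    refine ⟨(a - a') / (c' - c), mul_left_cancel₀ (Polynomial.C_ne_zero.2 hd) ?_⟩
    rw [← Polynomial.C_mul, mul_div_cancel₀ _ hd, Polynomial.C_sub, Polynomial.C_sub, ha, ha']
    ring
  have hb : b ≠ 0 := Polynomial.C_ne_zero.1 hB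
  refine hAB (c + a / b) ?_
  rw [Polynomial.C_add, add_mul, ← sub_sub, ← ha, ← Polynomial.C_mul, div_mul_cancel₀ _ hb,
    sub_self]

variable {W : WeierstrassCurve K}

variable (W) in
theorem exists_nonsingular [IsAlgClosed K] [W.IsElliptic] (x : K) :
    ∃ y, W.toAffine.Nonsingular x y := by
  let f : Polynomial K := Polynomial.X ^ 2 + Polynomial.C (W.a₁ * x + W.a₃) * Polynomial.X -
    Polynomial.C (x ^ 3 + W.a₂ * x ^ 2 + W.a₄ * x + W.a₆)
  have hf : f.natDegree = 2 := by simp only [f]; compute_degree!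
  obtain ⟨y, hy⟩ := IsAlgClosed.exists_root f
    (Polynomial.degree_ne_of_natDegree_ne (by rw [hf]; norm_num))
  refine ⟨y, equation_iff_nonsingular.1 ((equation_iff ..).2 ?_)⟩
  simp only [f, Polynomial.IsRoot.def, Polynomial.eval_add, Polynomial.eval_sub,
    Polynomial.eval_mul, Polynomial.eval_pow, Polynomial.eval_X, Polynomial.eval_C] at hy
  linear_combination hy

theorem sq_sub_negY {x y : K} (h : W.toAffine.Equation x y) :
    (y - W.toAffine.negY x y) ^ 2 = W.Ψ₂Sq.eval x := by
  have e := (equation_iff ..).1 h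
  simp only [Ψ₂Sq, negY, b₂, b₄, b₆, Polynomial.eval_add, Polynomial.eval_mul,
    Polynomial.eval_pow, Polynomial.eval_X, Polynomial.eval_C]
  linear_combination 4 * e

theorem four_ne_zero_of_neZero_two [NeZero (2 : K)] : (4 : K) ≠ 0 := by
  have := mul_ne_zero (NeZero.ne (2 : K)) (NeZero.ne (2 : K))
  norm_num at this ⊢
  exact this

theorem some_eq_or_eq_neg {x y y' : K} (h : W.toAffine.Nonsingular x y)
    (h' : W.toAffine.Nonsingular x y') :
    Point.some x y h = Point.some x y' h' ∨ Point.some x y h = -Point.some x y' h' :=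
  Point.X_eq_iff.1 rfl

theorem eventually_point_of_eventually_X {p : W.toAffine.Point → Prop}
    (hp : ∀ᶠ x in cofinite, ∀ y h, p (Point.some x y h)) : ∀ᶠ P in cofinite, p P := by
  have hfib (x : K) : {P : W.toAffine.Point | ∃ y h, P = Point.some x y h}.Finite := by
    by_cases hx : ∃ y, W.toAffine.Nonsingular x y
    · obtain ⟨y, h⟩ := hx
      refine (Set.toFinite {Point.some x y h, -Point.some x y h}).subset ?_
      rintro _ ⟨y', h', rfl⟩
      exact some_eq_or_eq_neg h' h
    · refine Set.finite_empty.subset ?_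
      rintro _ ⟨y, h, -⟩
      exact hx ⟨y, h⟩
  refine eventually_cofinite.2 <| (((eventually_cofinite.1 hp).biUnion fun x _ => hfib x).union
    (Set.finite_singleton 0)).subset ?_
  rintro (_ | ⟨x, y, h⟩) hP
  · exact Or.inr rfl
  · exact Or.inl (Set.mem_biUnion (x := x) (fun hx => hP (hx y h)) ⟨y, h, rfl⟩)

theorem eval_Ψ₂Sq_ne_zero [W.IsElliptic] {x c : K} (hx : (W.Φ 2).eval x = c * W.Ψ₂Sq.eval x) :
    W.Ψ₂Sq.eval x ≠ 0 := by
  intro h0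
  rw [h0, mul_zero, Φ_two] at hx
  simp only [Ψ₂Sq, Polynomial.eval_sub, Polynomial.eval_add, Polynomial.eval_mul,
    Polynomial.eval_pow, Polynomial.eval_X, Polynomial.eval_C] at hx h0
  refine addSubMap_ne_zero W (x := ![x ^ 2, 2 * x, 1]) (fun h => ?_) ?_
  · simpa using congrFun h 2
  · ext i
    fin_cases i
    · simp [addSubMap]; linear_combination hx
    · simp [addSubMap]; linear_combination h0
    · simp [addSubMap]; ring

instance infinite_point [IsAlgClosed K] [W.IsElliptic] : Infinite W.toAffine.Point := by
  have : Infinite K := IsAlgClosed.instInfinite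
  choose y hy using exists_nonsingular W
  exact Infinite.of_injective (fun x => Point.some x (y x) (hy x)) fun x x' h => by
    simpa using (Point.some.inj h).1

section Points

variable [DecidableEq K]

theorem two_nsmul_some {x y : K} (h : W.toAffine.Nonsingular x y) (hΨ : W.Ψ₂Sq.eval x ≠ 0) :
    ∃ x' y' h', 2 • Point.some x y h = Point.some x' y' h' ∧
      x' * W.Ψ₂Sq.eval x = (W.Φ 2).eval x := by
  have e := (equation_iff ..).1 h.1
  have hsq := sq_sub_negY h.1
  have hd : y - W.toAffine.negY x y ≠ 0 := fun h0 => hΨ (by rw [← hsq, h0, sq, zero_mul])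
  have hy : y ≠ W.toAffine.negY x y := sub_ne_zero.1 hd
  refine ⟨_, _, _, (two_nsmul _).trans (Point.add_self_of_Y_ne hy), ?_⟩
  rw [← hsq, slope_of_Y_ne rfl hy, addX, Φ_two]
  simp only [Polynomial.eval_sub, Polynomial.eval_mul, Polynomial.eval_pow, Polynomial.eval_X,
    Polynomial.eval_C]
  field_simp
  rw [negY, b₄, b₆, b₈]
  linear_combination (-(4 : K) * x * 2 - W.a₁ ^ 2 - 4 * W.a₂) * e

theorem add_X_add_sub_X {x₁ y₁ x₂ y₂ : K} (h₁ : W.toAffine.Nonsingular x₁ y₁)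
    (h₂ : W.toAffine.Nonsingular x₂ y₂) (hx : x₁ ≠ x₂) :
    ∃ x y h x' y' h', Point.some x₁ y₁ h₁ + Point.some x₂ y₂ h₂ = Point.some x y h ∧
      Point.some x₁ y₁ h₁ - Point.some x₂ y₂ h₂ = Point.some x' y' h' ∧
      (x + x') * (x₁ - x₂) ^ 2 =
        2 * x₁ * x₂ * (x₁ + x₂) + W.b₂ * x₁ * x₂ + W.b₄ * (x₁ + x₂) + W.b₆ := by
  have e₁ := (equation_iff ..).1 h₁.1
  have e₂ := (equation_iff ..).1 h₂.1
  have hsub := Point.add_of_X_ne (h₁ := h₁) (h₂ := (nonsingular_neg ..).2 h₂) hx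
  refine ⟨_, _, _, _, _, _, Point.add_of_X_ne hx, (sub_eq_add_neg _ _).trans hsub, ?_⟩
  have hd : x₁ - x₂ ≠ 0 := sub_ne_zero.2 hx
  rw [slope_of_X_ne hx, slope_of_X_ne hx, addX, addX]
  field_simp
  rw [negY, b₂, b₄, b₆]
  linear_combination 2 * e₁ + 2 * e₂

variable (W) in
/-- The rational function `A / B` computes the `x`-coordinate of `n • P` for every point `P` with
`x`-coordinate `x`; the denominator is cleared, so the condition is weak where `B` vanishes. -/
def IsMulFormulaAt (n : ℕ) (A B : Polynomial K) (x : K) : Prop :=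
  ∀ y h, ∃ x' y' h', n • Point.some (W' := W.toAffine) x y h = Point.some x' y' h' ∧
    x' * B.eval x = A.eval x

variable (W) in
/-- The rational function `A / B` computes the `x`-coordinate of multiplication by `n`, for all but
finitely many `x`-coordinates. -/
def IsGenericMul (n : ℕ) (A B : Polynomial K) : Prop :=
  ∀ᶠ x in cofinite, IsMulFormulaAt W n A B x

variable {n : ℕ} {A B A' B' : Polynomial K} {x : K}

theorem IsMulFormulaAt.nsmul_eq_or_eq_neg (h : IsMulFormulaAt W n A B x) (hB : B.eval x ≠ 0)
    {c d y : K} (hc : A.eval x = c * B.eval x) (hP : W.toAffine.Nonsingular c d)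
    (hQ : W.toAffine.Nonsingular x y) :
    n • Point.some x y hQ = Point.some c d hP ∨ n • Point.some x y hQ = -Point.some c d hP := by
  obtain ⟨x', y', h', hmul, hx'⟩ := h y hQ
  obtain rfl : x' = c := mul_right_cancel₀ hB (hx'.trans hc)
  rw [hmul]
  exact some_eq_or_eq_neg h' hP

theorem IsMulFormulaAt.add_two (h : IsMulFormulaAt W n A' B' x)
    (h₁ : IsMulFormulaAt W (n + 1) A B x) (hAB : (A - Polynomial.X * B).eval x ≠ 0) :
    IsMulFormulaAt W (n + 2)
      ((Polynomial.C 2 * A * Polynomial.X * (A + Polynomial.X * B) +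
        Polynomial.C W.b₂ * A * Polynomial.X * B + Polynomial.C W.b₄ * B * (A + Polynomial.X * B) +
        Polynomial.C W.b₆ * B ^ 2) * B' - A' * (A - Polynomial.X * B) ^ 2)
      ((A - Polynomial.X * B) ^ 2 * B') x := by
  intro y hy
  obtain ⟨x₁, y₁, n₁, e₁, f₁⟩ := h y hy
  obtain ⟨x₂, y₂, n₂, e₂, f₂⟩ := h₁ y hy
  simp only [Polynomial.eval_sub, Polynomial.eval_mul, Polynomial.eval_X] at hAB
  have hne : x₂ ≠ x := by
    rintro rfl
    exact hAB (sub_eq_zero.2 f₂.symm)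
  obtain ⟨x₃, y₃, n₃, x₄, y₄, n₄, hadd, hsub, hsum⟩ := add_X_add_sub_X n₂ hy hne
  refine ⟨x₃, y₃, n₃, by rw [← hadd, ← e₂, ← succ_nsmul], ?_⟩
  obtain rfl : x₁ = x₄ := by
    rw [← e₂, succ_nsmul, add_sub_cancel_right, e₁] at hsub
    exact (Point.some.inj hsub).1
  simp only [Polynomial.eval_sub, Polynomial.eval_mul, Polynomial.eval_X, Polynomial.eval_add,
    Polynomial.eval_C, Polynomial.eval_pow]
  rw [← f₁, ← f₂]
  linear_combination (B.eval x ^ 2 * B'.eval x) * hsum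

theorem IsGenericMul.of_mul_left {g : Polynomial K} (hg : g ≠ 0)
    (h : IsGenericMul W n (g * A) (g * B)) : IsGenericMul W n A B := by
  filter_upwards [h, eventually_eval_ne_zero hg] with x hx hgx y hy
  obtain ⟨x', y', h', hmul, hx'⟩ := hx y hy
  refine ⟨x', y', h', hmul, mul_left_cancel₀ hgx ?_⟩
  rw [Polynomial.eval_mul, Polynomial.eval_mul] at hx'
  linear_combination hx'

variable [IsAlgClosed K] [W.IsElliptic]

theorem exists_two_nsmul_eq (P : W.toAffine.Point) : ∃ Q, 2 • Q = P := by
  rcases P with _ | ⟨c, d, h⟩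
  · exact ⟨0, smul_zero _⟩
  let f : Polynomial K := W.Φ 2 - Polynomial.C c * W.Ψ₂Sq
  have hf : f.natDegree = 4 := by simp only [f, Φ_two, Ψ₂Sq]; compute_degree!
  obtain ⟨x, hx⟩ := IsAlgClosed.exists_root f
    (Polynomial.degree_ne_of_natDegree_ne (by rw [hf]; norm_num))
  replace hx : (W.Φ 2).eval x = c * W.Ψ₂Sq.eval x := by
    simpa [f, sub_eq_zero] using hx
  have hΨ := eval_Ψ₂Sq_ne_zero hx
  obtain ⟨y, hy⟩ := exists_nonsingular W x
  have hmul : IsMulFormulaAt W 2 (W.Φ 2) W.Ψ₂Sq x := fun y hy => two_nsmul_some hy hΨ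
  rcases hmul.nsmul_eq_or_eq_neg hΨ hx h hy with he | he
  · exact ⟨_, he⟩
  · exact ⟨-Point.some x y hy, by rw [smul_neg, he, neg_neg]⟩

theorem exists_two_pow_nsmul_eq (k : ℕ) (P : W.toAffine.Point) : ∃ Q, 2 ^ k • Q = P := by
  induction k generalizing P with
  | zero => exact ⟨P, by simp⟩
  | succ k ih =>
    obtain ⟨Q, rfl⟩ := ih P
    obtain ⟨R, rfl⟩ := exists_two_nsmul_eq Q
    exact ⟨R, by rw [pow_succ, mul_smul]⟩

theorem IsGenericMul.sub_C_mul_ne_zero (h : IsGenericMul W n A B) (hB : B ≠ 0) (c : K) :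
    A - Polynomial.C c * B ≠ 0 := by
  intro h0
  obtain ⟨d, hd⟩ := exists_nonsingular W c
  refine not_eventually_map_mem_of_zero_notMem (nsmulAddMonoidHom (α := W.toAffine.Point) n)
    (T := {Point.some c d hd, -Point.some c d hd}) (Set.toFinite _) ?_
    (eventually_point_of_eventually_X ?_)
  · simp [eq_comm (a := (0 : W.toAffine.Point))]
  · filter_upwards [h, eventually_eval_ne_zero hB] with x hx hBx y hy
    refine hx.nsmul_eq_or_eq_neg hBx ?_ hd hy
    rw [sub_eq_zero.1 h0, Polynomial.eval_mul, Polynomial.eval_C]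

theorem exists_nsmul_eq_of_isGenericMul (hB : B ≠ 0) (hAB : IsCoprime A B)
    (h : IsGenericMul W n A B) (P : W.toAffine.Point) : ∃ Q, n • Q = P := by
  suffices htop : (nsmulAddMonoidHom (α := W.toAffine.Point) n).range = ⊤ from
    AddMonoidHom.range_eq_top.1 htop P
  have hdeg := subsingleton_setOf_natDegree_sub_C_mul_eq_zero hB (h.sub_C_mul_ne_zero hB)
  refine addSubgroup_eq_top_of_finite_compl (eventually_cofinite.1
    (eventually_point_of_eventually_X (p := (· ∈ AddMonoidHom.range _)) ?_))
  have hbad := hdeg.finite.union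
    ((eventually_cofinite.1 h).image fun x => A.eval x / B.eval x)
  filter_upwards [hbad.compl_mem_cofinite] with c hc d hd
  rw [Set.mem_compl_iff, Set.mem_union, not_or] at hc
  obtain ⟨x, hx⟩ := IsAlgClosed.exists_root (A - Polynomial.C c * B)
    (Polynomial.degree_ne_of_natDegree_ne hc.1)
  replace hx : A.eval x = c * B.eval x := by simpa [sub_eq_zero] using hx
  have hBx : B.eval x ≠ 0 := by
    intro h0
    obtain ⟨u, v, huv⟩ := hAB
    simpa [hx, h0] using congrArg (Polynomial.eval x) huv
  have hmul : IsMulFormulaAt W n A B x := by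
    by_contra hbad
    exact hc.2 ⟨x, hbad, by rw [div_eq_iff hBx, hx]⟩
  obtain ⟨y, hy⟩ := exists_nonsingular W x
  rcases hmul.nsmul_eq_or_eq_neg hBx hx hd hy with he | he
  · exact ⟨_, he⟩
  · exact ⟨-Point.some x y hy, by rw [nsmulAddMonoidHom_apply, smul_neg, he, neg_neg]⟩

variable [NeZero (2 : K)]

variable (W) in
theorem exists_two_torsion : ∃ P : W.toAffine.Point, P ≠ 0 ∧ 2 • P = 0 := by
  obtain ⟨x, hx⟩ := IsAlgClosed.exists_root W.Ψ₂Sq (Polynomial.degree_ne_of_natDegree_ne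
    (by rw [natDegree_Ψ₂Sq _ four_ne_zero_of_neZero_two]; norm_num))
  obtain ⟨y, h⟩ := exists_nonsingular W x
  refine ⟨Point.some x y h, Point.some_ne_zero _, (two_nsmul _).trans (Point.add_self_of_Y_eq ?_)⟩
  rw [← sub_eq_zero, ← sq_eq_zero_iff, sq_sub_negY h.1]
  exact hx

variable (W) in
theorem exists_nsmul_ne_zero {N : ℕ} (hN : N ≠ 0) : ∃ P : W.toAffine.Point, N • P ≠ 0 := by
  obtain ⟨k, m, ⟨j, rfl⟩, rfl⟩ := Nat.exists_eq_two_pow_mul_odd hN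
  obtain ⟨P, hP, hP2⟩ := exists_two_torsion W
  obtain ⟨Q, hQ⟩ := exists_two_pow_nsmul_eq k P
  refine ⟨Q, ?_⟩
  rwa [mul_comm, mul_smul, hQ, add_smul, mul_comm, mul_smul, hP2, smul_zero, zero_add, one_smul]

/-- Otherwise `n • P = ±P`, hence `(n - 1) * (n + 1) • P = 0`, for almost all `P`. -/
theorem IsGenericMul.sub_X_mul_ne_zero (h : IsGenericMul W n A B) (hn : 2 ≤ n) (hB : B ≠ 0) :
    A - Polynomial.X * B ≠ 0 := by
  intro h0
  obtain ⟨k, rfl⟩ : ∃ k, n = k + 1 := ⟨n - 1, by omega⟩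
  have hker : (nsmulAddMonoidHom (α := W.toAffine.Point) (k * (k + 2))).ker = ⊤ := by
    refine addSubgroup_eq_top_of_finite_compl (eventually_cofinite.1
      (eventually_point_of_eventually_X (p := (· ∈ AddMonoidHom.ker _)) ?_))
    filter_upwards [h, eventually_eval_ne_zero hB] with x hx hBx y hy
    have hxB : A.eval x = x * B.eval x := by
      rw [sub_eq_zero.1 h0, Polynomial.eval_mul, Polynomial.eval_X]
    rw [AddMonoidHom.mem_ker, nsmulAddMonoidHom_apply]
    rcases hx.nsmul_eq_or_eq_neg hBx hxB hy hy with he | he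
    · rw [succ_nsmul, add_eq_right] at he
      rw [mul_comm, mul_smul, he, smul_zero]
    · rw [mul_smul, succ_nsmul, he, neg_add_cancel, smul_zero]
  obtain ⟨P, hP⟩ := exists_nsmul_ne_zero W (N := k * (k + 2)) (mul_ne_zero (by omega) (by omega))
  exact hP (AddMonoidHom.mem_ker.1 (hker ▸ AddSubgroup.mem_top P))

variable (W) in
theorem exists_isGenericMul (n : ℕ) :
    ∃ A B : Polynomial K, B ≠ 0 ∧ IsGenericMul W (n + 1) A B := by
  induction n using Nat.twoStepInduction with
  | zero =>
    exact ⟨Polynomial.X, 1, one_ne_zero,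
      Eventually.of_forall fun x y h => ⟨x, y, h, by simp, by simp⟩⟩
  | one =>
    have hΨ : W.Ψ₂Sq ≠ 0 := W.Ψ₂Sq_ne_zero four_ne_zero_of_neZero_two
    exact ⟨W.Φ 2, W.Ψ₂Sq, hΨ,
      (eventually_eval_ne_zero hΨ).mono fun x hx y h => two_nsmul_some h hx⟩
  | more n ih₁ ih₂ =>
    obtain ⟨A', B', hB', h₁⟩ := ih₁
    obtain ⟨A, B, hB, h₂⟩ := ih₂
    have hne := h₂.sub_X_mul_ne_zero (by omega) hB
    exact ⟨_, _, mul_ne_zero (pow_ne_zero 2 hne) hB',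
      ((h₁.and h₂).and (eventually_eval_ne_zero hne)).mono fun _ hx =>
        hx.1.1.add_two hx.1.2 hx.2⟩

theorem exists_nsmul_eq_of_isAlgClosed {n : ℕ} (hn : n ≠ 0) (P : W.toAffine.Point) :
    ∃ Q, n • Q = P := by
  obtain ⟨k, rfl⟩ := Nat.exists_eq_add_one_of_ne_zero hn
  obtain ⟨A₀, B₀, hB₀, h₀⟩ := exists_isGenericMul W k
  obtain ⟨g, A, B, hAB, rfl, rfl⟩ :
      ∃ g A B : Polynomial K, IsCoprime A B ∧ A₀ = g * A ∧ B₀ = g * B := by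
    obtain ⟨A, B, hA, hB, hu⟩ := extract_gcd A₀ B₀
    exact ⟨_, A, B, (gcd_isUnit_iff A B).1 hu, hA, hB⟩
  exact exists_nsmul_eq_of_isGenericMul (right_ne_zero_of_mul hB₀) hAB
    (h₀.of_mul_left (left_ne_zero_of_mul hB₀)) P

end Points

end Divisibility

/-! ### Inertia groups away from `p` -/

section Inertia

open WeierstrassCurve WeierstrassCurve.Affine IsLocalRing

theorem fixed_of_nsmul_eq_zero {K : Type*} [Field K] [DecidableEq K] {O : ValuationSubring K}
    {W₀ : WeierstrassCurve O} {W : WeierstrassCurve K} (hW : W = W₀.map O.subtype) {n : ℕ}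
    (hn : (n : ResidueField O) ≠ 0) (hΔ : residue O W₀.Δ ≠ 0) {σ : K → K}
    (hσ : ∀ x ∈ O, σ x ∈ O ∧ (σ x - x = 0 ∨ (σ x - x)⁻¹ ∉ O)) {x y : K}
    {h : W.toAffine.Nonsingular x y} {h' : W.toAffine.Nonsingular (σ x) (σ y)}
    (hP : n • Point.some x y h = 0) (hP' : n • Point.some (σ x) (σ y) h' = 0) :
    σ x = x ∧ σ y = y := by
  subst hW
  have hx : x ∈ O := X_mem_of_nsmul_eq_zero hn hP
  have hy : y ∈ O := Y_mem_of_X_mem h.1 hx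
  have exists_lift (a : O) : ∃ b : O, (b : K) = σ a ∧ residue O b = residue O a := by
    obtain ⟨hmem, hsub⟩ := hσ a a.2
    refine ⟨⟨σ a, hmem⟩, rfl, ?_⟩
    rw [← sub_eq_zero, ← map_sub]
    rcases hsub with hsub | hsub
    · have : (⟨σ a, hmem⟩ - a : O) = 0 := Subtype.ext hsub
      rw [this, map_zero]
    · exact residue_eq_zero_of_inv_notMem hsub
  lift x to O using hx
  lift y to O using hy
  obtain ⟨x', hx', hxr⟩ := exists_lift x
  obtain ⟨y', hy', hyr⟩ := exists_lift y
  generalize σ x = X at *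
  generalize σ y = Y at *
  subst hx' hy'
  exact Point.some.inj (some_eq_some_of_residue_eq hn hΔ hP' hP hxr hyr)

namespace Pts

variable {F : Type*} [Field F] (E : WeierstrassCurve F) {L : Type*} [Field L] [Algebra F L]

theorem map_injective {L' : Type*} [Field L'] [Algebra F L'] (f : L →ₐ[F] L') :
    Function.Injective (map E f) := by
  classical
  exact Point.map_injective (W' := E.toAffine) f

theorem exists_map_eq (M : IntermediateField F L) {x y : L}
    (h : (E.baseChange L).toAffine.Nonsingular x y) (hx : x ∈ M) (hy : y ∈ M) :
    ∃ Q : Pts E M, map E M.val Q = (Point.some x y h : (E.baseChange L).toAffine.Point) := by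
  lift x to M using hx
  lift y to M using hy
  have h' : (E.baseChange M).toAffine.Nonsingular x y :=
    (baseChange_nonsingular E.toAffine (f := M.val) M.val.injective x y).1 h
  exact ⟨(Point.some x y h' : (E.baseChange M).toAffine.Point), rfl⟩

theorem exists_rep_variableChangeHom_some [DecidableEq L] (σ : Gal(L/F)) (C : VariableChange F)
    {x y : L} (h : (C.map (algebraMap F L) • E.baseChange L).toAffine.Nonsingular x y) :
    ∃ h', rep E L σ (variableChangeHom (E.baseChange L) (C.map (algebraMap F L))
        (.some x y h)) =
      variableChangeHom (E.baseChange L) (C.map (algebraMap F L)) (.some (σ x) (σ y) h') := by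
  obtain ⟨hns, hrep⟩ : ∃ hns, rep E L σ (variableChangeHom (E.baseChange L)
      (C.map (algebraMap F L)) (.some x y h)) =
        (Point.some (σ _) (σ _) hns : (E.baseChange L).toAffine.Point) := ⟨_, rfl⟩
  have hX : σ ((C.map (algebraMap F L)).u ^ 2 * x + (C.map (algebraMap F L)).r) =
      (C.map (algebraMap F L)).u ^ 2 * σ x + (C.map (algebraMap F L)).r := by
    simp [VariableChange.map]
  have hY : σ ((C.map (algebraMap F L)).u ^ 3 * y + (C.map (algebraMap F L)).u ^ 2 *
        (C.map (algebraMap F L)).s * x + (C.map (algebraMap F L)).t) =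
      (C.map (algebraMap F L)).u ^ 3 * σ y + (C.map (algebraMap F L)).u ^ 2 *
        (C.map (algebraMap F L)).s * σ x + (C.map (algebraMap F L)).t := by
    simp [VariableChange.map]
  have h' : (C.map (algebraMap F L) • E.baseChange L).toAffine.Nonsingular (σ x) (σ y) := by
    rw [nonsingular_variableChange_iff, ← hX, ← hY]
    exact hns
  refine ⟨h', hrep.trans ?_⟩
  rw [variableChangeHom_some]
  congr 1

end Pts

namespace FineSelmer

open NumberField IsDedekindDomain

variable {F : Type*} [Field F] [NumberField F]

/-- The inclusion of the ring of `v`-integers of `F` into the valuation ring of a place of `L`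
above `v`. -/
def placeHom {L : Type*} [Field L] [Algebra F L] {v : HeightOneSpectrum (𝓞 F)}
    {w : ValuationSubring L} (hw : w ∈ placesOver L v) :
    (v.valuation F).valuationSubring →+* w :=
  ((algebraMap F L).comp (v.valuation F).valuationSubring.subtype).codRestrict w fun x => by
    have hx : (x : F) ∈ w.comap (algebraMap F L) := by
      rw [show w.comap (algebraMap F L) = _ from hw]
      exact x.2
    exact hx

variable {E : WeierstrassCurve F} {p : ℕ} {v : HeightOneSpectrum (𝓞 F)}

theorem exists_good_model (hv : HasGoodReductionAt E v)
    {L : Type*} [Field L] [Algebra F L] {w : ValuationSubring L} (hw : w ∈ placesOver L v) :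
    ∃ (C : VariableChange F) (W₀ : WeierstrassCurve w),
      C.map (algebraMap F L) • E.baseChange L = W₀.map w.subtype ∧ residue w W₀.Δ ≠ 0 := by
  let R := (v.valuation F).valuationSubring
  have hg : (E.minimal R).HasGoodReduction R := hv
  have hint := baseChange_integralModel_eq R (E.minimal R)
  refine ⟨(E.exists_isMinimal R).choose, (integralModel R (E.minimal R)).map (placeHom hw), ?_, ?_⟩
  · have hcomp : w.subtype.comp (placeHom hw) = (algebraMap F L).comp (algebraMap R F) := rfl
    rw [map_map, hcomp, ← map_map]
    change _ = ((integralModel R (E.minimal R)).baseChange F).map _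
    rw [hint]
    exact map_variableChange ..
  · have hell := (hasGoodReduction_iff_isElliptic_reduction R).1 hg
    have hres : IsUnit (residue R (integralModel R (E.minimal R)).Δ) := by
      rw [← map_Δ]
      exact hell.isUnit
    rw [map_Δ, residue_ne_zero_iff_isUnit]
    exact ((residue_ne_zero_iff_isUnit _).1 hres.ne_zero).map (placeHom hw)

theorem natCast_residue_ne_zero (hv : (p : 𝓞 F) ∉ v.asIdeal)
    {L : Type*} [Field L] [Algebra F L] {w : ValuationSubring L} (hw : w ∈ placesOver L v) :
    (p : ResidueField w) ≠ 0 := by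
  have hval : v.valuation F (p : F) = 1 := by
    simpa using v.valuation_eq_one_iff_notMem (K := F) (r := (p : 𝓞 F)) |>.2 hv
  have hunit : IsUnit (p : (v.valuation F).valuationSubring) :=
    (Valuation.valuationSubring.integers (v.valuation F)).isUnit_of_one' (by simpa using hval)
  rw [← map_natCast (residue w), residue_ne_zero_iff_isUnit, ← map_natCast (placeHom hw)]
  exact hunit.map (placeHom hw)

open Pointwise in
theorem rep_eq_of_mem_inertia (hv : v ∉ badPrimes E p)
    {w : ValuationSubring (AlgebraicClosure F)} (hw : w ∈ placesOver (AlgebraicClosure F) v)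
    {σ : w.decompositionSubgroup F} (hσ : σ ∈ w.inertiaSubgroup F)
    {P : Pts E (AlgebraicClosure F)} {n : ℕ} (hP : p ^ n • P = 0) :
    Pts.rep E (AlgebraicClosure F) σ P = P := by
  classical
  rw [badPrimes, Set.mem_ofPred_eq, not_or, not_not] at hv
  obtain ⟨C, W₀, hW, hΔ⟩ := exists_good_model hv.2 hw
  have hp : ((p ^ n : ℕ) : ResidueField w) ≠ 0 := by
    rw [Nat.cast_pow]
    exact pow_ne_zero n (natCast_residue_ne_zero hv.1 hw)
  have hstable (x) (hx : x ∈ w) : (σ : Gal(AlgebraicClosure F/F)) x ∈ w := by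
    have hσw : (σ : Gal(AlgebraicClosure F/F)) • w = w := σ.2
    exact hσw.le (ValuationSubring.smul_mem_pointwise_smul _ _ _ hx)
  rw [mem_inertia_iff] at hσ
  set C' := C.map (algebraMap F (AlgebraicClosure F))
  have hinj := variableChangeHom_injective (E.baseChange (AlgebraicClosure F)) C'
  obtain ⟨Q, rfl⟩ := variableChangeHom_surjective (E.baseChange (AlgebraicClosure F)) C' P
  rcases Q with _ | ⟨x, y, h⟩
  · rfl
  obtain ⟨h', hrep⟩ := Pts.exists_rep_variableChangeHom_some E (σ : Gal(AlgebraicClosure F/F)) C h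
  have hQ : p ^ n • Point.some x y h = 0 := by
    refine hinj ?_
    rw [map_nsmul, map_zero]
    exact hP
  have hQ' : p ^ n • Point.some _ _ h' = 0 := by
    refine hinj ?_
    rw [map_nsmul, ← hrep, map_zero]
    refine (map_nsmul (Pts.rep E (AlgebraicClosure F) σ) (p ^ n) _).symm.trans ?_
    rw [hP, map_zero]
    rfl
  have hfix := fixed_of_nsmul_eq_zero hW hp hΔ (fun a ha => ⟨hstable a ha, hσ a ha⟩) hQ hQ'
  rw [hrep]
  refine congrArg (variableChangeHom _ C') (?_ : _ = Point.some x y h)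
  rwa [Point.some.injEq]

theorem mem_FS_of_fixed {x : AlgebraicClosure F}
    (hx : ∀ v ∉ badPrimes E p, ∀ w ∈ placesOver (AlgebraicClosure F) v,
      ∀ σ ∈ w.inertiaSubgroup F, (σ : Gal(AlgebraicClosure F/F)) x = x) : x ∈ FS E p := by
  have hadjoin : IntermediateField.adjoin F {x} ≤ IntermediateField.fixedField
      (MulAction.stabilizer Gal(AlgebraicClosure F/F) x) := by
    rw [IntermediateField.adjoin_le_iff, Set.singleton_subset_iff, SetLike.mem_coe,
      IntermediateField.mem_fixedField_iff]
    exact fun _ hf => hf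
  have hle : IntermediateField.adjoin F {x} ≤ FS E p := by
    refine le_sSup fun v hv w hw σ hσ y hy => ?_
    exact (IntermediateField.mem_fixedField_iff _ _).1 (hadjoin hy) _ (hx v hv w hw σ hσ)
  exact hle (IntermediateField.mem_adjoin_simple_self F x)

theorem exists_map_eq_of_pow_nsmul_eq_zero {P : Pts E (AlgebraicClosure F)} {n : ℕ}
    (hP : p ^ n • P = 0) : ∃ Q : Pts E (FS E p), Pts.map E (FS E p).val Q = P := by
  rcases P with _ | ⟨x, y, h⟩
  · exact ⟨0, map_zero _⟩
  have hfix (v) (hv : v ∉ badPrimes E p) (w) (hw : w ∈ placesOver (AlgebraicClosure F) v) (σ)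
      (hσ : σ ∈ w.inertiaSubgroup F) : (σ : Gal(AlgebraicClosure F/F)) x = x ∧
        (σ : Gal(AlgebraicClosure F/F)) y = y :=
    Point.some.inj (rep_eq_of_mem_inertia hv hw hσ hP)
  exact Pts.exists_map_eq E (FS E p) h
    (mem_FS_of_fixed fun v hv w hw σ hσ => (hfix v hv w hw σ hσ).1)
    (mem_FS_of_fixed fun v hv w hw σ hσ => (hfix v hv w hw σ hσ).2)

theorem exists_nsmul_eq_pTors [E.IsElliptic] (hp : p ≠ 0) (a : pTors p ⊤ (Pts E (FS E p))) :
    ∃ b, p • b = a := by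
  classical
  have : (E.baseChange (AlgebraicClosure F)).IsElliptic :=
    inferInstanceAs (E.map (algebraMap F (AlgebraicClosure F))).IsElliptic
  obtain ⟨a, n, -, hn⟩ := a
  obtain ⟨Q, hQ⟩ : ∃ Q : Pts E (AlgebraicClosure F), p • Q = Pts.map E (FS E p).val a :=
    exists_nsmul_eq_of_isAlgClosed (W := E.baseChange (AlgebraicClosure F)) hp _
  have hQ0 : p ^ (n + 1) • Q = 0 := by
    rw [pow_succ, mul_smul, hQ, ← map_nsmul, hn, map_zero]
  obtain ⟨b, rfl⟩ := exists_map_eq_of_pow_nsmul_eq_zero hQ0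
  have hinj := Pts.map_injective E (FS E p).val
  refine ⟨⟨b, n + 1, le_top, hinj ?_⟩, Subtype.ext (hinj ?_)⟩
  · rw [map_nsmul, hQ0, map_zero]
  · exact (map_nsmul (Pts.map E (FS E p).val) p b).trans hQ

end FineSelmer

end Inertia

/-! ### The residual fine Selmer group -/

section ResidualSelmer

theorem finite_and_card_ker_comp_le {A B C : Type*} [AddCommGroup A] [AddCommGroup B]
    [AddCommGroup C] (g : B →+ C) (f : A →+ B) [Finite f.ker] [Finite g.ker] :
    Finite (g.comp f).ker ∧ Nat.card (g.comp f).ker ≤ Nat.card f.ker * Nat.card g.ker := by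
  have hle : (g.comp f).ker.map f ≤ g.ker := by
    rintro _ ⟨a, ha, rfl⟩
    exact ha
  have : Finite ((g.comp f).ker.map f) :=
    Finite.of_injective _ (AddSubgroup.inclusion_injective hle)
  have hker : f.ker ≤ (g.comp f).ker := fun a (ha : f a = 0) => (congrArg g ha).trans (map_zero g)
  have hcard : Nat.card f.ker * Nat.card ((g.comp f).ker.map f) = Nat.card (g.comp f).ker := by
    rw [← AddSubgroup.relIndex_ker, ← AddSubgroup.relIndex_bot_left,
      ← AddSubgroup.relIndex_bot_left (g.comp f).ker]
    exact AddSubgroup.relIndex_mul_relIndex _ _ _ bot_le hker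
  refine ⟨Nat.finite_of_card_ne_zero (hcard ▸ mul_ne_zero Nat.card_pos.ne' Nat.card_pos.ne'), ?_⟩
  rw [← hcard]
  exact Nat.mul_le_mul_left _ (Nat.card_le_card_of_injective _
    (AddSubgroup.inclusion_injective hle))

open Topology in
theorem isLocallyConstant_of_eventually_fixed {G M : Type*} [Group G] [TopologicalSpace G]
    [IsTopologicalGroup G] [AddCommGroup M] (ρ : G →* AddMonoid.End M) {m : M}
    (hm : ∀ᶠ σ in 𝓝 (1 : G), ρ σ m = m) : IsLocallyConstant fun g => ρ g m := by
  rw [IsLocallyConstant.iff_eventually_eq]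
  intro g
  have htendsto : Filter.Tendsto (fun h => g⁻¹ * h) (𝓝 g) (𝓝 1) := by
    simpa only [inv_mul_cancel] using (continuous_const_mul g⁻¹).tendsto g
  filter_upwards [htendsto.eventually hm] with h hh
  calc ρ h m = ρ (g * (g⁻¹ * h)) m := by rw [mul_inv_cancel_left]
    _ = ρ g (ρ (g⁻¹ * h) m) := by rw [map_mul]; rfl
    _ = ρ g m := by rw [hh]

-- If `p • c` is the coboundary of `m = p • n`, then `c` minus the coboundary of `n` is a cocycle
-- killed by `p`, hence takes values in `M'`.
theorem ContH1.H1.exists_map_eq {G M M' : Type*} [Group G] [TopologicalSpace G] [AddCommGroup M]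
    [AddCommGroup M'] {p : ℕ} {ρ : G →* AddMonoid.End M} {ρ' : G →* AddMonoid.End M'}
    (hρ : ∀ m, IsLocallyConstant fun g => ρ g m) (hdiv : ∀ m : M, ∃ n, p • n = m) (u : M' →+ M)
    (hu : ∀ g m, u (ρ' (MonoidHom.id G g) m) = ρ g (u m)) (hinj : Function.Injective u)
    (hrange : ∀ m, p • m = 0 → ∃ m', u m' = m) {c : H1 ρ} (hc : p • c = 0) :
    ∃ c', H1.map (MonoidHom.id G) continuous_id u hu c' = c := by
  obtain ⟨c, rfl⟩ := H1.mk_surjective _ c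
  rw [← map_nsmul] at hc
  obtain ⟨m, hm⟩ := (H1.mk_eq_zero (p • c)).1 hc
  obtain ⟨n, rfl⟩ := hdiv m
  have hkilled (g : G) : p • (c.1 g - (ρ g n - n)) = 0 := by
    have hcobd : p • c.1 g = ρ g (p • n) - p • n := hm g
    rw [smul_sub, hcobd, map_nsmul, smul_sub, sub_self]
  choose b hb using fun g => hrange _ (hkilled g)
  have hb_locConst : IsLocallyConstant b := by
    refine IsLocallyConstant.desc b u ?_ hinj
    rw [show u ∘ b = fun g => c.1 g - (ρ g n - n) from funext hb]
    exact c.2.1.sub ((hρ n).sub (IsLocallyConstant.const n))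
  have hb_cocycle (g h : G) : b (g * h) = b g + ρ' g (b h) := by
    have hequiv : u (ρ' g (b h)) = ρ g (u (b h)) := hu g (b h)
    have hmul : ρ (g * h) n = ρ g (ρ h n) := by rw [map_mul]; rfl
    apply hinj
    rw [map_add, hequiv, hb, hb, hb, c.2.2 g h, map_sub, map_sub, hmul]
    abel
  refine ⟨H1.mk _ ⟨b, hb_locConst, hb_cocycle⟩, ?_⟩
  rw [H1.map_mk, ← sub_eq_zero, ← map_sub, H1.mk_eq_zero]
  refine ⟨-n, fun g => ?_⟩
  change u (b g) - c.1 g = ρ g (-n) - -n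
  rw [map_neg, hb]
  abel

namespace FineSelmer

open NumberField IsDedekindDomain ContH1

variable {F : Type*} [Field F] [NumberField F] (E : WeierstrassCurve F) (p : ℕ)
  (Finf : IntermediateField F (AlgebraicClosure F))

/-- The map `H¹(F_S/F_∞, E[p]) → H¹(F_S/F_∞, E[p ^ ∞])` induced by `E[p] ⊆ E[p ^ ∞]`, the global
counterpart of `hMap`. -/
def globalIncl : GlobalH1 E p 1 Finf →+ GlobalH1 E p ⊤ Finf :=
  H1.map (MonoidHom.id _) continuous_id (pTors.incl p 1 _) fun _ _ => rfl

theorem locMap_globalIncl (c : GlobalH1 E p 1 Finf) :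
    locMap E p ⊤ Finf (globalIncl E p Finf c) = hMap E p Finf (locMap E p 1 Finf c) := by
  obtain ⟨c, rfl⟩ := H1.mk_surjective _ c
  rfl

variable {Finf} in
theorem exists_globalIncl_eq [E.IsElliptic] (hp : p ≠ 0) {c : GlobalH1 E p ⊤ Finf}
    (hc : p • c = 0) : ∃ c', globalIncl E p Finf c' = c := by
  refine H1.exists_map_eq (fun m => ?_) (exists_nsmul_eq_pTors hp) (pTors.incl p 1 _)
    (fun _ _ => rfl) (AddSubgroup.inclusion_injective _) (fun m hm => ?_) hc
  · refine (isLocallyConstant_of_eventually_fixed (globalRep E p ⊤) (m := m) ?_).comp_continuous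
      continuous_subtype_val
    filter_upwards [Pts.rep_eventually E m.1] with σ hσ
    exact Subtype.ext hσ
  · have hm' : p ^ 1 • m.1 = 0 := by
      rw [pow_one]
      exact congrArg Subtype.val hm
    exact ⟨⟨m.1, 1, le_rfl, hm'⟩, rfl⟩

theorem finite_torsion_fineSelmer_and_card_le [E.IsElliptic] (hp : p ≠ 0)
    [Finite (hMap E p Finf).ker] [Finite (fineSelmer E p 1 Finf)] :
    Finite {c : fineSelmer E p ⊤ Finf // p • c = 0} ∧
      Nat.card {c : fineSelmer E p ⊤ Finf // p • c = 0} ≤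
        Nat.card (fineSelmer E p 1 Finf) * Nat.card (hMap E p Finf).ker := by
  have : Finite (locMap E p 1 Finf).ker := ‹Finite (fineSelmer E p 1 Finf)›
  obtain ⟨hfin, hcard⟩ := finite_and_card_ker_comp_le (hMap E p Finf) (locMap E p 1 Finf)
  have exists_lift (c : {c : fineSelmer E p ⊤ Finf // p • c = 0}) :
      ∃ u : ((hMap E p Finf).comp (locMap E p 1 Finf)).ker, globalIncl E p Finf u = c.1.1 := by
    obtain ⟨u, hu⟩ := exists_globalIncl_eq E p hp (c := c.1.1) (congrArg Subtype.val c.2)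
    refine ⟨⟨u, ?_⟩, hu⟩
    rw [AddMonoidHom.mem_ker, AddMonoidHom.comp_apply, ← locMap_globalIncl, hu]
    exact c.1.2
  choose s hs using exists_lift
  have hinj : Function.Injective s := fun c d h =>
    Subtype.ext (Subtype.ext (by rw [← hs c, ← hs d, h]))
  exact ⟨Finite.of_injective s hinj, (Nat.card_le_card_of_injective s hinj).trans hcard⟩

end FineSelmer

end ResidualSelmer

/-! ### Pontryagin duals over `ℤ_p` -/

section Duality

open IsLocalRing

instance isPrecomplete_pi_const {R ι : Type*} [CommRing R] [Finite ι] (I : Ideal R)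
    [IsPrecomplete I R] : IsPrecomplete I (ι → R) := by
  classical
  have := Fintype.ofFinite ι
  rw [← AdicCompletion.of_surjective_iff]
  intro y
  choose x hx using fun i => AdicCompletion.of_surjective I R
    (AdicCompletion.piEquivOfFintype I (fun _ : ι => R) y i)
  refine ⟨x, (AdicCompletion.piEquivOfFintype I (fun _ : ι => R)).injective (funext fun i => ?_)⟩
  rw [← hx i, AdicCompletion.piEquivOfFintype_apply]
  exact AdicCompletion.map_of I (LinearMap.proj (φ := fun _ : ι => R) i) x

theorem exists_span_range_eq_top_of_card_le (k : Type*) {V : Type*} [Field k] [Finite k]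
    [AddCommGroup V] [Module k V] [Finite V] {B : ℕ} (hB : Nat.card V ≤ Nat.card k ^ B) :
    ∃ v : Fin B → V, Submodule.span k (Set.range v) = ⊤ := by
  have hrank : Module.finrank k V ≤ B := by
    rw [Module.natCard_eq_pow_finrank (K := k) (V := V)] at hB
    exact (Nat.pow_le_pow_iff_right Finite.one_lt_card).1 hB
  let b := Module.finBasis k V
  refine ⟨fun i => if h : i.1 < Module.finrank k V then b ⟨i, h⟩ else 0, ?_⟩
  rw [eq_top_iff, ← b.span_eq, Submodule.span_le]
  rintro _ ⟨i, rfl⟩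
  exact Submodule.subset_span ⟨⟨i, i.2.trans_le hrank⟩, by simp⟩

theorem exists_closure_range_eq_top_of_card_le (p : ℕ) [Fact p.Prime] {V : Type*}
    [AddCommGroup V] [Module (ZMod p) V] [Finite V] {B : ℕ} (hB : Nat.card V ≤ p ^ B) :
    ∃ v : Fin B → V, AddSubgroup.closure (Set.range v) = ⊤ := by
  obtain ⟨v, hv⟩ := exists_span_range_eq_top_of_card_le (ZMod p) (V := V) (B := B)
    (by rwa [Nat.card_zmod])
  refine ⟨v, (AddSubgroup.toZModSubmodule p (M := V)).injective ?_⟩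
  rw [map_top, eq_top_iff, ← hv, Submodule.span_le]
  exact AddSubgroup.subset_closure

theorem exists_surjective_of_card_quotient_le (R : Type*) {M : Type*} [CommRing R] [IsLocalRing R]
    [IsPrecomplete (maximalIdeal R) R] [Finite (ResidueField R)] [AddCommGroup M] [Module R M]
    [IsHausdorff (maximalIdeal R) M] [Finite (M ⧸ (maximalIdeal R • ⊤ : Submodule R M))] {B : ℕ}
    (hB : Nat.card (M ⧸ (maximalIdeal R • ⊤ : Submodule R M)) ≤ Nat.card (ResidueField R) ^ B) :
    ∃ f : (Fin B → R) →ₗ[R] M, Function.Surjective f := by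
  let _ : Module (ResidueField R) (M ⧸ (maximalIdeal R • ⊤ : Submodule R M)) :=
    inferInstanceAs (Module (R ⧸ maximalIdeal R) _)
  have : IsScalarTower R (ResidueField R) (M ⧸ (maximalIdeal R • ⊤ : Submodule R M)) :=
    inferInstanceAs (IsScalarTower R (R ⧸ maximalIdeal R) _)
  obtain ⟨v, hv⟩ := exists_span_range_eq_top_of_card_le (ResidueField R) hB
  choose u hu using fun i => Submodule.mkQ_surjective _ (v i)
  refine ⟨Fintype.linearCombination R u,
    surjective_of_mkQ_comp_surjective (I := maximalIdeal R) ?_⟩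
  rw [← LinearMap.range_eq_top, LinearMap.range_comp, Fintype.range_linearCombination,
    Submodule.map_span, ← Set.range_comp, show Submodule.mkQ _ ∘ u = v from funext hu,
    ← Submodule.restrictScalars_span R (ResidueField R) residue_surjective, hv,
    Submodule.restrictScalars_top]

namespace PontDual

variable (p : ℕ) [Fact p.Prime]

instance divisibleBy : DivisibleBy (ℚ_[p] ⧸ (PadicInt.subring p).toAddSubgroup) ℤ :=
  have : DivisibleBy (ℚ_[p] ⧸ (PadicInt.subring p).toAddSubgroup) ℕ :=
    have : DivisibleBy ℚ_[p] ℕ := AddGroup.divisibleByNatOfDivisibleByInt _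
    QuotientAddGroup.divisibleBy _
  AddGroup.divisibleByIntOfDivisibleByNat _

variable {p} in
/-- The homomorphism `A → ℚ_p / ℤ_p` underlying an element of the Pontryagin dual; `PontDual`
itself carries no coercion to functions. -/
def toHom {A : Type*} [AddCommGroup A] (g : PontDual p A) :
    A →+ ℚ_[p] ⧸ (PadicInt.subring p).toAddSubgroup := g

theorem exists_smul_eq_of_forall_apply_eq_zero {A : Type*} [AddCommGroup A] [Module ℤ_[p] A]
    (g : PontDual p A) (hg : ∀ a : A, p • a = 0 → toHom g a = 0) :
    ∃ g' : PontDual p A, (p : ℤ_[p]) • g' = g := by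
  let mulP : A →+ A := nsmulAddMonoidHom p
  obtain ⟨h, hh⟩ := (Module.Baer.of_divisible _).extension_property_addMonoidHom
    (QuotientAddGroup.kerLift mulP) (QuotientAddGroup.kerLift_injective mulP)
    (QuotientAddGroup.lift mulP.ker (toHom g) hg)
  refine ⟨h, AddMonoidHom.ext fun a => ?_⟩
  change h ((p : ℤ_[p]) • a) = toHom g a
  rw [Nat.cast_smul_eq_nsmul]
  exact DFunLike.congr_fun hh (QuotientAddGroup.mk a)

theorem exists_eq_mk_of_nsmul_eq_zero {x : ℚ_[p] ⧸ (PadicInt.subring p).toAddSubgroup}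
    (hx : p • x = 0) : ∃ a : ZMod p, x = QuotientAddGroup.mk ((a.val : ℚ_[p]) / p) := by
  obtain ⟨x, rfl⟩ := QuotientAddGroup.mk_surjective x
  have hp : (p : ℚ_[p]) ≠ 0 := by exact_mod_cast (Fact.out : p.Prime).ne_zero
  have hint : p • x ∈ (PadicInt.subring p).toAddSubgroup := by
    rw [← QuotientAddGroup.eq_zero_iff]
    exact hx
  let z : ℤ_[p] := ⟨p • x, hint⟩
  obtain ⟨w, hw⟩ : (p : ℤ_[p]) ∣ z - (PadicInt.toZMod z).val := by
    rw [← Ideal.mem_span_singleton, ← PadicInt.maximalIdeal_eq_span_p, ← ZMod.cast_eq_val]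
    exact PadicInt.toZMod_spec z
  have hw' : p * x - ((PadicInt.toZMod z).val : ℚ_[p]) = p * w := by
    have hcast := congrArg (fun t : ℤ_[p] => (t : ℚ_[p])) hw
    push_cast at hcast
    rwa [show (z : ℚ_[p]) = p * x from nsmul_eq_mul ..] at hcast
  have hsub : -x + ((PadicInt.toZMod z).val : ℚ_[p]) / p = ((-w : ℤ_[p]) : ℚ_[p]) := by
    push_cast
    field_simp
    linear_combination -hw'
  refine ⟨PadicInt.toZMod z, QuotientAddGroup.eq.2 ?_⟩
  rw [hsub]
  exact (-w).2

variable {A : Type*} [AddCommGroup A] [Module ℤ_[p] A]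

theorem isHausdorff (hA : ∀ a : A, ∃ k : ℕ, p ^ k • a = 0) :
    IsHausdorff (maximalIdeal ℤ_[p]) (PontDual p A) := by
  refine ⟨fun x hx => AddMonoidHom.ext fun a => ?_⟩
  obtain ⟨k, hk⟩ := hA a
  obtain ⟨y, -, rfl⟩ : ∃ y ∈ (⊤ : Submodule ℤ_[p] (PontDual p A)), (p : ℤ_[p]) ^ k • y = x := by
    rw [← Submodule.mem_smul_pointwise_iff_exists, ← Submodule.ideal_span_singleton_smul,
      ← Ideal.span_singleton_pow, ← PadicInt.maximalIdeal_eq_span_p, ← SModEq.zero]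
    exact hx k
  change toHom y ((p : ℤ_[p]) ^ k • a) = 0
  rw [← Nat.cast_pow, Nat.cast_smul_eq_nsmul, hk, map_zero]

theorem finite_quotient_and_card_le {B : ℕ} [Finite {a : A // p • a = 0}]
    (hB : Nat.card {a : A // p • a = 0} ≤ p ^ B) :
    Finite (PontDual p A ⧸ (maximalIdeal ℤ_[p] • ⊤ : Submodule ℤ_[p] (PontDual p A))) ∧
      Nat.card (PontDual p A ⧸ (maximalIdeal ℤ_[p] • ⊤ : Submodule ℤ_[p] (PontDual p A))) ≤
        p ^ B := by
  let T : AddSubgroup A := (nsmulAddMonoidHom p : A →+ A).ker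
  have : Finite T := ‹Finite {a : A // p • a = 0}›
  let _ : Module (ZMod p) T := AddCommGroup.zmodModule fun a => Subtype.ext a.2
  obtain ⟨b, hb⟩ := exists_closure_range_eq_top_of_card_le p (V := T) hB
  have exists_val (g : PontDual p A) (i : Fin B) :
      ∃ c : ZMod p, toHom g (b i : A) = QuotientAddGroup.mk ((c.val : ℚ_[p]) / p) := by
    refine exists_eq_mk_of_nsmul_eq_zero p ?_
    rw [← map_nsmul]
    exact (congrArg _ (b i).2).trans (map_zero _)
  choose c hc using exists_val
  have hc_inj (g g' : PontDual p A) (h : c g = c g') :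
      g - g' ∈ (maximalIdeal ℤ_[p] • ⊤ : Submodule ℤ_[p] (PontDual p A)) := by
    have hgens : AddSubgroup.closure (Set.range b) ≤ (toHom (g - g')).ker.comap T.subtype := by
      rw [AddSubgroup.closure_le]
      rintro _ ⟨i, rfl⟩
      change toHom g (b i : A) - toHom g' (b i : A) = 0
      rw [hc, hc, h, sub_self]
    obtain ⟨g₀, hg₀⟩ := exists_smul_eq_of_forall_apply_eq_zero p (g - g') fun a ha =>
      hgens (hb ▸ AddSubgroup.mem_top (⟨a, ha⟩ : T))
    rw [← hg₀, PadicInt.maximalIdeal_eq_span_p]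
    exact Submodule.smul_mem_smul (Ideal.mem_span_singleton_self _) Submodule.mem_top
  have hinj : Function.Injective fun q : PontDual p A ⧸ (maximalIdeal ℤ_[p] • ⊤ :
      Submodule ℤ_[p] (PontDual p A)) => c q.out := fun q q' h => by
    rw [← q.out_eq, ← q'.out_eq]
    exact (Submodule.Quotient.eq _).2 (hc_inj _ _ h)
  exact ⟨Finite.of_injective _ hinj, by simpa using Nat.card_le_card_of_injective _ hinj⟩

theorem exists_surjective_of_card_le (hA : ∀ a : A, ∃ k : ℕ, p ^ k • a = 0) {B : ℕ}
    [Finite {a : A // p • a = 0}] (hB : Nat.card {a : A // p • a = 0} ≤ p ^ B) :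
    ∃ f : (Fin B → ℤ_[p]) →ₗ[ℤ_[p]] PontDual p A, Function.Surjective f := by
  obtain ⟨hfin, hcard⟩ := finite_quotient_and_card_le p hB
  have := isHausdorff p hA
  have hresidue : Nat.card (ResidueField ℤ_[p]) = p := by
    rw [Nat.card_congr PadicInt.residueField.toEquiv, Nat.card_zmod]
  have : Finite (ResidueField ℤ_[p]) := .of_equiv _ PadicInt.residueField.symm.toEquiv
  exact exists_surjective_of_card_quotient_le ℤ_[p] (hcard.trans_eq (by rw [hresidue]))

end PontDual

end Duality

/-! ### Power series modules finite over the coefficients -/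

section WeierstrassPreparation

open Polynomial IsLocalRing
open scoped PowerSeries

variable {A : Type*} [CommRing A]

theorem isDistinguishedAt_pow {I : Ideal A} {f : A[X]} (hf : f.IsDistinguishedAt I) (n : ℕ) :
    (f ^ n).IsDistinguishedAt I := by
  induction n with
  | zero => exact ⟨⟨fun hn => by simp at hn⟩, by simp⟩
  | succ n ih => rw [pow_succ]; exact ih.mul hf

theorem not_C_dvd_coe_of_monic {a : A} (ha : ¬ IsUnit a) {f : A[X]} (hf : f.Monic) :
    ¬ PowerSeries.C a ∣ (f : A⟦X⟧) := by
  rintro ⟨q, hq⟩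
  have hcoeff := congrArg (PowerSeries.coeff f.natDegree) hq
  rw [PowerSeries.coeff_C_mul, Polynomial.coeff_coe, hf.coeff_natDegree] at hcoeff
  exact ha (IsUnit.of_mul_eq_one _ hcoeff.symm)

theorem isDistinguishedAt_of_dvd [IsLocalRing A] {g h : A[X]} (hg : g.Monic)
    (hh : h.IsDistinguishedAt (maximalIdeal A)) (hgh : g ∣ h) :
    g.IsDistinguishedAt (maximalIdeal A) := by
  have hdvd := Polynomial.map_dvd (residue A) hgh
  rw [show h.map (residue A) = X ^ h.natDegree from hh.map_eq_X_pow,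
    dvd_prime_pow Polynomial.prime_X] at hdvd
  obtain ⟨k, -, hk⟩ := hdvd
  have hmap : g.map (residue A) = X ^ k :=
    Polynomial.eq_of_monic_of_associated (hg.map _) (monic_X_pow k) hk
  have hdeg : k = g.natDegree := by
    rw [← hg.natDegree_map (residue A), hmap, natDegree_X_pow]
  refine ⟨⟨fun {n} hn => (residue_eq_zero_iff _).1 ?_⟩, hg⟩
  rw [← Polynomial.coeff_map, hmap, Polynomial.coeff_X_pow, if_neg (hdeg ▸ hn.ne)]

section Quotient

variable {I : Ideal A} [IsAdicComplete I A] {f : A[X]} (hf : f.IsDistinguishedAt I) (n : ℕ)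

/-- Weierstrass division as an isomorphism `A[X] / (f ^ n) ≃ A⟦X⟧ / (f ^ n)` of `A[X]`-modules, for
a distinguished polynomial `f`. -/
def distinguishedQuotientPowEquiv : (A[X] ⧸ Ideal.span {f ^ n}) ≃ₗ[A[X]]
    (A⟦X⟧ ⧸ Ideal.span {(f : A⟦X⟧) ^ n}) where
  toAddEquiv := ((isDistinguishedAt_pow hf n).algEquivQuotient.trans
    (Ideal.quotientEquivAlgOfEq A (by rw [Polynomial.coe_pow]))).toAddEquiv
  map_smul' q x := by
    obtain ⟨x, rfl⟩ := Ideal.Quotient.mk_surjective x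
    have hsource : q • Ideal.Quotient.mk (Ideal.span {f ^ n}) x =
        Ideal.Quotient.mk (Ideal.span {f ^ n}) (q * x) := rfl
    have htarget (y : A⟦X⟧) : q • Ideal.Quotient.mk (Ideal.span {(f : A⟦X⟧) ^ n}) y =
        Ideal.Quotient.mk (Ideal.span {(f : A⟦X⟧) ^ n}) ((q : A⟦X⟧) * y) :=
      congrArg (Ideal.Quotient.mk _) (by simp [Algebra.smul_def, PowerSeries.algebraMap_apply'])
    rw [hsource]
    simp [htarget]

include hf

theorem finite_powerSeries_quotient_pow :
    Module.Finite A (A⟦X⟧ ⧸ Ideal.span {(f : A⟦X⟧) ^ n}) := by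
  have : Module.Finite A (A[X] ⧸ Ideal.span {f ^ n}) := (hf.monic.pow n).finite_quotient
  exact Module.Finite.equiv ((distinguishedQuotientPowEquiv hf n).restrictScalars A)

theorem free_powerSeries_quotient_pow :
    Module.Free A (A⟦X⟧ ⧸ Ideal.span {(f : A⟦X⟧) ^ n}) := by
  have : Module.Free A (A[X] ⧸ Ideal.span {f ^ n}) := (hf.monic.pow n).free_quotient
  exact Module.Free.of_equiv ((distinguishedQuotientPowEquiv hf n).restrictScalars A)

theorem finrank_powerSeries_quotient_pow [Nontrivial A] :
    Module.finrank A (A⟦X⟧ ⧸ Ideal.span {(f : A⟦X⟧) ^ n}) = n * f.natDegree := by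
  rw [← ((distinguishedQuotientPowEquiv hf n).restrictScalars A).finrank_eq,
    finrank_quotient_span_eq_natDegree' (hf.monic.pow n), hf.monic.natDegree_pow]

end Quotient

variable [IsLocalRing A] [IsAdicComplete (maximalIdeal A) A]
  (M : Type*) [AddCommGroup M] [Module A⟦X⟧ M] [Module A M] [IsScalarTower A A⟦X⟧ M]
  [Module.Finite A M]

theorem exists_isDistinguishedAt_smul_eq_zero :
    ∃ h : A[X], h.IsDistinguishedAt (maximalIdeal A) ∧ ∀ m : M, (h : A⟦X⟧) • m = 0 := by
  obtain ⟨q, hq, hq0⟩ := LinearMap.exists_monic_and_aeval_eq_zero A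
    (Algebra.lsmul A A M (PowerSeries.X : A⟦X⟧))
  have hqM (m : M) : (q : A⟦X⟧) • m = 0 := by
    have hcoe : (q : A⟦X⟧) = aeval PowerSeries.X q := by
      have hhom : coeToPowerSeries.algHom A = aeval (R := A) (PowerSeries.X : A⟦X⟧) :=
        Polynomial.algHom_ext (by simp)
      simp [← hhom]
    rw [Polynomial.aeval_algHom_apply, ← hcoe] at hq0
    exact LinearMap.congr_fun hq0 m
  have hmap : (q : A⟦X⟧).map (residue A) ≠ 0 := fun h0 => by
    simpa [hq.coeff_natDegree] using congrArg (PowerSeries.coeff q.natDegree) h0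
  obtain ⟨f, u, hf⟩ := PowerSeries.exists_isWeierstrassFactorization hmap
  refine ⟨f, hf.isDistinguishedAt, fun m => hf.isUnit.smul_eq_zero.1 ?_⟩
  rw [← mul_smul, mul_comm, ← hf.eq_mul, hqM]

theorem isTorsion_powerSeries_of_finite [IsDomain A] : Module.IsTorsion A⟦X⟧ M := by
  obtain ⟨h, hh, hM⟩ := exists_isDistinguishedAt_smul_eq_zero (A := A) M
  intro m
  refine ⟨⟨h, mem_nonZeroDivisors_of_ne_zero ?_⟩, hM m⟩
  exact mt Polynomial.coe_eq_zero_iff.1 hh.monic.ne_zero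

variable {M} {N : Type*} [AddCommGroup N] [Module A⟦X⟧ N] [Module A N] [IsScalarTower A A⟦X⟧ N]
  [Module.Finite A N] [Module A[X] M] [IsScalarTower A[X] A⟦X⟧ M] [Module A[X] N]
  [IsScalarTower A[X] A⟦X⟧ N]

/-- Modulo a distinguished annihilator, every power series is a polynomial. -/
theorem map_powerSeries_smul (φ : M →ₗ[A[X]] N) (g : A⟦X⟧) (m : M) : φ (g • m) = g • φ m := by
  obtain ⟨h, hh, hMN⟩ := exists_isDistinguishedAt_smul_eq_zero (A := A) (M × N)
  have hM (m : M) : (h : A⟦X⟧) • m = 0 := congrArg Prod.fst (hMN (m, 0))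
  have hN (n : N) : (h : A⟦X⟧) • n = 0 := congrArg Prod.snd (hMN (0, n))
  obtain ⟨q, r, hg⟩ : ∃ (q : A⟦X⟧) (r : A[X]), g = h * q + r :=
    ⟨_, _, (hh.isWeierstrassDivisorAt'.isWeierstrassDivisionAt_div_mod g).2⟩
  have hr : (r : A⟦X⟧) = algebraMap A[X] A⟦X⟧ r := by simp [PowerSeries.algebraMap_apply']
  simp only [hg, add_smul, mul_smul, hM, hN, zero_add, hr, algebraMap_smul, map_smul]

end WeierstrassPreparation

/-! ### The structure theorem -/

section StructureTheorem

open Polynomial TensorProduct IsLocalRing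

theorem exists_isLocalizedModule_quotient_span {R K : Type*} [CommRing R] [CommRing K] [Algebra R K]
    (S : Submonoid R) [IsLocalization S K] (a : R) :
    ∃ f : (R ⧸ Ideal.span {a}) →ₗ[R] (K ⧸ Ideal.span {algebraMap R K a}),
      IsLocalizedModule S f := by
  have h : (Ideal.span {a} : Submodule R R).localized' K S (Algebra.linearMap R K) =
      Ideal.span {algebraMap R K a} := by
    rw [Ideal.span, Submodule.localized'_span, Set.image_singleton, Algebra.linearMap_apply]
  rw [← h]
  exact ⟨_, IsLocalizedModule.toLocalizedQuotient' K S (Algebra.linearMap R K) _⟩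

theorem exists_linearMap_pi_quotient {R K M : Type*} [CommRing R] [CommRing K] [Algebra R K]
    (S : Submonoid R) [IsLocalization S K] [AddCommGroup M] [Module R M]
    [Module.FinitePresentation R M] {ι : Type*} [Finite ι] (a : ι → R)
    (e : (K ⊗[R] M) ≃ₗ[K] ((i : ι) → K ⧸ Ideal.span {algebraMap R K (a i)})) :
    ∃ φ : M →ₗ[R] ((i : ι) → R ⧸ Ideal.span {a i}),
      (∀ m, φ m = 0 → ∃ s ∈ S, s • m = 0) ∧ ∀ n, ∃ s ∈ S, s • n ∈ LinearMap.range φ := by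
  choose f hf using fun i => exists_isLocalizedModule_quotient_span (K := K) S (a i)
  let F : ((i : ι) → R ⧸ Ideal.span {a i}) →ₗ[R]
      ((i : ι) → K ⧸ Ideal.span {algebraMap R K (a i)}) := .pi fun i ↦ f i ∘ₗ .proj i
  have hF : IsLocalizedModule S F := IsLocalizedModule.pi S f
  let g : M →ₗ[R] ((i : ι) → K ⧸ Ideal.span {algebraMap R K (a i)}) :=
    (e.restrictScalars R).toLinearMap ∘ₗ TensorProduct.mk R K M 1
  have hmk : IsLocalizedModule S (TensorProduct.mk R K M 1) :=
    (isLocalizedModule_iff_isBaseChange S K _).2 (TensorProduct.isBaseChange R M K)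
  have hg : IsLocalizedModule S g := IsLocalizedModule.of_linearEquiv S _ (e.restrictScalars R)
  obtain ⟨φ, s, hφ⟩ := Module.FinitePresentation.exists_lift_of_isLocalizedModule S F g
  have hFφ (m : M) : F (φ m) = (s : R) • g m := LinearMap.congr_fun hφ m
  refine ⟨φ, fun m hm => ?_, fun n => ?_⟩
  · have hgm : g m = 0 := by
      have hs : s • g m = s • (0 : (i : ι) → K ⧸ Ideal.span {algebraMap R K (a i)}) := by
        rw [Submonoid.smul_def, ← hFφ, hm, map_zero, smul_zero]
      exact IsLocalizedModule.smul_injective g s hs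
    obtain ⟨s', hs'⟩ := (IsLocalizedModule.eq_zero_iff S g).1 hgm
    exact ⟨s', s'.2, hs'⟩
  · obtain ⟨⟨m, s₁⟩, hm⟩ := IsLocalizedModule.surj S g (F n)
    have hFn : F (φ m) = F ((s * s₁ : R) • n) := by
      rw [hFφ, ← hm, map_smul, mul_smul, Submonoid.smul_def]
    obtain ⟨s₂, hs₂⟩ := IsLocalizedModule.exists_of_eq (S := S) (f := F) hFn
    refine ⟨s₂ * (s * s₁), mul_mem s₂.2 (mul_mem s.2 s₁.2), (s₂ : R) • m, ?_⟩
    rw [map_smul, mul_smul]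
    exact hs₂

theorem bijective_pi_proj_of_subsingleton (R : Type*) {ι : Type*} [Semiring R] (s : Set ι)
    {N : ι → Type*} [∀ i, AddCommMonoid (N i)] [∀ i, Module R (N i)]
    (hN : ∀ i ∉ s, Subsingleton (N i)) :
    Function.Bijective
      (LinearMap.pi fun j => LinearMap.proj (j : ι) : ((i : ι) → N i) →ₗ[R] (j : s) → N j) := by
  classical
  refine ⟨fun x y h => funext fun i => ?_, fun y => ?_⟩
  · by_cases hi : i ∈ s
    · exact congrFun h ⟨i, hi⟩
    · exact (hN i hi).elim _ _
  · exact ⟨fun i => if hi : i ∈ s then y ⟨i, hi⟩ else 0, funext fun j => dif_pos j.2⟩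

theorem exists_equiv_pi_quotient_of_isTorsion {R M : Type*} [CommRing R] [IsDomain R]
    [IsPrincipalIdealRing R] [AddCommGroup M] [Module R M] [Module.Finite R M]
    (hM : Module.IsTorsion R M) :
    ∃ (t : ℕ) (P : Fin t → R) (e : Fin t → ℕ), (∀ j, Irreducible (P j)) ∧ (∀ j, 0 < e j) ∧
      Nonempty (M ≃ₗ[R] ((j : Fin t) → R ⧸ Ideal.span {P j ^ e j})) := by
  classical
  obtain ⟨ι, _, P, hP, e, ⟨E⟩⟩ := Module.equiv_directSum_of_isTorsion hM
  have hb := bijective_pi_proj_of_subsingleton R {i | 0 < e i}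
    (N := fun i => R ⧸ Ideal.span {P i ^ e i}) fun i hi => by
      rw [Nat.eq_zero_of_not_pos hi, pow_zero]
      exact Ideal.Quotient.subsingleton_iff.2 Ideal.span_singleton_one
  let σ := Fintype.equivFin {i | 0 < e i}
  refine ⟨_, fun j => P (σ.symm j), fun j => e (σ.symm j), fun _ => hP _, fun j => (σ.symm j).2,
    ⟨?_⟩⟩
  exact ((E.trans (DirectSum.linearEquivFunOnFintype R ι _)).trans
    (LinearEquiv.ofBijective _ hb)).trans (LinearEquiv.piCongrLeft' R _ σ)

theorem dvd_of_smul_eq_zero_of_equiv_pi_quotient {R M ι : Type*} [CommRing R] [AddCommGroup M]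
    [Module R M] {a : ι → R} (E : M ≃ₗ[R] ((i : ι) → R ⧸ Ideal.span {a i})) {r : R}
    (hr : ∀ m : M, r • m = 0) (i : ι) : a i ∣ r := by
  have h := congrFun (congrArg E (hr (E.symm fun _ => Submodule.Quotient.mk 1))) i
  rw [map_smul, E.apply_symm_apply, map_zero, Pi.smul_apply, ← Submodule.Quotient.mk_smul] at h
  simpa [Ideal.mem_span_singleton] using (Submodule.Quotient.mk_eq_zero _).1 h

variable {A K : Type*} [CommRing A] [IsIntegrallyClosed A] [IsLocalRing A] [Field K] [Algebra A K]
  [IsFractionRing A K]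

theorem exists_isDistinguishedAt_associated {P : K[X]} (hP : Irreducible P) {h : A[X]}
    (hh : h.IsDistinguishedAt (maximalIdeal A)) (hPh : P ∣ h.map (algebraMap A K)) :
    ∃ g : A[X], g.IsDistinguishedAt (maximalIdeal A) ∧ Irreducible g ∧
      Associated P (g.map (algebraMap A K)) := by
  obtain ⟨g, hg⟩ := IsIntegrallyClosed.eq_map_mul_C_of_dvd K hh.monic hPh
  have hlc : P.leadingCoeff ≠ 0 := leadingCoeff_ne_zero.2 hP.ne_zero
  have hass : Associated P (g.map (algebraMap A K)) :=
    Associated.symm ⟨(isUnit_C.2 hlc.isUnit).unit, hg⟩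
  have hmonic : g.Monic := by
    have hmul := congrArg leadingCoeff hg
    rw [leadingCoeff_mul, leadingCoeff_C, mul_eq_right₀ hlc] at hmul
    exact Polynomial.monic_of_injective (IsFractionRing.injective A K) hmul
  have hdvd : g ∣ h :=
    (Polynomial.map_dvd_map _ (IsFractionRing.injective A K) hmonic).1 (hass.symm.dvd.trans hPh)
  exact ⟨g, isDistinguishedAt_of_dvd hmonic hh hdvd,
    (hmonic.irreducible_iff_irreducible_map_fraction_map (K := K)).2 (hass.irreducible hP), hass⟩

attribute [local instance] Polynomial.algebra

variable (K) in
theorem exists_equiv_pi_quotient_isDistinguishedAt (M : Type*) [AddCommGroup M] [Module A[X] M]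
    [Module.Finite A[X] M] {h : A[X]} (hh : h.IsDistinguishedAt (maximalIdeal A))
    (hM : ∀ m : M, h • m = 0) :
    ∃ (t : ℕ) (g : Fin t → A[X]) (e : Fin t → ℕ),
      (∀ j, (g j).IsDistinguishedAt (maximalIdeal A)) ∧ (∀ j, Irreducible (g j)) ∧
      (∀ j, 0 < e j) ∧
      Nonempty ((K[X] ⊗[A[X]] M) ≃ₗ[K[X]]
        ((j : Fin t) → K[X] ⧸ Ideal.span {algebraMap A[X] K[X] (g j ^ e j)})) := by
  have hV (x : K[X] ⊗[A[X]] M) : algebraMap A[X] K[X] h • x = 0 := by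
    induction x using TensorProduct.induction_on with
    | zero => rw [smul_zero]
    | tmul c m => rw [algebraMap_smul, ← TensorProduct.tmul_smul, hM, TensorProduct.tmul_zero]
    | add x y hx hy => rw [smul_add, hx, hy, add_zero]
  have htors : Module.IsTorsion K[X] (K[X] ⊗[A[X]] M) := fun {x} =>
    ⟨⟨_, mem_nonZeroDivisors_of_ne_zero (hh.monic.map _).ne_zero⟩, hV x⟩
  obtain ⟨t, P, e, hP, he, ⟨E⟩⟩ := exists_equiv_pi_quotient_of_isTorsion htors
  have hdvd (j : Fin t) : P j ∣ h.map (algebraMap A K) :=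
    (dvd_pow_self _ (he j).ne').trans (dvd_of_smul_eq_zero_of_equiv_pi_quotient E hV j)
  choose g hg hgi hga using fun j => exists_isDistinguishedAt_associated (hP j) hh (hdvd j)
  refine ⟨t, g, e, hg, hgi, he, ⟨E.trans (LinearEquiv.piCongrRight fun j =>
    Submodule.quotEquivOfEq _ _ ?_)⟩⟩
  rw [map_pow]
  exact Ideal.span_singleton_eq_span_singleton.2 ((hga j).pow_pow)

end StructureTheorem

/-! ### Iwasawa invariants -/

section IwasawaInvariants

open Polynomial TensorProduct IsLocalRing
open scoped PowerSeries nonZeroDivisors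

section Torsion

variable {A M : Type*} [CommRing A] [IsDomain A] [IsNoetherianRing A] [IsIntegrallyClosed A]
  [IsLocalRing A] [AddCommGroup M] [Module A M] [Module.Finite A M]

theorem exists_linearMap_pi_polynomial_quotient [Module A[X] M] [IsScalarTower A A[X] M] {h : A[X]}
    (hh : h.IsDistinguishedAt (maximalIdeal A)) (hM : ∀ m : M, h • m = 0) :
    ∃ (t : ℕ) (g : Fin t → A[X]) (e : Fin t → ℕ),
      (∀ j, (g j).IsDistinguishedAt (maximalIdeal A)) ∧ (∀ j, Irreducible (g j)) ∧
      (∀ j, 0 < e j) ∧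
      ∃ φ : M →ₗ[A[X]] ((j : Fin t) → A[X] ⧸ Ideal.span {g j ^ e j}),
        (∀ m, φ m = 0 → ∃ a ∈ A⁰, a • m = 0) ∧
        ∀ n, ∃ a ∈ A⁰, ∃ m, φ m = a • n := by
  have : Module.Finite A[X] M := Module.Finite.of_restrictScalars_finite A _ _
  have : Module.FinitePresentation A[X] M := Module.finitePresentation_of_finite _ _
  obtain ⟨t, g, e, hg, hgi, he, ⟨E⟩⟩ :=
    exists_equiv_pi_quotient_isDistinguishedAt (FractionRing A) M hh hM
  let _ := Polynomial.algebra A (FractionRing A)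
  have := Polynomial.isLocalization A⁰ (FractionRing A)
  obtain ⟨φ, hker, hcoker⟩ := exists_linearMap_pi_quotient (A⁰.map C) (fun j => g j ^ e j) E
  refine ⟨t, g, e, hg, hgi, he, φ, fun m hm => ?_, fun n => ?_⟩
  · obtain ⟨_, ⟨a, ha, rfl⟩, ham⟩ := hker m hm
    exact ⟨a, ha, by rw [← ham, ← algebraMap_smul A[X] a m, Polynomial.algebraMap_eq]⟩
  · obtain ⟨_, ⟨a, ha, rfl⟩, m, hm⟩ := hcoker n
    exact ⟨a, ha, m, by rw [hm, ← algebraMap_smul A[X] a n, Polynomial.algebraMap_eq]⟩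

theorem exists_linearMap_pi_powerSeries_quotient [IsAdicComplete (maximalIdeal A) A]
    [Module A⟦X⟧ M] [IsScalarTower A A⟦X⟧ M] :
    ∃ (t : ℕ) (g : Fin t → A[X]) (e : Fin t → ℕ),
      (∀ j, (g j).IsDistinguishedAt (maximalIdeal A)) ∧ (∀ j, Irreducible (g j)) ∧
      (∀ j, 0 < e j) ∧
      ∃ ψ : M →ₗ[A⟦X⟧] ((j : Fin t) → A⟦X⟧ ⧸ Ideal.span {(g j : A⟦X⟧) ^ e j}),
        (∀ m, ψ m = 0 → ∃ a ∈ A⁰, a • m = 0) ∧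
        ∀ n, ∃ a ∈ A⁰, ∃ m, ψ m = a • n := by
  let _ : Module A[X] M := Module.compHom M (algebraMap A[X] A⟦X⟧)
  have : IsScalarTower A[X] A⟦X⟧ M := IsScalarTower.of_algebraMap_smul fun _ _ => rfl
  have : IsScalarTower A A[X] M := IsScalarTower.of_algebraMap_smul fun a m => by
    rw [← algebraMap_smul A⟦X⟧ (algebraMap A A[X] a) m, ← algebraMap_smul A⟦X⟧ a m]
    congr 1
    simp [PowerSeries.algebraMap_apply']
  obtain ⟨h, hh, hM⟩ := exists_isDistinguishedAt_smul_eq_zero (A := A) M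
  have hM' (m : M) : h • m = 0 := by
    rw [← algebraMap_smul A⟦X⟧ h m, PowerSeries.algebraMap_apply', Algebra.algebraMap_self,
      PowerSeries.map_id]
    exact hM m
  obtain ⟨t, g, e, hg, hgi, he, φ, hker, hcoker⟩ := exists_linearMap_pi_polynomial_quotient hh hM'
  have hfin (j : Fin t) := finite_powerSeries_quotient_pow (hg j) (e j)
  let E := LinearEquiv.piCongrRight fun j => distinguishedQuotientPowEquiv (hg j) (e j)
  let ψ : M →ₗ[A⟦X⟧] ((j : Fin t) → A⟦X⟧ ⧸ Ideal.span {(g j : A⟦X⟧) ^ e j}) :=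
    { E.toLinearMap ∘ₗ φ with map_smul' := map_powerSeries_smul (E.toLinearMap ∘ₗ φ) }
  refine ⟨t, g, e, hg, hgi, he, ψ, fun m hm => hker m (E.map_eq_zero_iff.1 hm), fun n => ?_⟩
  obtain ⟨a, ha, m, hm⟩ := hcoker (E.symm n)
  refine ⟨a, ha, m, ?_⟩
  change E (φ m) = a • n
  rw [hm]
  exact ((E.restrictScalars A).map_smul a (E.symm n)).trans
    (congrArg (a • ·) (E.apply_symm_apply n))

end Torsion

theorem finite_of_isTorsion {R Q : Type*} [CommRing R] [Nontrivial R] [Ring.HasFiniteQuotients R]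
    [AddCommGroup Q] [Module R Q] [Module.Finite R Q] (hQ : Module.IsTorsion R Q) : Finite Q := by
  obtain ⟨a, haQ, ha⟩ := Submodule.annihilator_top_inter_nonZeroDivisors hQ
  let I : Ideal R := (⊤ : Submodule R Q).annihilator
  have hI : I ≠ ⊥ := fun h => nonZeroDivisors.ne_zero ha ((Submodule.eq_bot_iff _).1 h a haQ)
  have : Finite (R ⧸ I) := Ring.HasFiniteQuotients.finiteQuotient hI
  have htors : Module.IsTorsionBySet R Q I := Module.isTorsionBySet_annihilator_top R Q
  let _ : Module (R ⧸ I) Q := htors.module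
  have : IsScalarTower R (R ⧸ I) Q := htors.isScalarTower
  have : Module.Finite (R ⧸ I) Q := Module.Finite.of_restrictScalars_finite R _ _
  exact Module.finite_of_finite (R ⧸ I)

instance hasFiniteQuotients_padicInt (p : ℕ) [Fact p.Prime] : Ring.HasFiniteQuotients ℤ_[p] where
  finiteQuotient {I} hI := by
    obtain ⟨n, rfl⟩ := PadicInt.ideal_eq_span_pow_p hI
    have : NeZero (p ^ n) := ⟨pow_ne_zero _ (Fact.out : p.Prime).ne_zero⟩
    rw [← PadicInt.ker_toZModPow]
    exact Finite.of_injective _ (RingHom.kerLift_injective (PadicInt.toZModPow n))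

section PseudoIso

variable {R A M N : Type*} [CommRing R] [CommRing A] [Algebra R A] [AddCommGroup M] [Module A M]
  [AddCommGroup N] [Module A N]

theorem IsPseudoIso.linearEquiv_comp {N' : Type*} [AddCommGroup N'] [Module A N'] {φ : M →ₗ[A] N}
    (hφ : IsPseudoIso φ) (e : N ≃ₗ[A] N') : IsPseudoIso (e.toLinearMap ∘ₗ φ) := by
  obtain ⟨hker, hcoker⟩ := hφ
  refine ⟨by rwa [LinearEquiv.ker_comp], ?_⟩
  exact Finite.of_equiv _ (Submodule.Quotient.equiv _ _ e (LinearMap.range_comp _ _).symm).toEquiv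

variable [Module R M] [IsScalarTower R A M] [Module.Finite R M] [Module R N] [IsScalarTower R A N]

theorem IsPseudoIso.of_smul [Nontrivial R] [Ring.HasFiniteQuotients R] [Module.Finite R N]
    (φ : M →ₗ[A] N) (hker : ∀ m, φ m = 0 → ∃ a ∈ R⁰, a • m = 0)
    (hcoker : ∀ n, ∃ a ∈ R⁰, ∃ m, φ m = a • n) : IsPseudoIso φ := by
  have hkerfin : Finite (LinearMap.ker (φ.restrictScalars R)) :=
    finite_of_isTorsion (R := R) fun x => by
      obtain ⟨a, ha, hx⟩ := hker x.1 x.2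
      exact ⟨⟨a, ha⟩, Subtype.ext hx⟩
  have hcokerfin : Finite (N ⧸ LinearMap.range (φ.restrictScalars R)) :=
    finite_of_isTorsion (R := R) fun x => by
      obtain ⟨n, rfl⟩ := Submodule.mkQ_surjective _ x
      obtain ⟨a, ha, m, hm⟩ := hcoker n
      exact ⟨⟨a, ha⟩, (Submodule.Quotient.mk_eq_zero _).2 ⟨m, hm⟩⟩
  exact ⟨hkerfin, hcokerfin⟩

variable {φ : M →ₗ[A] N}

include R in
theorem IsPseudoIso.finite (hφ : IsPseudoIso φ) : Module.Finite R N := by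
  have : Finite (N ⧸ LinearMap.range (φ.restrictScalars R)) := hφ.2
  exact Module.Finite.of_submodule_quotient (LinearMap.range (φ.restrictScalars R))

theorem IsPseudoIso.finrank_le [IsDomain R] [CharZero R] (hφ : IsPseudoIso φ) :
    Module.finrank R N ≤ Module.finrank R M := by
  have := hφ.finite (R := R)
  let C := N ⧸ LinearMap.range (φ.restrictScalars R)
  have : Finite C := hφ.2
  have hC : Module.finrank R C = 0 := by
    rw [Module.finrank_eq_zero_iff_isTorsion]
    intro x
    refine ⟨⟨(Nat.card C : R), mem_nonZeroDivisors_of_ne_zero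
      (Nat.cast_ne_zero.2 Nat.card_pos.ne')⟩, ?_⟩
    rw [Submonoid.mk_smul, Nat.cast_smul_eq_nsmul, card_nsmul_eq_zero']
  rw [← (LinearMap.range (φ.restrictScalars R)).finrank_quotient_add_finrank, hC, zero_add]
  exact LinearMap.finrank_range_le _

end PseudoIso

variable {p : ℕ} [Fact p.Prime]

/-- The data of the elementary torsion module `⨁ j, Λ / (f_j ^ e_j)`, which has no summands `Λ` or
`Λ / (p ^ μ)`. -/
def ElementaryData.ofDistinguished {t : ℕ} (f : Fin t → ℤ_[p][X]) (e : Fin t → ℕ)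
    (hf : ∀ j, (f j).IsDistinguishedAt (maximalIdeal ℤ_[p])) (hirr : ∀ j, Irreducible (f j))
    (he : ∀ j, 0 < e j) : ElementaryData p where
  r := 0
  s := 0
  mu := Fin.elim0
  mu_pos i := i.elim0
  t := t
  f := f
  distinguished j := PadicInt.maximalIdeal_eq_span_p (p := p) ▸ hf j
  irreducible := hirr
  lam := e
  lam_pos := he

/-- An elementary module without summands `Λ` and `Λ / (p ^ μ)` is `⨁ j, Λ / (f_j ^ λ_j)`. -/
def ElementaryData.modEquiv (D : ElementaryData p) [IsEmpty (Fin D.r)] [IsEmpty (Fin D.s)] :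
    D.Mod ≃ₗ[IwasawaAlg p]
      ((j : Fin D.t) → IwasawaAlg p ⧸ Ideal.span {(D.f j : IwasawaAlg p) ^ D.lam j}) :=
  LinearEquiv.uniqueProd.trans LinearEquiv.uniqueProd

theorem exists_hasIwasawaInvariants (M : Type*) [AddCommGroup M] [Module (IwasawaAlg p) M]
    [Module ℤ_[p] M] [IsScalarTower ℤ_[p] (IwasawaAlg p) M] [Module.Finite ℤ_[p] M] :
    ∃ m l, HasIwasawaInvariants p M m l := by
  obtain ⟨t, f, e, hf, hirr, he, ψ, hker, hcoker⟩ :=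
    exists_linearMap_pi_powerSeries_quotient (A := ℤ_[p]) (M := M)
  have hfin (j : Fin t) := finite_powerSeries_quotient_pow (hf j) (e j)
  let D := ElementaryData.ofDistinguished f e hf hirr he
  have : IsEmpty (Fin D.r) := Fin.isEmpty
  have : IsEmpty (Fin D.s) := Fin.isEmpty
  exact ⟨_, _, D, _, (IsPseudoIso.of_smul ψ hker hcoker).linearEquiv_comp D.modEquiv.symm, rfl, rfl⟩

namespace ElementaryData

variable {D : ElementaryData p}

theorem isEmpty_r (hD : Module.IsTorsion (IwasawaAlg p) D.Mod) : IsEmpty (Fin D.r) := by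
  refine ⟨fun i => ?_⟩
  obtain ⟨⟨h, hh⟩, hD⟩ := @hD (fun _ => 1, 0, 0)
  have hzero : h * 1 = 0 := congrFun (congrArg Prod.fst hD) i
  exact nonZeroDivisors.ne_zero hh (by rwa [mul_one] at hzero)

theorem isEmpty_s {h : ℤ_[p][X]} (hh : h.Monic) (hD : ∀ x : D.Mod, (h : IwasawaAlg p) • x = 0) :
    IsEmpty (Fin D.s) := by
  refine ⟨fun i => ?_⟩
  have hmk : Ideal.Quotient.mk (Ideal.span {(p : IwasawaAlg p) ^ D.mu i})
      ((h : IwasawaAlg p) * 1) = 0 :=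
    congrFun (congrArg (fun z => z.2.1) (hD (0, fun _ => Ideal.Quotient.mk _ 1, 0))) i
  rw [mul_one, Ideal.Quotient.eq_zero_iff_mem, Ideal.mem_span_singleton] at hmk
  refine not_C_dvd_coe_of_monic PadicInt.prime_p.not_isUnit hh ?_
  rw [map_natCast]
  exact (dvd_pow_self _ (D.mu_pos i).ne').trans hmk

theorem finrank_Mod [IsEmpty (Fin D.r)] [IsEmpty (Fin D.s)] :
    Module.finrank ℤ_[p] D.Mod = ∑ j, D.lam j * (D.f j).natDegree := by
  have hdist (j : Fin D.t) : (D.f j).IsDistinguishedAt (maximalIdeal ℤ_[p]) :=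
    PadicInt.maximalIdeal_eq_span_p (p := p) ▸ D.distinguished j
  have hfin (j : Fin D.t) := finite_powerSeries_quotient_pow (hdist j) (D.lam j)
  have hfree (j : Fin D.t) := free_powerSeries_quotient_pow (hdist j) (D.lam j)
  rw [(D.modEquiv.restrictScalars ℤ_[p]).finrank_eq, Module.finrank_pi_fintype]
  exact Finset.sum_congr rfl fun j _ => finrank_powerSeries_quotient_pow (hdist j) (D.lam j)

end ElementaryData

theorem HasIwasawaInvariants.eq_zero_and_le_finrank {M : Type*} [AddCommGroup M]
    [Module (IwasawaAlg p) M] [Module ℤ_[p] M] [IsScalarTower ℤ_[p] (IwasawaAlg p) M]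
    [Module.Finite ℤ_[p] M] {m l : ℕ} (hM : HasIwasawaInvariants p M m l) :
    m = 0 ∧ l ≤ Module.finrank ℤ_[p] M := by
  obtain ⟨D, φ, hφ, hm, hl⟩ := hM
  have : Module.Finite ℤ_[p] D.Mod := hφ.finite
  obtain ⟨h, hh, hD⟩ := exists_isDistinguishedAt_smul_eq_zero (A := ℤ_[p]) D.Mod
  have := ElementaryData.isEmpty_r (isTorsion_powerSeries_of_finite (A := ℤ_[p]) D.Mod)
  have := ElementaryData.isEmpty_s hh.monic hD
  rw [← hm, ← hl, ← ElementaryData.finrank_Mod]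
  exact ⟨Fintype.sum_empty _, hφ.finrank_le⟩

end IwasawaInvariants

/-! ### The dual of the fine Selmer group -/

section FineSelmerDual

theorem PontDual.isScalarTower (p : ℕ) [Fact p.Prime] {A R S : Type*} [AddCommGroup A] [CommRing R]
    [CommRing S] [Algebra R S] [Module R A] [Module S A] [IsScalarTower R S A] :
    IsScalarTower R S (PontDual p A) :=
  ⟨fun r s f => AddMonoidHom.ext fun a => congrArg (toHom f) <|
    show (r • s) • a = s • r • a by rw [smul_assoc, smul_comm]⟩

theorem PontDual.iwasawaInvariants_of_card_le (p : ℕ) [Fact p.Prime] {A : Type*} [AddCommGroup A]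
    [Module (IwasawaAlg p) A] (hA : ∀ a : A, ∃ k : ℕ, p ^ k • a = 0) {B : ℕ}
    [Finite {a : A // p • a = 0}] (hB : Nat.card {a : A // p • a = 0} ≤ p ^ B) :
    Module.Finite (IwasawaAlg p) (PontDual p A) ∧
    Module.IsTorsion (IwasawaAlg p) (PontDual p A) ∧
    (∃ m l, HasIwasawaInvariants p (PontDual p A) m l) ∧
    ∀ m l, HasIwasawaInvariants p (PontDual p A) m l → m = 0 ∧ l ≤ B := by
  let _ : Module ℤ_[p] A := Module.compHom A (algebraMap ℤ_[p] (IwasawaAlg p))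
  have : IsScalarTower ℤ_[p] (IwasawaAlg p) A := .of_algebraMap_smul fun _ _ => rfl
  have := PontDual.isScalarTower p (A := A) (R := ℤ_[p]) (S := IwasawaAlg p)
  obtain ⟨f, hf⟩ := PontDual.exists_surjective_of_card_le p hA hB
  have : Module.Finite ℤ_[p] (PontDual p A) := .of_surjective f hf
  have : Module.Finite (IwasawaAlg p) (PontDual p A) := .of_restrictScalars_finite ℤ_[p] _ _
  have hrank : Module.finrank ℤ_[p] (PontDual p A) ≤ B := by
    have h := LinearMap.finrank_range_le f
    rwa [LinearMap.range_eq_top.2 hf, finrank_top, Module.finrank_fin_fun] at h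
  exact ⟨this, isTorsion_powerSeries_of_finite (A := ℤ_[p]) _, exists_hasIwasawaInvariants _,
    fun m l h => h.eq_zero_and_le_finrank.imp_right hrank.trans'⟩

open NumberField IsDedekindDomain FineSelmer in
theorem proposition3p1_general {F : Type*} [Field F] [NumberField F] (p : ℕ) [Fact p.Prime]
    (E : WeierstrassCurve F) [E.IsElliptic]
    (Finf : IntermediateField F (AlgebraicClosure F)) [IsGalois F Finf] [IsZpExtension p F Finf]
    (γ : Gal(Finf/F)) (hker : Finite (hMap E p Finf).ker)
    (hR : Finite (fineSelmer E p 1 Finf)) :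
    Module.Finite (IwasawaAlg p) (PontDual p (SelmerModule E p γ)) ∧
    Module.IsTorsion (IwasawaAlg p) (PontDual p (SelmerModule E p γ)) ∧
    (∃ m l, HasIwasawaInvariants p (PontDual p (SelmerModule E p γ)) m l) ∧
    ∀ m l, HasIwasawaInvariants p (PontDual p (SelmerModule E p γ)) m l →
      m = 0 ∧ l ≤ Module.finrank (ZMod p) (fineSelmer E p 1 Finf) +
        Module.finrank (ZMod p) (hMap E p Finf).ker := by
  obtain ⟨hfin, hcard⟩ :=
    finite_torsion_fineSelmer_and_card_le E p Finf (Fact.out : p.Prime).ne_zero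
  have : Finite {c : SelmerModule E p γ // p • c = 0} := hfin
  have hprimary (c : SelmerModule E p γ) : ∃ k : ℕ, p ^ k • c = 0 :=
    (gammaAct_nilpotent E p ⊤ γ c).imp fun _ h => h.1
  refine PontDual.iwasawaInvariants_of_card_le p hprimary (hcard.trans_eq ?_)
  rw [pow_add, Module.natCard_eq_pow_finrank (K := ZMod p) (V := fineSelmer E p 1 Finf),
    Module.natCard_eq_pow_finrank (K := ZMod p) (V := (hMap E p Finf).ker), Nat.card_zmod]

end FineSelmerDual

open NumberField IsDedekindDomain FineSelmer in
theorem proposition3p1 {F : Type*} [Field F] [NumberField F] (p : ℕ) [Fact p.Prime] (hp : p ≠ 2)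
    (E : WeierstrassCurve F) [E.IsElliptic]
    (hgood : ∀ v : HeightOneSpectrum (𝓞 F), (p : 𝓞 F) ∈ v.asIdeal → HasGoodReductionAt E v)
    (Finf : IntermediateField F (AlgebraicClosure F)) [IsGalois F Finf] [IsZpExtension p F Finf]
    (γ : Gal(Finf/F)) (hγ : (Subgroup.zpowers γ).topologicalClosure = ⊤)
    (hker : Finite (hMap E p Finf).ker)
    (hR : Finite (fineSelmer E p 1 Finf)) :
    Module.Finite (IwasawaAlg p) (PontDual p (SelmerModule E p γ)) ∧
    Module.IsTorsion (IwasawaAlg p) (PontDual p (SelmerModule E p γ)) ∧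
    (∃ m l, HasIwasawaInvariants p (PontDual p (SelmerModule E p γ)) m l) ∧
    ∀ m l, HasIwasawaInvariants p (PontDual p (SelmerModule E p γ)) m l →
      m = 0 ∧ l ≤ Module.finrank (ZMod p) (fineSelmer E p 1 Finf) +
        Module.finrank (ZMod p) (hMap E p Finf).ker :=
  proposition3p1_general p E Finf γ hker hR

end
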